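/- Let $K=\mathbb R$ or $K=\mathbb C$ and let $q,Q_1$ be real. Let $A=A_{q,Q_1}$ be the unital associative $K$-algebra generated by $a,a^*,q^N$ (the symbol $q^N$ denotes a generator) with the relations $$a\,q^N=q\,q^Na,\qquad q^Na^*=q\,a^*q^N,\qquad aa^*-Q_1a^*a=(q^N)^2$$ (the first-type Fibonacci oscillator). A *braided Hopf algebra structure* on $A$ consists of linear maps $\Delta:A\to A\otimes A$, $\epsilon:A\to K$, $S:A\to A$, $\psi:A\otimes A\to A\otimes A$ such that, with $m$ and $\eta$ the multiplication and unit maps of $A$, $$(\mathrm{id}\otimes\Delta)\Delta=(\Delta\otimes\mathrm{id})\Delta,\quad (\epsilon\otimes\mathrm{id})\Delta=(\mathrm{id}\otimes\epsilon)\Delta=\mathrm{id},\quad m(\mathrm{id}\otimes S)\Delta=m(S\otimes\mathrm{id})\Delta=\eta\epsilon,$$ $$\psi(m\otimes\mathrm{id})=(\mathrm{id}\otimes m)(\psi\otimes\mathrm{id})(\mathrm{id}\otimes\psi),\quad \psi(\mathrm{id}\otimes m)=(m\otimes\mathrm{id})(\mathrm{id}\otimes\psi)(\psi\otimes\mathrm{id}),$$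 $$(\mathrm{id}\otimes\Delta)\psi=(\psi\otimes\mathrm{id})(\mathrm{id}\otimes\psi)(\Delta\otimes\mathrm{id}),\quad (\Delta\otimes\mathrm{id})\psi=(\mathrm{id}\otimes\psi)(\psi\otimes\mathrm{id})(\mathrm{id}\otimes\Delta),$$ $$\Delta m=(m\otimes m)(\mathrm{id}\otimes\psi\otimes\mathrm{id})(\Delta\otimes\Delta),\quad Sm=m\psi(S\otimes S),\quad \Delta S=(S\otimes S)\psi\Delta,\quad \epsilon m=\epsilon\otimes\epsilon,$$ $$(\psi\otimes\mathrm{id})(\mathrm{id}\otimes\psi)(\psi\otimes\mathrm{id})=(\mathrm{id}\otimes\psi)(\psi\otimes\mathrm{id})(\mathrm{id}\otimes\psi),$$ $$\Delta(1)=1\otimes1,\quad \psi(1\otimes x)=x\otimes1,\quad \psi(x\otimes1)=1\otimes x\quad(x\in A).$$ It is *of the ansatz form* if there are constants in $K$ such that $$\begin{aligned} \Delta(q^N)&=A_1q^N\otimes q^N+A_2a\otimes a^*+A_3a^*\otimes a+A_41\otimes q^N+A_5q^N\otimes1+A_61\otimes1,\\ \Delta(a)&=B_1q^N\otimes a+B_2a\otimes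 q^N+B_31\otimes a+B_4a\otimes1,\\ \Delta(a^*)&=B_1a^*\otimes q^N+B_2q^N\otimes a^*+B_3a^*\otimes1+B_41\otimes a^*,\\ \epsilon(q^N)&=e_1,\qquad \epsilon(a)=\epsilon(a^*)=e_2,\\ S(q^N)&=k_1q^N+k_2a+k_3a^*+k_4,\\ S(a)&=m_1q^N+m_2a+m_3a^*+m_4,\qquad S(a^*)=m_1q^N+m_2a^*+m_3a+m_4,\\ \psi(q^N\otimes q^N)&=g_1q^N\otimes q^N+g_2a\otimes a^*+g_3a^*\otimes a+g_41\otimes q^N+g_5q^N\otimes1+g_61\otimes1,\\ \psi(q^N\otimes a)&=d_1a\otimes q^N+d_2q^N\otimes a+d_31\otimes a+d_4a\otimes1,\\ \psi(a^*\otimes q^N)&=d_1q^N\otimes a^*+d_2a^*\otimes q^N+d_3a^*\otimes1+d_41\otimes a^*,\\ \psi(q^N\otimes a^*)&=f_1a^*\otimes q^N+f_2q^N\otimes a^*+f_31\otimes a^*+f_4a^*\otimes1,\\ \psi(a\otimes q^N)&=f_1q^N\otimes a+f_2a\otimes q^N+f_3a\otimes1+f_41\otimes a,\\ \psi(a\otimes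 a)&=z\,a\otimes a,\qquad \psi(a^*\otimes a^*)=z\,a^*\otimes a^*,\\ \psi(a\otimes a^*)&=b_1q^N\otimes q^N+b_2a\otimes a^*+b_3a^*\otimes a+b_41\otimes q^N+b_5q^N\otimes1+b_61\otimes1,\\ \psi(a^*\otimes a)&=c_1q^N\otimes q^N+c_2a\otimes a^*+c_3a^*\otimes a+c_41\otimes q^N+c_5q^N\otimes1+c_61\otimes1. \end{aligned}$$ **Theorem.** (i) Suppose $q\ne0$, $Q_1\ne0$, $Q_1\ne\pm q^2$, and let $s=\sqrt{Q_1}\in K$ be a square root of $Q_1$ (it is assumed to exist in $K$). Then there are exactly six braided Hopf algebra structures of the ansatz form on $A$. In all of them $A_1=A_2=A_3=A_6=B_1=B_2=0$, $A_4=A_5=B_3=B_4=1$, $e_1=e_2=0$, $k_1=m_2=-1$, $k_2=k_3=k_4=m_1=m_3=m_4=0$, $b_j=c_j=g_j=0$ for $j=4,5,6$, $d_3=d_4=f_3=f_4=0$. The remaining constants are given by the columns of the following table; the six columns are pairwise different, and each of them belongs to exactly one structure. $$\begin{array}{c|cccccc} &\text{sol1}&\text{sol2}&\text{sol3}&\text{sol4}&\text{sol5}&\text{sol6}\\\hline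 b_1&1&1-\frac qs&1+\frac qs&\frac{Q_1}{q^2}&0&0\\ b_2&\frac{q^2-Q_1}{Q_1}&\frac{(q^2-Q_1)(s+q)}{qQ_1}&\frac{(Q_1-q^2)(s-q)}{qQ_1}&0&0&0\\ b_3&Q_1&Q_1&Q_1&\frac{Q_1^2}{q^2}&Q_1&Q_1\\ z&\frac{q^2}{Q_1}&\frac{q^2}{Q_1}&\frac{q^2}{Q_1}&\frac{Q_1}{q^2}&\frac{Q_1}{q^2}&\frac{Q_1}{q^2}\\ c_1&-\frac{q^2}{Q_1^2}&0&0&-\frac1{Q_1}&-\frac{q+s}{qQ_1}&\frac{s-q}{qQ_1}\\ c_2&\frac{q^2}{Q_1^2}&\frac1{Q_1}&\frac1{Q_1}&\frac1{Q_1}&\frac1{Q_1}&\frac1{Q_1}\\ c_3&0&0&0&\frac{Q_1-q^2}{q^2}&\frac{(q^2-Q_1)(q-s)}{q^2s}&\frac{(Q_1-q^2)(q+s)}{q^2s}\\ d_1&\frac q{Q_1}&\frac q{Q_1}&\frac q{Q_1}&q^{-1}&q^{-1}&q^{-1}\\ d_2&0&0&0&\frac{Q_1-q^2}{q^2}&\frac{Q_1-q^2}{q^2}&\frac{Q_1-q^2}{q^2}\\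 f_1&q&q&q&\frac{Q_1}q&\frac{Q_1}q&\frac{Q_1}q\\ f_2&\frac{q^2-Q_1}{Q_1}&\frac{q^2-Q_1}{Q_1}&\frac{q^2-Q_1}{Q_1}&0&0&0\\ g_1&\frac{q^2}{Q_1}&-\frac qs&\frac qs&\frac{Q_1}{q^2}&\frac sq&-\frac sq\\ g_2&0&\frac{(q^2-Q_1)(s+q)}{qQ_1}&\frac{(Q_1-q^2)(s-q)}{qQ_1}&0&0&0\\ g_3&0&0&0&0&-\frac{Q_1(Q_1-q^2)^2}{q^2(Q_1+qs)}&\frac{Q_1(Q_1-q^2)^2}{q^2(qs-Q_1)} \end{array}$$ (ii) In particular, if $q\notin\{0,1,-1\}$, then (i) with $Q_1=q^{-2}$ and $s=q^{-1}$ gives exactly six braided Hopf algebra structures of the ansatz form for the first-type Biedenharn–Macfarlane oscillator $aa^*-q^{-2}a^*a=(q^N)^2$. (iii) If $q\ne0$, $Q_1>0$ and $Q_1\ne q^2$, then $A$ has a unique conjugate-linear unital anti-multiplicative map $*$ with $a\mapsto a^*$, $a^*\mapsto a$, $q^N\mapsto q^N$, and every braided Hopf algebra structure of the ansatz form satisfies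 $\Delta\circ*=\pi\circ(*\otimes*)\circ\Delta$ and $S\circ*=*\circ S$, where $\pi$ is the flip. -/

import Mathlib

open scoped TensorProduct

/-! ### Braided Hopf algebra structures -/

section BraidedHopf

variable (K A : Type*) [CommRing K] [Ring A] [Algebra K A]

/-- `ψ ⊗ id` on `A ⊗ A ⊗ A`, bracketed to the right. -/
def onFirstTwo (ψ : A ⊗[K] A →ₗ[K] A ⊗[K] A) :
    A ⊗[K] (A ⊗[K] A) →ₗ[K] A ⊗[K] (A ⊗[K] A) :=
  (TensorProduct.assoc K A A A).toLinearMap ∘ₗ ψ.rTensor A ∘ₗ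
    (TensorProduct.assoc K A A A).symm.toLinearMap

/-- `id ⊗ ψ` on `A ⊗ A ⊗ A`, bracketed to the right. -/
def onLastTwo (ψ : A ⊗[K] A →ₗ[K] A ⊗[K] A) :
    A ⊗[K] (A ⊗[K] A) →ₗ[K] A ⊗[K] (A ⊗[K] A) :=
  ψ.lTensor A

/-- `id ⊗ ψ ⊗ id` on `(A ⊗ A) ⊗ (A ⊗ A)`. -/
def onMiddleTwo (ψ : A ⊗[K] A →ₗ[K] A ⊗[K] A) :
    (A ⊗[K] A) ⊗[K] (A ⊗[K] A) →ₗ[K] (A ⊗[K] A) ⊗[K] (A ⊗[K] A) :=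
  (TensorProduct.assoc K A A (A ⊗[K] A)).symm.toLinearMap ∘ₗ
    (onFirstTwo K A ψ).lTensor A ∘ₗ
    (TensorProduct.assoc K A A (A ⊗[K] A)).toLinearMap

/-- A braided Hopf algebra structure on the unital associative algebra `A`: linear maps `Δ`, `ε`,
`S` and `ψ` that satisfy, together with the multiplication and the unit of `A`, the axioms of a
braided Hopf algebra. -/
@[ext]
structure BraidedHopfStructure where
  comul : A →ₗ[K] A ⊗[K] A
  counit : A →ₗ[K] K
  antipode : A →ₗ[K] A
  braiding : A ⊗[K] A →ₗ[K] A ⊗[K] A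
  /-- `(id ⊗ Δ) ∘ Δ = (Δ ⊗ id) ∘ Δ` -/
  coassoc : comul.lTensor A ∘ₗ comul =
    (TensorProduct.assoc K A A A).toLinearMap ∘ₗ comul.rTensor A ∘ₗ comul
  /-- `(ε ⊗ id) ∘ Δ = id` -/
  counit_comul :
    (TensorProduct.lid K A).toLinearMap ∘ₗ counit.rTensor A ∘ₗ comul = LinearMap.id
  /-- `(id ⊗ ε) ∘ Δ = id` -/
  comul_counit :
    (TensorProduct.rid K A).toLinearMap ∘ₗ counit.lTensor A ∘ₗ comul = LinearMap.id
  /-- `m ∘ (id ⊗ S) ∘ Δ = η ∘ ε` -/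
  mul_antipode_right :
    LinearMap.mul' K A ∘ₗ antipode.lTensor A ∘ₗ comul = Algebra.linearMap K A ∘ₗ counit
  /-- `m ∘ (S ⊗ id) ∘ Δ = η ∘ ε` -/
  mul_antipode_left :
    LinearMap.mul' K A ∘ₗ antipode.rTensor A ∘ₗ comul = Algebra.linearMap K A ∘ₗ counit
  /-- `ψ ∘ (m ⊗ id) = (id ⊗ m) ∘ (ψ ⊗ id) ∘ (id ⊗ ψ)` -/
  braiding_mul_left :
    braiding ∘ₗ (LinearMap.mul' K A).rTensor A ∘ₗ
        (TensorProduct.assoc K A A A).symm.toLinearMap =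
      (LinearMap.mul' K A).lTensor A ∘ₗ onFirstTwo K A braiding ∘ₗ onLastTwo K A braiding
  /-- `ψ ∘ (id ⊗ m) = (m ⊗ id) ∘ (id ⊗ ψ) ∘ (ψ ⊗ id)` -/
  braiding_mul_right :
    braiding ∘ₗ (LinearMap.mul' K A).lTensor A =
      (LinearMap.mul' K A).rTensor A ∘ₗ (TensorProduct.assoc K A A A).symm.toLinearMap ∘ₗ
        onLastTwo K A braiding ∘ₗ onFirstTwo K A braiding
  /-- `(id ⊗ Δ) ∘ ψ = (ψ ⊗ id) ∘ (id ⊗ ψ) ∘ (Δ ⊗ id)` -/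
  comul_right_braiding :
    comul.lTensor A ∘ₗ braiding =
      onFirstTwo K A braiding ∘ₗ onLastTwo K A braiding ∘ₗ
        (TensorProduct.assoc K A A A).toLinearMap ∘ₗ comul.rTensor A
  /-- `(Δ ⊗ id) ∘ ψ = (id ⊗ ψ) ∘ (ψ ⊗ id) ∘ (id ⊗ Δ)` -/
  comul_left_braiding :
    (TensorProduct.assoc K A A A).toLinearMap ∘ₗ comul.rTensor A ∘ₗ braiding =
      onLastTwo K A braiding ∘ₗ onFirstTwo K A braiding ∘ₗ comul.lTensor A
  /-- `Δ ∘ m = (m ⊗ m) ∘ (id ⊗ ψ ⊗ id) ∘ (Δ ⊗ Δ)` -/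
  comul_mul :
    comul ∘ₗ LinearMap.mul' K A =
      TensorProduct.map (LinearMap.mul' K A) (LinearMap.mul' K A) ∘ₗ
        onMiddleTwo K A braiding ∘ₗ TensorProduct.map comul comul
  /-- `S ∘ m = m ∘ ψ ∘ (S ⊗ S)` -/
  antipode_mul :
    antipode ∘ₗ LinearMap.mul' K A =
      LinearMap.mul' K A ∘ₗ braiding ∘ₗ TensorProduct.map antipode antipode
  /-- `Δ ∘ S = (S ⊗ S) ∘ ψ ∘ Δ` -/
  comul_antipode :
    comul ∘ₗ antipode = TensorProduct.map antipode antipode ∘ₗ braiding ∘ₗ comul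
  /-- `ε ∘ m = ε ⊗ ε` -/
  counit_mul :
    counit ∘ₗ LinearMap.mul' K A = LinearMap.mul' K K ∘ₗ TensorProduct.map counit counit
  /-- `(ψ ⊗ id) ∘ (id ⊗ ψ) ∘ (ψ ⊗ id) = (id ⊗ ψ) ∘ (ψ ⊗ id) ∘ (id ⊗ ψ)` -/
  yang_baxter :
    onFirstTwo K A braiding ∘ₗ onLastTwo K A braiding ∘ₗ onFirstTwo K A braiding =
      onLastTwo K A braiding ∘ₗ onFirstTwo K A braiding ∘ₗ onLastTwo K A braiding
  comul_one : comul 1 = 1 ⊗ₜ 1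
  braiding_one_left : ∀ x : A, braiding (1 ⊗ₜ x) = x ⊗ₜ 1
  braiding_one_right : ∀ x : A, braiding (x ⊗ₜ 1) = 1 ⊗ₜ x

end BraidedHopf

/-! ### The first-type Fibonacci oscillator algebra -/

/-- The generators `a`, `a*`, `q^N`. -/
inductive OscGen where
  | a
  | aStar
  | qN

/-- The defining relations `a q^N = q q^N a`, `q^N a* = q a* q^N`,
`a a* - Q₁ a* a = (q^N)²`. -/
inductive FibRel {K : Type*} [CommRing K] (q Q₁ : K) :
    FreeAlgebra K OscGen → FreeAlgebra K OscGen → Prop where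
  | a_qN : FibRel q Q₁
      (FreeAlgebra.ι K OscGen.a * FreeAlgebra.ι K OscGen.qN)
      (q • (FreeAlgebra.ι K OscGen.qN * FreeAlgebra.ι K OscGen.a))
  | qN_aStar : FibRel q Q₁
      (FreeAlgebra.ι K OscGen.qN * FreeAlgebra.ι K OscGen.aStar)
      (q • (FreeAlgebra.ι K OscGen.aStar * FreeAlgebra.ι K OscGen.qN))
  | a_aStar : FibRel q Q₁
      (FreeAlgebra.ι K OscGen.a * FreeAlgebra.ι K OscGen.aStar
        - Q₁ • (FreeAlgebra.ι K OscGen.aStar * FreeAlgebra.ι K OscGen.a))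
      (FreeAlgebra.ι K OscGen.qN ^ 2)

/-- The unital associative `K`-algebra generated by `a`, `a*`, `q^N` with the relations above. -/
abbrev FibOsc {K : Type*} [CommRing K] (q Q₁ : K) : Type _ := RingQuot (FibRel q Q₁)

namespace FibOsc

variable {K : Type*} [CommRing K] (q Q₁ : K)

/-- The class of a generator in the oscillator algebra. -/
def gen (x : OscGen) : FibOsc q Q₁ :=
  RingQuot.mkAlgHom K (FibRel q Q₁) (FreeAlgebra.ι K x)

/-- The generator `a`. -/
def a : FibOsc q Q₁ := gen q Q₁ OscGen.a

/-- The generator `a*`. -/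
def aStar : FibOsc q Q₁ := gen q Q₁ OscGen.aStar

/-- The generator `q^N`. -/
def qN : FibOsc q Q₁ := gen q Q₁ OscGen.qN

end FibOsc

/-! ### The ansatz -/

/-- The constants of the ansatz. -/
@[ext]
structure AnsatzConstants (K : Type*) where
  (A₁ A₂ A₃ A₄ A₅ A₆ : K)
  (B₁ B₂ B₃ B₄ : K)
  (e₁ e₂ : K)
  (k₁ k₂ k₃ k₄ : K)
  (m₁ m₂ m₃ m₄ : K)
  (g₁ g₂ g₃ g₄ g₅ g₆ : K)
  (d₁ d₂ d₃ d₄ : K)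
  (f₁ f₂ f₃ f₄ : K)
  (z : K)
  (b₁ b₂ b₃ b₄ b₅ b₆ : K)
  (c₁ c₂ c₃ c₄ c₅ c₆ : K)

open FibOsc in
/-- The structure `H` on the first-type Fibonacci oscillator algebra is of the ansatz form with
constants `C`. -/
structure HasAnsatzForm {K : Type*} [CommRing K] {q Q₁ : K}
    (H : BraidedHopfStructure K (FibOsc q Q₁)) (C : AnsatzConstants K) : Prop where
  comul_qN : H.comul (qN q Q₁) =
    C.A₁ • (qN q Q₁ ⊗ₜ qN q Q₁) + C.A₂ • (a q Q₁ ⊗ₜ aStar q Q₁)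
      + C.A₃ • (aStar q Q₁ ⊗ₜ a q Q₁) + C.A₄ • (1 ⊗ₜ qN q Q₁)
      + C.A₅ • (qN q Q₁ ⊗ₜ 1) + C.A₆ • (1 ⊗ₜ 1)
  comul_a : H.comul (a q Q₁) =
    C.B₁ • (qN q Q₁ ⊗ₜ a q Q₁) + C.B₂ • (a q Q₁ ⊗ₜ qN q Q₁)
      + C.B₃ • (1 ⊗ₜ a q Q₁) + C.B₄ • (a q Q₁ ⊗ₜ 1)
  comul_aStar : H.comul (aStar q Q₁) =
    C.B₁ • (aStar q Q₁ ⊗ₜ qN q Q₁) + C.B₂ • (qN q Q₁ ⊗ₜ aStar q Q₁)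
      + C.B₃ • (aStar q Q₁ ⊗ₜ 1) + C.B₄ • (1 ⊗ₜ aStar q Q₁)
  counit_qN : H.counit (qN q Q₁) = C.e₁
  counit_a : H.counit (a q Q₁) = C.e₂
  counit_aStar : H.counit (aStar q Q₁) = C.e₂
  antipode_qN : H.antipode (qN q Q₁) =
    C.k₁ • qN q Q₁ + C.k₂ • a q Q₁ + C.k₃ • aStar q Q₁ + C.k₄ • 1
  antipode_a : H.antipode (a q Q₁) =
    C.m₁ • qN q Q₁ + C.m₂ • a q Q₁ + C.m₃ • aStar q Q₁ + C.m₄ • 1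
  antipode_aStar : H.antipode (aStar q Q₁) =
    C.m₁ • qN q Q₁ + C.m₂ • aStar q Q₁ + C.m₃ • a q Q₁ + C.m₄ • 1
  braiding_qN_qN : H.braiding (qN q Q₁ ⊗ₜ qN q Q₁) =
    C.g₁ • (qN q Q₁ ⊗ₜ qN q Q₁) + C.g₂ • (a q Q₁ ⊗ₜ aStar q Q₁)
      + C.g₃ • (aStar q Q₁ ⊗ₜ a q Q₁) + C.g₄ • (1 ⊗ₜ qN q Q₁)
      + C.g₅ • (qN q Q₁ ⊗ₜ 1) + C.g₆ • (1 ⊗ₜ 1)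
  braiding_qN_a : H.braiding (qN q Q₁ ⊗ₜ a q Q₁) =
    C.d₁ • (a q Q₁ ⊗ₜ qN q Q₁) + C.d₂ • (qN q Q₁ ⊗ₜ a q Q₁)
      + C.d₃ • (1 ⊗ₜ a q Q₁) + C.d₄ • (a q Q₁ ⊗ₜ 1)
  braiding_aStar_qN : H.braiding (aStar q Q₁ ⊗ₜ qN q Q₁) =
    C.d₁ • (qN q Q₁ ⊗ₜ aStar q Q₁) + C.d₂ • (aStar q Q₁ ⊗ₜ qN q Q₁)
      + C.d₃ • (aStar q Q₁ ⊗ₜ 1) + C.d₄ • (1 ⊗ₜ aStar q Q₁)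
  braiding_qN_aStar : H.braiding (qN q Q₁ ⊗ₜ aStar q Q₁) =
    C.f₁ • (aStar q Q₁ ⊗ₜ qN q Q₁) + C.f₂ • (qN q Q₁ ⊗ₜ aStar q Q₁)
      + C.f₃ • (1 ⊗ₜ aStar q Q₁) + C.f₄ • (aStar q Q₁ ⊗ₜ 1)
  braiding_a_qN : H.braiding (a q Q₁ ⊗ₜ qN q Q₁) =
    C.f₁ • (qN q Q₁ ⊗ₜ a q Q₁) + C.f₂ • (a q Q₁ ⊗ₜ qN q Q₁)
      + C.f₃ • (a q Q₁ ⊗ₜ 1) + C.f₄ • (1 ⊗ₜ a q Q₁)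
  braiding_a_a : H.braiding (a q Q₁ ⊗ₜ a q Q₁) = C.z • (a q Q₁ ⊗ₜ a q Q₁)
  braiding_aStar_aStar : H.braiding (aStar q Q₁ ⊗ₜ aStar q Q₁) =
    C.z • (aStar q Q₁ ⊗ₜ aStar q Q₁)
  braiding_a_aStar : H.braiding (a q Q₁ ⊗ₜ aStar q Q₁) =
    C.b₁ • (qN q Q₁ ⊗ₜ qN q Q₁) + C.b₂ • (a q Q₁ ⊗ₜ aStar q Q₁)
      + C.b₃ • (aStar q Q₁ ⊗ₜ a q Q₁) + C.b₄ • (1 ⊗ₜ qN q Q₁)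
      + C.b₅ • (qN q Q₁ ⊗ₜ 1) + C.b₆ • (1 ⊗ₜ 1)
  braiding_aStar_a : H.braiding (aStar q Q₁ ⊗ₜ a q Q₁) =
    C.c₁ • (qN q Q₁ ⊗ₜ qN q Q₁) + C.c₂ • (a q Q₁ ⊗ₜ aStar q Q₁)
      + C.c₃ • (aStar q Q₁ ⊗ₜ a q Q₁) + C.c₄ • (1 ⊗ₜ qN q Q₁)
      + C.c₅ • (qN q Q₁ ⊗ₜ 1) + C.c₆ • (1 ⊗ₜ 1)

/-! ### The table of the six solutions -/

/-- The constants that are common to all solutions; the others are set to `0` here. -/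
def commonConstants (K : Type*) [Field K] : AnsatzConstants K where
  A₁ := 0
  A₂ := 0
  A₃ := 0
  A₄ := 1
  A₅ := 1
  A₆ := 0
  B₁ := 0
  B₂ := 0
  B₃ := 1
  B₄ := 1
  e₁ := 0
  e₂ := 0
  k₁ := -1
  k₂ := 0
  k₃ := 0
  k₄ := 0
  m₁ := 0
  m₂ := -1
  m₃ := 0
  m₄ := 0
  g₁ := 0
  g₂ := 0
  g₃ := 0
  g₄ := 0
  g₅ := 0
  g₆ := 0
  d₁ := 0
  d₂ := 0
  d₃ := 0
  d₄ := 0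
  f₁ := 0
  f₂ := 0
  f₃ := 0
  f₄ := 0
  z := 0
  b₁ := 0
  b₂ := 0
  b₃ := 0
  b₄ := 0
  b₅ := 0
  b₆ := 0
  c₁ := 0
  c₂ := 0
  c₃ := 0
  c₄ := 0
  c₅ := 0
  c₆ := 0

/-- The six solutions; `s` stands for `√Q₁`. -/
def fibTable {K : Type*} [Field K] (q Q₁ s : K) : Fin 6 → AnsatzConstants K := ![
  { commonConstants K with
    b₁ := 1
    b₂ := (q ^ 2 - Q₁) / Q₁
    b₃ := Q₁
    z := q ^ 2 / Q₁
    c₁ := -(q ^ 2 / Q₁ ^ 2)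
    c₂ := q ^ 2 / Q₁ ^ 2
    c₃ := 0
    d₁ := q / Q₁
    d₂ := 0
    f₁ := q
    f₂ := (q ^ 2 - Q₁) / Q₁
    g₁ := q ^ 2 / Q₁
    g₂ := 0
    g₃ := 0 },
  { commonConstants K with
    b₁ := 1 - q / s
    b₂ := (q ^ 2 - Q₁) * (s + q) / (q * Q₁)
    b₃ := Q₁
    z := q ^ 2 / Q₁
    c₁ := 0
    c₂ := 1 / Q₁
    c₃ := 0
    d₁ := q / Q₁
    d₂ := 0
    f₁ := q
    f₂ := (q ^ 2 - Q₁) / Q₁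
    g₁ := -(q / s)
    g₂ := (q ^ 2 - Q₁) * (s + q) / (q * Q₁)
    g₃ := 0 },
  { commonConstants K with
    b₁ := 1 + q / s
    b₂ := (Q₁ - q ^ 2) * (s - q) / (q * Q₁)
    b₃ := Q₁
    z := q ^ 2 / Q₁
    c₁ := 0
    c₂ := 1 / Q₁
    c₃ := 0
    d₁ := q / Q₁
    d₂ := 0
    f₁ := q
    f₂ := (q ^ 2 - Q₁) / Q₁
    g₁ := q / s
    g₂ := (Q₁ - q ^ 2) * (s - q) / (q * Q₁)
    g₃ := 0 },
  { commonConstants K with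
    b₁ := Q₁ / q ^ 2
    b₂ := 0
    b₃ := Q₁ ^ 2 / q ^ 2
    z := Q₁ / q ^ 2
    c₁ := -1 / Q₁
    c₂ := 1 / Q₁
    c₃ := (Q₁ - q ^ 2) / q ^ 2
    d₁ := q⁻¹
    d₂ := (Q₁ - q ^ 2) / q ^ 2
    f₁ := Q₁ / q
    f₂ := 0
    g₁ := Q₁ / q ^ 2
    g₂ := 0
    g₃ := 0 },
  { commonConstants K with
    b₁ := 0
    b₂ := 0
    b₃ := Q₁
    z := Q₁ / q ^ 2
    c₁ := -((q + s) / (q * Q₁))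
    c₂ := 1 / Q₁
    c₃ := (q ^ 2 - Q₁) * (q - s) / (q ^ 2 * s)
    d₁ := q⁻¹
    d₂ := (Q₁ - q ^ 2) / q ^ 2
    f₁ := Q₁ / q
    f₂ := 0
    g₁ := s / q
    g₂ := 0
    g₃ := -(Q₁ * (Q₁ - q ^ 2) ^ 2 / (q ^ 2 * (Q₁ + q * s))) },
  { commonConstants K with
    b₁ := 0
    b₂ := 0
    b₃ := Q₁
    z := Q₁ / q ^ 2
    c₁ := (s - q) / (q * Q₁)
    c₂ := 1 / Q₁
    c₃ := (Q₁ - q ^ 2) * (q + s) / (q ^ 2 * s)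
    d₁ := q⁻¹
    d₂ := (Q₁ - q ^ 2) / q ^ 2
    f₁ := Q₁ / q
    f₂ := 0
    g₁ := -(s / q)
    g₂ := 0
    g₃ := Q₁ * (Q₁ - q ^ 2) ^ 2 / (q ^ 2 * (q * s - Q₁)) }]

/-- The braided Hopf algebra structures of the ansatz form on the first-type Fibonacci oscillator
algebra are exactly the six solutions of the table: the six lists of constants are pairwise
distinct, each of them is realized by exactly one structure, there is no other admissible list of
constants, and altogether there are exactly six structures. -/
def ExactlySixSolutions {K : Type*} [Field K] (q Q₁ s : K) : Prop :=
  Function.Injective (fibTable q Q₁ s) ∧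
  (∀ i : Fin 6, ∃! H : BraidedHopfStructure K (FibOsc q Q₁),
    HasAnsatzForm H (fibTable q Q₁ s i)) ∧
  (∀ (H : BraidedHopfStructure K (FibOsc q Q₁)) (C : AnsatzConstants K),
    HasAnsatzForm H C → ∃ i : Fin 6, C = fibTable q Q₁ s i) ∧
  {H : BraidedHopfStructure K (FibOsc q Q₁) |
    ∃ C : AnsatzConstants K, HasAnsatzForm H C}.ncard = 6

/-! ### The `*`-structure -/

section StarStructure

variable {𝕜 : Type*} [RCLike 𝕜] {q Q₁ : 𝕜}

/-- `st` is the `*`-structure of the oscillator algebra: the conjugate-linear anti-multiplicative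
map that exchanges `a` and `a*` and fixes `q^N`. -/
structure IsOscStar (st : FibOsc q Q₁ →ₛₗ[starRingEnd 𝕜] FibOsc q Q₁) : Prop where
  map_one : st 1 = 1
  map_mul : ∀ x y, st (x * y) = st y * st x
  map_a : st (FibOsc.a q Q₁) = FibOsc.aStar q Q₁
  map_aStar : st (FibOsc.aStar q Q₁) = FibOsc.a q Q₁
  map_qN : st (FibOsc.qN q Q₁) = FibOsc.qN q Q₁

/-- The compatibility `Δ ∘ * = π ∘ (* ⊗ *) ∘ Δ` and `S ∘ * = * ∘ S`, where `π` is the flip. -/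
def IsStarCompatible (st : FibOsc q Q₁ →ₛₗ[starRingEnd 𝕜] FibOsc q Q₁)
    (H : BraidedHopfStructure 𝕜 (FibOsc q Q₁)) : Prop :=
  (∀ x, H.comul (st x) =
    TensorProduct.comm 𝕜 (FibOsc q Q₁) (FibOsc q Q₁) (TensorProduct.map st st (H.comul x))) ∧
  (∀ x, H.antipode (st x) = st (H.antipode x))

end StarStructure

/-!
The oscillator algebra is quadratic: its relations span a subspace of `V ⊗ V`, where `V` is the span
of the generators. The classification has two halves.

*Existence.* Let `R` be a solution of the Yang–Baxter equation on `V ⊗ V` that moves the relations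
through `V` from both sides and acts on them by `-1` (`IsCompatibleBraiding`). Then the quadratic
algebra carries a braided Hopf algebra structure with braiding `R` on generators, primitive
generators and antipode `-1` on generators (`IsBraidedQuadratic.braidedHopf`). All structure maps
come from algebra maps out of `A` given on generators: `ρ : A → Mat(A)` with
`ψ (v i ⊗ x) = ∑ j, ρ x i j ⊗ v j`, and actions of `A` on `A ⊗ A` and on `A` by
`u ⊗ w ↦ ψ (x ⊗ u) (1 ⊗ w)`, by left multiplication with `Δ x` in the braided tensor square and by
`u ↦ m (ψ (S x ⊗ u))`; the structure maps are recovered by evaluating at units. Each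
axiom is then checked by induction on left multiplication by a generator. The braided structure is
determined by its values on generators (`IsBraidedQuadratic.eq_braidedHopf`). For a column of the
table the relations are exactly the `-1`-eigenspace of `R` when `Q₁ ≠ ± q ^ 2`; the Yang–Baxter
equation then implies that they move through `V` (`IsCompatibleBraiding.of_exact`), and only the
Yang–Baxter equation itself has to be verified.

*Necessity.* Linear functionals that read off the coefficients of monomials of degree at most two
(`FibOsc.exists_functional`) turn the axioms into equations for the constants. The counit, antipode
and coassociativity axioms make the generators primitive; compatibility of the braiding with the
comultiplication makes the braiding homogeneous (`HasAnsatzForm.isPrimitive`), since `id ⊗ ε` and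
`ε ⊗ id` annihilate the braiding of primitive elements. Applying `Δ` to the relations gives
the eigenvalue `-1`, and the vanishing of the braiding of a generator and a relation gives the
polynomial system `AnsatzConstants.IsBraidSolution`. It splits according to whether `d₂ = 0`, with
three solutions in each case; the branch `d₂ = 0`, `q * d₁ = 1` would force `Q₁ ^ 2 = q ^ 4` or
`Q₁ ^ 3 = q ^ 6`, which is impossible for real `q` and `Q₁` with `Q₁ ≠ ± q ^ 2`.

For the `*`-structure, the constants of the table are real when `√Q₁` is, and the ansatz is
symmetric under the exchange of `a` and `a*` together with the flip, which is what the compatibility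
requires on generators (`IsOscStar.isStarCompatible`).
-/

universe u

/-! ### Quadratic algebras with a compatible braiding of the generators -/


/-- `A` is the quadratic algebra with generators `v i` and relations
`∑ i j, r α i j • v i * v j = 0`. -/
structure IsQuadraticPresentation {K A : Type u} {ι κ : Type} [CommRing K] [Ring A] [Algebra K A]
    [Fintype ι] (v : ι → A) (r : κ → ι → ι → K) : Prop where
  adjoin_eq_top : Algebra.adjoin K (Set.range v) = ⊤
  rel : ∀ α, ∑ i, ∑ j, r α i j • (v i * v j) = 0
  exists_lift : ∀ (B : Type u) [Ring B] [Algebra K B] (f : ι → B),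
    (∀ α, ∑ i, ∑ j, r α i j • (f i * f j) = 0) → ∃ φ : A →ₐ[K] B, ∀ i, φ (v i) = f i

/-- `R i j k l` is the coefficient of `v k ⊗ v l` in the image of `v i ⊗ v j`. The conditions say
that `R` solves the Yang–Baxter equation, that it moves the space of quadratic relations through a
generator from either side, and that it acts on the relations by `-1`. -/
structure IsCompatibleBraiding {K : Type u} {ι κ : Type} [CommRing K] [Fintype ι] [Fintype κ]
    (r : κ → ι → ι → K) (R : ι → ι → ι → ι → K) : Prop where
  yang_baxter : ∀ i j k l m n, ∑ a, ∑ b, ∑ c, R i j a b * R b k c n * R a c l m =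
    ∑ a, ∑ b, ∑ c, R j k a b * R i a l c * R c b m n
  rel_left : ∃ N : κ → ι → ι → κ → K, ∀ α i l k k',
    ∑ j, ∑ j', ∑ m, r α j j' * R i j k m * R m j' k' l = ∑ β, N α i l β * r β k k'
  rel_right : ∃ N : κ → ι → ι → κ → K, ∀ α c p k l,
    ∑ i, ∑ j, ∑ m, r α i j * R j c m l * R i m p k = ∑ β, N α c p β * r β k l
  rel_eigen : ∀ α k l, ∑ i, ∑ j, r α i j * R i j k l = -r α k l

/-- A quadratic algebra together with a compatible braiding of its generators. -/
structure IsBraidedQuadratic {K A : Type u} {ι κ : Type} [CommRing K] [Ring A] [Algebra K A]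
    [Fintype ι] [Fintype κ] (v : ι → A) (r : κ → ι → ι → K) (R : ι → ι → ι → ι → K) : Prop
    extends IsQuadraticPresentation v r, IsCompatibleBraiding r R

namespace IsQuadraticPresentation

variable {K A : Type u} {ι κ : Type} [CommRing K] [Ring A] [Algebra K A] [Fintype ι]
  {v : ι → A} {r : κ → ι → ι → K}

theorem induction_left (h : IsQuadraticPresentation v r) {P : A → Prop} (one : P 1)
    (gen_mul : ∀ i x, P x → P (v i * x)) (add : ∀ x y, P x → P y → P (x + y))
    (smul : ∀ (c : K) x, P x → P (c • x)) (x : A) : P x := by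
  have hx : x ∈ Submodule.span K (Submonoid.closure (Set.range v) : Set A) := by
    rw [← Algebra.adjoin_eq_span, h.adjoin_eq_top]; trivial
  induction hx using Submodule.span_induction with
  | mem x hx =>
    induction hx using Submonoid.closure_induction_left with
    | one => exact one
    | mul_left y hy z _ ih => obtain ⟨i, rfl⟩ := hy; exact gen_mul i z ih
  | zero => simpa using smul 0 1 one
  | add x y _ _ hx hy => exact add x y hx hy
  | smul c x _ hx => exact smul c x hx

/-- Linear maps on `A` agree if their agreement propagates under left multiplication by
generators. -/
theorem linearMap_ext_left (h : IsQuadraticPresentation v r) {M : Type*} [AddCommGroup M]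
    [Module K M] {f g : A →ₗ[K] M} (one : f 1 = g 1)
    (gen_mul : ∀ i x, f x = g x → f (v i * x) = g (v i * x)) (x : A) : f x = g x := by
  induction x using h.induction_left with
  | one => exact one
  | gen_mul i x ih => exact gen_mul i x ih
  | add x y hx hy => rw [map_add, map_add, hx, hy]
  | smul c x hx => rw [map_smul, map_smul, hx]

theorem mem_subalgebra (h : IsQuadraticPresentation v r) (S : Subalgebra K A)
    (hS : ∀ i, v i ∈ S) (x : A) : x ∈ S := by
  have : Algebra.adjoin K (Set.range v) ≤ S :=
    Algebra.adjoin_le (by rintro _ ⟨i, rfl⟩; exact hS i)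
  rw [h.adjoin_eq_top] at this
  exact this trivial

end IsQuadraticPresentation

namespace IsBraidedQuadratic

variable {K A : Type u} {ι κ : Type} [CommRing K] [Ring A] [Algebra K A] [Fintype ι] [Fintype κ]
  [DecidableEq ι] {v : ι → A} {r : κ → ι → ι → K} {R : ι → ι → ι → ι → K}

theorem exists_coeffHom (h : IsBraidedQuadratic v r R) :
    ∃ φ : A →ₐ[K] Matrix ι ι A, ∀ j, φ (v j) = Matrix.of fun i l => ∑ k, R i j k l • v k := by
  refine h.exists_lift _ _ fun α => ?_
  obtain ⟨N, hN⟩ := h.rel_left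
  ext i l
  have key : ∑ β, N α i l β • ∑ k, ∑ k', r β k k' • (v k * v k') = 0 := by simp [h.rel]
  rw [Matrix.zero_apply, ← key]
  simp only [Matrix.sum_apply, Matrix.smul_apply, Matrix.mul_apply, Matrix.of_apply,
    Finset.sum_mul_sum, Finset.smul_sum, smul_mul_smul_comm, smul_smul]
  calc _ = ∑ k, ∑ k', (∑ j, ∑ j', ∑ m, r α j j' * R i j k m * R m j' k' l) • (v k * v k') := by
        simp only [Finset.sum_smul]
        simp only [← Fintype.sum_prod_type']
        refine Fintype.sum_equiv ⟨fun x => ⟨x.2.2.2.1, x.2.2.2.2, x.1, x.2.1, x.2.2.1⟩,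
          fun x => ⟨x.2.2.1, x.2.2.2.1, x.2.2.2.2, x.1, x.2.1⟩, fun _ => rfl, fun _ => rfl⟩ _ _ fun x => ?_
        simp [mul_assoc]
    _ = _ := by
        simp only [hN, Finset.sum_smul]
        rw [Finset.sum_comm_cycle]

/-- The algebra map `ρ : A → Mat(A)` that encodes the braiding of a generator with an element:
`ψ (v i ⊗ x) = ∑ j, ρ x i j ⊗ v j`. -/
noncomputable def coeffHom (h : IsBraidedQuadratic v r R) : A →ₐ[K] Matrix ι ι A :=
  h.exists_coeffHom.choose

/-- The entries of `coeffHom`. -/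
noncomputable def coeff (h : IsBraidedQuadratic v r R) (i j : ι) : A →ₗ[K] A :=
  LinearMap.proj j ∘ₗ LinearMap.proj i ∘ₗ h.coeffHom.toLinearMap

variable (h : IsBraidedQuadratic v r R)

theorem coeffHom_apply (x : A) (i j : ι) : h.coeffHom x i j = h.coeff i j x := rfl

theorem coeff_gen (i j l : ι) : h.coeff i l (v j) = ∑ k, R i j k l • v k := by
  rw [← coeffHom_apply, coeffHom, h.exists_coeffHom.choose_spec, Matrix.of_apply]

theorem coeff_mul (i j : ι) (x y : A) :
    h.coeff i j (x * y) = ∑ k, h.coeff i k x * h.coeff k j y := by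
  simp only [← coeffHom_apply, map_mul, Matrix.mul_apply]

theorem coeff_one (i j : ι) : h.coeff i j 1 = if i = j then 1 else 0 := by
  simp only [← coeffHom_apply, map_one, Matrix.one_apply]

/-- The action of an element on two generators: the entry `((m, i), (l, j))` is
`ρ (ρ x m l) i j`. -/
noncomputable def coeffHomTwo : A →ₐ[K] Matrix (ι × ι) (ι × ι) A :=
  (Matrix.compAlgEquiv ι ι A K).toAlgHom.comp (h.coeffHom.mapMatrix.comp h.coeffHom)

theorem coeffHomTwo_apply (x : A) (m i l j : ι) :
    h.coeffHomTwo x (m, i) (l, j) = h.coeff i j (h.coeff m l x) := rfl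

/-- The braiding matrix commutes with the action of `A` on two generators; this is the
Yang–Baxter equation on two generators and an arbitrary element. -/
theorem sum_smul_coeff_coeff (i m l k : ι) (x : A) :
    ∑ p, ∑ j, R i m p j • h.coeff p l (h.coeff j k x) =
      ∑ j, ∑ n, R j n l k • h.coeff i j (h.coeff m n x) := by
  let Q : Matrix (ι × ι) (ι × ι) A := Matrix.of fun a b => algebraMap K A (R a.2 a.1 b.2 b.1)
  have hQ : x ∈ (Subalgebra.centralizer K {Q}).comap h.coeffHomTwo := by
    refine h.mem_subalgebra _ (fun c => ?_) x
    rw [Subalgebra.mem_comap, Subalgebra.mem_centralizer_iff]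
    rintro _ rfl
    ext ⟨m, i⟩ ⟨k, l⟩
    simp only [Matrix.mul_apply, Q, Matrix.of_apply, Fintype.sum_prod_type, coeffHomTwo_apply,
      ← Algebra.smul_def, ← Algebra.commutes, coeff_gen, map_sum, map_smul, Finset.smul_sum,
      smul_smul]
    calc _ = ∑ y, (∑ p, ∑ j, ∑ a, R i m p j * R j c a k * R p a y l) • v y := by
          simp only [Finset.sum_smul]
          simp only [← Fintype.sum_prod_type']
          refine Fintype.sum_equiv ⟨fun x => ⟨x.2.2.2, x.2.1, x.1, x.2.2.1⟩,
            fun x => ⟨x.2.2.1, x.2.1, x.2.2.2, x.1⟩, fun _ => rfl, fun _ => rfl⟩ _ _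
            fun x => ?_
          simp [mul_assoc]
      _ = ∑ y, (∑ a, ∑ n, ∑ j, R m c a n * R i a y j * R j n l k) • v y := by
          simp only [h.yang_baxter]
      _ = _ := by
          simp only [Finset.sum_smul]
          simp only [← Fintype.sum_prod_type']
          refine Fintype.sum_equiv ⟨fun x => ⟨x.2.2.1, x.2.2.2, x.2.1, x.1⟩,
            fun x => ⟨x.2.2.2, x.2.2.1, x.1, x.2.1⟩, fun _ => rfl, fun _ => rfl⟩ _ _
            fun x => ?_
          simp only [Equiv.coe_fn_mk]
          congr 1
          ring
  rw [Subalgebra.mem_comap, Subalgebra.mem_centralizer_iff] at hQ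
  have := congrFun (congrFun (hQ Q rfl) (m, i)) (k, l)
  simp only [Matrix.mul_apply, Q, Matrix.of_apply, Fintype.sum_prod_type, coeffHomTwo_apply,
      ← Algebra.smul_def, ← Algebra.commutes] at this
  rw [Finset.sum_comm, this, Finset.sum_comm]

/-- The relations are stable under the action of `A` on two generators. -/
theorem exists_sum_smul_coeff_coeff (x : A) : ∃ N : κ → κ → A, ∀ α k l,
    ∑ i, ∑ j, r α i j • h.coeff i k (h.coeff j l x) = ∑ β, r β k l • N α β := by
  let Q : Matrix κ (ι × ι) A := Matrix.of fun α b => algebraMap K A (r α b.2 b.1)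
  let S : Subalgebra K A :=
    { carrier := {x | ∃ N : Matrix κ κ A, Q * h.coeffHomTwo x = N * Q}
      mul_mem' := by
        rintro x y ⟨M, hM⟩ ⟨N, hN⟩
        exact ⟨M * N, by rw [map_mul, ← Matrix.mul_assoc, hM, Matrix.mul_assoc, hN, Matrix.mul_assoc]⟩
      add_mem' := by
        rintro x y ⟨M, hM⟩ ⟨N, hN⟩
        exact ⟨M + N, by rw [map_add, Matrix.mul_add, hM, hN, Matrix.add_mul]⟩
      algebraMap_mem' := fun c => by
        classical
        refine ⟨algebraMap K _ c, ?_⟩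
        rw [AlgHom.commutes]
        simp [Algebra.algebraMap_eq_smul_one] }
  have hx : x ∈ S := by
    refine h.mem_subalgebra _ (fun c => ?_) x
    obtain ⟨N, hN⟩ := h.rel_right
    refine ⟨Matrix.of fun α β => ∑ p, N α c p β • v p, ?_⟩
    ext α ⟨l, k⟩
    simp only [Matrix.mul_apply, Q, Matrix.of_apply, Fintype.sum_prod_type, coeffHomTwo_apply,
      ← Algebra.smul_def, ← Algebra.commutes, coeff_gen, map_sum, map_smul, Finset.smul_sum,
      smul_smul]
    calc _ = ∑ p, (∑ i, ∑ j, ∑ m, r α i j * R j c m l * R i m p k) • v p := by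
          simp only [Finset.sum_smul]
          simp only [← Fintype.sum_prod_type']
          refine Fintype.sum_equiv ⟨fun x => ⟨x.2.2.2, x.2.1, x.1, x.2.2.1⟩,
            fun x => ⟨x.2.2.1, x.2.1, x.2.2.2, x.1⟩, fun _ => rfl, fun _ => rfl⟩ _ _
            fun x => ?_
          simp [mul_assoc]
      _ = _ := by
          simp only [hN, Finset.sum_smul]
          rw [Finset.sum_comm]
          simp only [mul_comm]
  obtain ⟨N, hN⟩ := hx
  refine ⟨N, fun α k l => ?_⟩
  have := congrFun (congrFun hN α) (l, k)
  simp only [Matrix.mul_apply, Q, Matrix.of_apply, Fintype.sum_prod_type, coeffHomTwo_apply,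
      ← Algebra.smul_def, ← Algebra.commutes] at this
  rw [Finset.sum_comm, this]

end IsBraidedQuadratic

namespace IsBraidedQuadratic

theorem _root_.Fintype.sum_comm_pairs {α β γ δ M : Type*} [Fintype α] [Fintype β] [Fintype γ]
    [Fintype δ] [AddCommMonoid M] (F : α → β → γ → δ → M) :
    ∑ i, ∑ j, ∑ k, ∑ l, F i j k l = ∑ k, ∑ l, ∑ i, ∑ j, F i j k l := by
  have := Finset.sum_comm (s := (Finset.univ : Finset (α × β)))
    (t := (Finset.univ : Finset (γ × δ))) (f := fun x y => F x.1 x.2 y.1 y.2)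
  simpa only [Fintype.sum_prod_type] using this

variable {K A : Type u} {ι κ : Type} [CommRing K] [Ring A] [Algebra K A] [Fintype ι] [Fintype κ]
  [DecidableEq ι] {v : ι → A} {r : κ → ι → ι → K} {R : ι → ι → ι → ι → K}
  (h : IsBraidedQuadratic v r R)

/-- Letting an element cross a relation again gives a relation: whatever vanishes on the relations
vanishes on their images under the action of `A` on two generators. -/
theorem sum_rel_coeff_coeff {M : Type*} [AddCommGroup M] [Module K M] (f : ι → ι → A →ₗ[K] M)
    (hf : ∀ β y, ∑ k, ∑ l, r β k l • f k l y = 0) (α : κ) (x : A) :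
    ∑ i, ∑ j, r α i j • ∑ k, ∑ l, f k l (h.coeff i k (h.coeff j l x)) = 0 := by
  obtain ⟨N, hN⟩ := h.exists_sum_smul_coeff_coeff x
  calc _ = ∑ k, ∑ l, f k l (∑ i, ∑ j, r α i j • h.coeff i k (h.coeff j l x)) := by
        simp only [Finset.smul_sum, map_sum, map_smul]
        rw [Fintype.sum_comm_pairs]
    _ = ∑ β, ∑ k, ∑ l, r β k l • f k l (N α β) := by
        simp only [hN, map_sum, map_smul]
        rw [Finset.sum_comm_cycle]
    _ = 0 := by simp [hf]

/-! ### The braiding -/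

section crossOn

variable {M : Type u} [AddCommGroup M] [Module K M] (φ : A →ₐ[K] Module.End K M)

theorem exists_crossOn : ∃ Φ : A →ₐ[K] Module.End K (A ⊗[K] M),
    ∀ i, Φ (v i) = ∑ j, TensorProduct.map (h.coeff i j) (φ (v j)) := by
  refine h.exists_lift (Module.End K (A ⊗[K] M))
    (fun i => ∑ j, TensorProduct.map (h.coeff i j) (φ (v j)))
    fun α => TensorProduct.ext' fun x m => ?_
  have := h.sum_rel_coeff_coeff
    (fun k l => (TensorProduct.mk K A M).flip (φ (v k * v l) m)) (fun β y => by
      simpa [TensorProduct.tmul_sum] using congrArg (fun a => y ⊗ₜ[K] φ a m) (h.rel β)) α x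
  simp only [LinearMap.sum_apply, LinearMap.smul_apply, Module.End.mul_apply,
    TensorProduct.map_tmul, map_sum, LinearMap.zero_apply]
  rw [← this]
  refine Finset.sum_congr rfl fun i _ => Finset.sum_congr rfl fun j _ => ?_
  rw [Finset.sum_comm]
  simp

/-- The action of `A` on `A ⊗ M`, for a left `A`-module `M`, that lets an element cross the first
tensor factor and then act on `M`. -/
noncomputable def crossOn : A →ₐ[K] Module.End K (A ⊗[K] M) := (h.exists_crossOn φ).choose

theorem crossOn_gen_tmul (i : ι) (x : A) (m : M) :
    h.crossOn φ (v i) (x ⊗ₜ m) = ∑ j, h.coeff i j x ⊗ₜ φ (v j) m := by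
  rw [crossOn, (h.exists_crossOn φ).choose_spec]
  simp

theorem crossOn_mul_apply (x y : A) (t : A ⊗[K] M) :
    h.crossOn φ (x * y) t = h.crossOn φ x (h.crossOn φ y t) := by
  rw [map_mul, Module.End.mul_apply]

/-- A map that commutes with the crossings of generators commutes with all crossings. -/
theorem crossOn_comm_of_gen {N : Type u} [AddCommGroup N] [Module K N]
    {φ : A →ₐ[K] Module.End K M} {φ' : A →ₐ[K] Module.End K N} (T : A ⊗[K] M →ₗ[K] A ⊗[K] N)
    (hT : ∀ i x m, h.crossOn φ' (v i) (T (x ⊗ₜ m)) = T (h.crossOn φ (v i) (x ⊗ₜ m))) (x : A)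
    (t : A ⊗[K] M) : h.crossOn φ' x (T t) = T (h.crossOn φ x t) := by
  have hT' (i : ι) (t : A ⊗[K] M) : h.crossOn φ' (v i) (T t) = T (h.crossOn φ (v i) t) :=
    LinearMap.congr_fun (TensorProduct.ext' (hT i) :
      h.crossOn φ' (v i) ∘ₗ T = T ∘ₗ h.crossOn φ (v i)) t
  induction x using h.induction_left generalizing t with
  | one => simp
  | gen_mul i x ih => rw [crossOn_mul_apply, crossOn_mul_apply, ih, hT']
  | add x y hx hy => simp only [map_add, LinearMap.add_apply, hx, hy]
  | smul c x hx => simp only [map_smul, LinearMap.smul_apply, hx]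

theorem crossOn_lTensor {N : Type u} [AddCommGroup N] [Module K N]
    {φ : A →ₐ[K] Module.End K M} {φ' : A →ₐ[K] Module.End K N} (f : M →ₗ[K] N)
    (hf : ∀ i m, f (φ (v i) m) = φ' (v i) (f m)) (x : A) (t : A ⊗[K] M) :
    h.crossOn φ' x (f.lTensor A t) = f.lTensor A (h.crossOn φ x t) :=
  h.crossOn_comm_of_gen (f.lTensor A) (fun i x m => by simp [crossOn_gen_tmul, hf]) x t

end crossOn

/-- The action of `A` on `A ⊗ A` that lets an element cross the first tensor factor and multiplies
it into the second one: `x` acts as `u ⊗ w ↦ ψ (x ⊗ u) (1 ⊗ w)`. -/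
noncomputable def cross : A →ₐ[K] Module.End K (A ⊗[K] A) := h.crossOn (Algebra.lmul K A)

theorem cross_gen_tmul (i : ι) (x y : A) :
    h.cross (v i) (x ⊗ₜ y) = ∑ j, h.coeff i j x ⊗ₜ (v j * y) :=
  h.crossOn_gen_tmul _ i x y

theorem cross_comm_of_gen (T : Module.End K (A ⊗[K] A))
    (hT : ∀ i x y, h.cross (v i) (T (x ⊗ₜ y)) = T (h.cross (v i) (x ⊗ₜ y))) (x : A)
    (t : A ⊗[K] A) : h.cross x (T t) = T (h.cross x t) :=
  h.crossOn_comm_of_gen T hT x t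

theorem cross_mul_one_tmul (x w : A) (t : A ⊗[K] A) :
    h.cross x (t * (1 ⊗ₜ w)) = h.cross x t * (1 ⊗ₜ w) :=
  h.cross_comm_of_gen (LinearMap.mulRight K (1 ⊗ₜ w))
    (fun i x y => by simp [cross_gen_tmul, mul_assoc]) x t

theorem cross_mul_apply (x y : A) (t : A ⊗[K] A) :
    h.cross (x * y) t = h.cross x (h.cross y t) := by
  rw [map_mul, Module.End.mul_apply]

/-- The braiding of `A`. -/
noncomputable def braiding : A ⊗[K] A →ₗ[K] A ⊗[K] A :=
  TensorProduct.lift (h.cross.toLinearMap.compl₂ ((TensorProduct.mk K A A).flip 1))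

theorem braiding_tmul (x y : A) : h.braiding (x ⊗ₜ y) = h.cross x (y ⊗ₜ 1) := by
  simp [braiding]

theorem cross_tmul (x u w : A) : h.cross x (u ⊗ₜ w) = h.braiding (x ⊗ₜ u) * (1 ⊗ₜ w) := by
  rw [braiding_tmul, ← cross_mul_one_tmul]
  simp

theorem braiding_mul_tmul (x x' y : A) :
    h.braiding ((x * x') ⊗ₜ y) = h.cross x (h.braiding (x' ⊗ₜ y)) := by
  simp only [braiding_tmul, cross_mul_apply]

theorem braiding_gen_tmul (i : ι) (x : A) :
    h.braiding (v i ⊗ₜ x) = ∑ j, h.coeff i j x ⊗ₜ v j := by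
  simp [braiding_tmul, cross_gen_tmul]

theorem braiding_one_tmul (x : A) : h.braiding (1 ⊗ₜ x) = x ⊗ₜ 1 := by
  simp [braiding_tmul]

theorem braiding_gen_gen (i j : ι) :
    h.braiding (v i ⊗ₜ v j) = ∑ k, ∑ l, R i j k l • (v k ⊗ₜ v l) := by
  rw [braiding_gen_tmul, Finset.sum_comm]
  simp [coeff_gen, TensorProduct.sum_tmul, TensorProduct.smul_tmul']

theorem cross_tmul_one (x : A) (w : A) : h.cross x (1 ⊗ₜ w) = 1 ⊗ₜ (x * w) := by
  induction x using h.induction_left generalizing w with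
  | one => simp
  | gen_mul i x ih =>
    rw [cross_mul_apply, ih, cross_gen_tmul]
    simp [coeff_one, TensorProduct.ite_tmul, mul_assoc]
  | add x y hx hy => simp [hx, hy, add_mul, TensorProduct.tmul_add]
  | smul c x hx => simp [hx]

theorem braiding_tmul_one (x : A) : h.braiding (x ⊗ₜ 1) = 1 ⊗ₜ x := by
  rw [braiding_tmul, cross_tmul_one, mul_one]

/-- The second tensor factor crosses `y`, which is then multiplied into the first factor:
`u ⊗ x ↦ (u ⊗ 1) ψ (x ⊗ y)`. -/
noncomputable def crossBack (y : A) : Module.End K (A ⊗[K] A) :=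
  TensorProduct.lift ((LinearMap.mul K (A ⊗[K] A)).compl₁₂
    ((TensorProduct.mk K A A).flip 1) (h.braiding ∘ₗ (TensorProduct.mk K A A).flip y))

theorem crossBack_tmul (y u x : A) :
    h.crossBack y (u ⊗ₜ x) = (u ⊗ₜ 1) * h.braiding (x ⊗ₜ y) := by
  simp [crossBack]

theorem cross_gen_tmul_one_mul (i : ι) (y : A) (t : A ⊗[K] A) :
    h.cross (v i) ((y ⊗ₜ 1) * t) = ∑ j, (h.coeff i j y ⊗ₜ 1) * h.cross (v j) t := by
  induction t using TensorProduct.induction_on with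
  | zero => simp
  | tmul a b =>
    simp only [Algebra.TensorProduct.tmul_mul_tmul, one_mul, cross_gen_tmul, coeff_mul,
      Finset.mul_sum, TensorProduct.sum_tmul]
    rw [Finset.sum_comm]
  | add s t hs ht => simp only [mul_add, map_add, hs, ht, Finset.sum_add_distrib]

/-- The crossings from the left and from the right commute. Evaluated at `1 ⊗ 1` this is the
hexagon identity `braiding_tmul_mul` for products in the second factor. -/
theorem cross_crossBack (x y : A) (t : A ⊗[K] A) :
    h.cross x (h.crossBack y t) = h.crossBack y (h.cross x t) := by
  refine h.cross_comm_of_gen (h.crossBack y) (fun i a b => ?_) x t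
  rw [crossBack_tmul, cross_gen_tmul_one_mul, cross_gen_tmul, map_sum]
  simp only [crossBack_tmul, braiding_mul_tmul]

theorem braiding_tmul_mul (x y y' : A) :
    h.braiding (x ⊗ₜ (y * y')) = h.crossBack y' (h.braiding (x ⊗ₜ y)) := by
  rw [braiding_tmul, braiding_tmul, ← cross_crossBack, crossBack_tmul, braiding_one_tmul]
  simp

/-- The action of `A` on one generator, applied to a tensor product. -/
noncomputable def coeffTensor (i k : ι) : Module.End K (A ⊗[K] A) :=
  ∑ j, TensorProduct.map (h.coeff i j) (h.coeff j k)

theorem coeffTensor_tmul (i k : ι) (x y : A) :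
    h.coeffTensor i k (x ⊗ₜ y) = ∑ j, h.coeff i j x ⊗ₜ h.coeff j k y := by
  simp [coeffTensor]

/-- Crossing a generator and crossing an element commute. On generators this is the Yang–Baxter
equation for two generators and an element, `sum_smul_coeff_coeff`. -/
theorem cross_coeff_coeffTensor (i k : ι) (y : A) (t : A ⊗[K] A) :
    ∑ j, h.cross (h.coeff i j y) (h.coeffTensor j k t) = h.coeffTensor i k (h.cross y t) := by
  have gen (i k m : ι) (t : A ⊗[K] A) :
      ∑ j, h.cross (h.coeff i j (v m)) (h.coeffTensor j k t) =
        h.coeffTensor i k (h.cross (v m) t) := by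
    induction t using TensorProduct.induction_on with
    | zero => simp
    | add s t hs ht => simp only [map_add, Finset.sum_add_distrib, hs, ht]
    | tmul z w =>
      calc _ = ∑ n, ∑ l, (∑ p, ∑ j, R i m p j • h.coeff p l (h.coeff j n z)) ⊗ₜ
              (v l * h.coeff n k w) := by
            simp only [coeff_gen, coeffTensor_tmul, map_sum, map_smul, LinearMap.sum_apply,
              LinearMap.smul_apply, cross_gen_tmul, TensorProduct.sum_tmul, Finset.smul_sum,
              TensorProduct.smul_tmul']
            rw [Fintype.sum_comm_pairs, Finset.sum_comm]
            exact (Finset.sum_congr rfl fun _ _ => Finset.sum_comm_cycle).trans Finset.sum_comm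
        _ = ∑ n, ∑ l, (∑ j, ∑ p, R j p l n • h.coeff i j (h.coeff m p z)) ⊗ₜ
              (v l * h.coeff n k w) := by
            simp only [sum_smul_coeff_coeff]
        _ = _ := by
            simp only [cross_gen_tmul, map_sum, coeffTensor_tmul, coeff_mul, coeff_gen,
              TensorProduct.sum_tmul, TensorProduct.tmul_sum, Finset.sum_mul,
              TensorProduct.smul_tmul', TensorProduct.tmul_smul, smul_mul_assoc]
            rw [Fintype.sum_comm_pairs]
            exact Finset.sum_comm
  induction y using h.induction_left generalizing i k t with
  | one =>
    rw [Finset.sum_eq_single i (fun j _ hj => by simp [coeff_one, hj.symm]) (by simp)]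
    simp [coeff_one]
  | gen_mul m y ih =>
    simp only [coeff_mul, map_sum, LinearMap.sum_apply, cross_mul_apply]
    rw [Finset.sum_comm, ← gen]
    simp only [← map_sum, ih]
  | add x y hx hy => simp only [map_add, LinearMap.add_apply, Finset.sum_add_distrib, hx, hy]
  | smul c x hx => simp only [map_smul, LinearMap.smul_apply, ← Finset.smul_sum, hx]

theorem braiding_coeffTensor (i k : ι) (t : A ⊗[K] A) :
    h.braiding (h.coeffTensor i k t) = h.coeffTensor i k (h.braiding t) := by
  induction t using TensorProduct.induction_on with
  | zero => simp
  | add s t hs ht => simp only [map_add, hs, ht]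
  | tmul y z =>
    rw [braiding_tmul, ← cross_coeff_coeffTensor]
    simp [coeffTensor_tmul, coeff_one, braiding_tmul, TensorProduct.tmul_ite]

end IsBraidedQuadratic

namespace IsBraidedQuadratic

variable {K A : Type u} {ι κ : Type} [CommRing K] [Ring A] [Algebra K A] [Fintype ι] [Fintype κ]
  [DecidableEq ι] {v : ι → A} {r : κ → ι → ι → K} {R : ι → ι → ι → ι → K}
  (h : IsBraidedQuadratic v r R)

/-! ### The Yang–Baxter equation -/

theorem _root_.onFirstTwo_tmul {K A : Type*} [CommRing K] [Ring A] [Algebra K A]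
    (ψ : A ⊗[K] A →ₗ[K] A ⊗[K] A) (x y z : A) :
    onFirstTwo K A ψ (x ⊗ₜ (y ⊗ₜ z)) = TensorProduct.assoc K A A A (ψ (x ⊗ₜ y) ⊗ₜ z) := by
  simp [onFirstTwo]

theorem _root_.onFirstTwo_assoc_tmul {K A : Type*} [CommRing K] [Ring A] [Algebra K A]
    (ψ : A ⊗[K] A →ₗ[K] A ⊗[K] A) (t : A ⊗[K] A) (z : A) :
    onFirstTwo K A ψ (TensorProduct.assoc K A A A (t ⊗ₜ z)) =
      TensorProduct.assoc K A A A (ψ t ⊗ₜ z) := by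
  simp [onFirstTwo]

theorem _root_.onLastTwo_tmul {K A : Type*} [CommRing K] [Ring A] [Algebra K A]
    (ψ : A ⊗[K] A →ₗ[K] A ⊗[K] A) (x : A) (t : A ⊗[K] A) :
    onLastTwo K A ψ (x ⊗ₜ t) = x ⊗ₜ ψ t := by
  simp [onLastTwo]

theorem _root_.onMiddleTwo_tmul {K A : Type*} [CommRing K] [Ring A] [Algebra K A]
    (ψ : A ⊗[K] A →ₗ[K] A ⊗[K] A) (x y z w : A) :
    onMiddleTwo K A ψ ((x ⊗ₜ y) ⊗ₜ (z ⊗ₜ w)) = (TensorProduct.assoc K A A (A ⊗[K] A)).symm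
      (x ⊗ₜ TensorProduct.assoc K A A A (ψ (y ⊗ₜ z) ⊗ₜ w)) := by
  simp [onMiddleTwo, onFirstTwo_tmul]

/-- The action of `A` on `A ⊗ A ⊗ A` that lets an element cross the first two tensor factors and
multiplies it into the third one. -/
noncomputable def crossTwo : A →ₐ[K] Module.End K (A ⊗[K] (A ⊗[K] A)) := h.crossOn h.cross

theorem crossTwo_gen_tmul (i : ι) (x : A) (t : A ⊗[K] A) :
    h.crossTwo (v i) (x ⊗ₜ t) = ∑ j, h.coeff i j x ⊗ₜ h.cross (v j) t :=
  h.crossOn_gen_tmul _ i x t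

theorem crossTwo_gen_assoc (i : ι) (t : A ⊗[K] A) (z : A) :
    h.crossTwo (v i) (TensorProduct.assoc K A A A (t ⊗ₜ z)) =
      ∑ k, TensorProduct.assoc K A A A (h.coeffTensor i k t ⊗ₜ (v k * z)) := by
  induction t using TensorProduct.induction_on with
  | zero => simp
  | add s t hs ht => simp only [TensorProduct.add_tmul, map_add, hs, ht, Finset.sum_add_distrib]
  | tmul x y =>
    simp only [TensorProduct.assoc_tmul, crossTwo_gen_tmul, cross_gen_tmul, coeffTensor_tmul,
      TensorProduct.tmul_sum, TensorProduct.sum_tmul, map_sum]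
    rw [Finset.sum_comm]

/-- The braiding commutes with the crossing of `A ⊗ A`; this is the Yang–Baxter equation. -/
theorem crossTwo_onFirstTwo (x : A) (t : A ⊗[K] (A ⊗[K] A)) :
    h.crossTwo x (onFirstTwo K A h.braiding t) = onFirstTwo K A h.braiding (h.crossTwo x t) := by
  refine h.crossOn_comm_of_gen _ (fun i y t => ?_) x t
  induction t using TensorProduct.induction_on with
  | zero => simp
  | add s t hs ht => simp only [TensorProduct.tmul_add, map_add, hs, ht]
  | tmul u w =>
    change h.crossTwo _ _ = onFirstTwo K A h.braiding (h.crossTwo _ _)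
    rw [onFirstTwo_tmul, crossTwo_gen_assoc, ← TensorProduct.assoc_tmul, crossTwo_gen_assoc,
      map_sum]
    simp only [onFirstTwo_assoc_tmul, braiding_coeffTensor]

theorem onLastTwo_onFirstTwo (x y z : A) :
    onLastTwo K A h.braiding (onFirstTwo K A h.braiding (x ⊗ₜ (y ⊗ₜ z))) =
      h.crossTwo x (y ⊗ₜ (z ⊗ₜ 1)) := by
  have key := h.crossOn_lTensor (φ := Algebra.lmul K A) (φ' := h.cross)
    (h.braiding ∘ₗ (TensorProduct.mk K A A).flip z) (fun i m => by
      simp [braiding_mul_tmul]) x (y ⊗ₜ 1)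
  have h1 : (h.braiding ∘ₗ (TensorProduct.mk K A A).flip z).lTensor A (y ⊗ₜ (1 : A)) =
      y ⊗ₜ (z ⊗ₜ 1) := by simp [braiding_one_tmul]
  rw [h1] at key
  rw [crossTwo, key, onFirstTwo_tmul, braiding_tmul, cross]
  generalize h.crossOn (Algebra.lmul K A) x (y ⊗ₜ 1) = s
  induction s using TensorProduct.induction_on with
  | zero => simp
  | add s t hs ht => simp only [TensorProduct.add_tmul, map_add, hs, ht]
  | tmul u w => simp [onLastTwo_tmul]

theorem onLastTwo_onFirstTwo_tmul (x : A) (s : A ⊗[K] A) :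
    onLastTwo K A h.braiding (onFirstTwo K A h.braiding (x ⊗ₜ s)) =
      h.crossTwo x (TensorProduct.assoc K A A A (s ⊗ₜ 1)) := by
  induction s using TensorProduct.induction_on with
  | zero => simp
  | add s t hs ht => simp only [TensorProduct.tmul_add, TensorProduct.add_tmul, map_add, hs, ht]
  | tmul u w => rw [onLastTwo_onFirstTwo, TensorProduct.assoc_tmul]

theorem yang_baxter_tmul (x : A) (t : A ⊗[K] A) :
    onFirstTwo K A h.braiding (onLastTwo K A h.braiding (onFirstTwo K A h.braiding (x ⊗ₜ t))) =
    onLastTwo K A h.braiding (onFirstTwo K A h.braiding (onLastTwo K A h.braiding (x ⊗ₜ t))) := by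
  rw [onLastTwo_onFirstTwo_tmul, ← crossTwo_onFirstTwo, onFirstTwo_assoc_tmul, onLastTwo_tmul,
    onLastTwo_onFirstTwo_tmul]

/-! ### The comultiplication -/

/-- The operators by which `v i ⊗ 1 + 1 ⊗ v i` acts on the braided tensor product satisfy the
relations; the mixed terms cancel since the relations have eigenvalue `-1` under `R`. -/
theorem exists_comulHom : ∃ φ : A →ₐ[K] Module.End K (A ⊗[K] A),
    ∀ i, φ (v i) = LinearMap.mulLeft K (v i ⊗ₜ 1) + h.cross (v i) := by
  refine h.exists_lift (Module.End K (A ⊗[K] A))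
    (fun i => LinearMap.mulLeft K (v i ⊗ₜ 1) + h.cross (v i)) fun α => LinearMap.ext fun t => ?_
  have h1 : ∑ i, ∑ j, r α i j • ((v i ⊗ₜ[K] (1 : A)) * ((v j ⊗ₜ 1) * t)) = 0 := by
    have := congrArg (fun x => (x ⊗ₜ[K] (1 : A)) * t) (h.rel α)
    simpa [TensorProduct.sum_tmul, Finset.sum_mul, ← TensorProduct.smul_tmul', ← mul_assoc]
      using this
  have h2 : ∑ i, ∑ j, r α i j • h.cross (v i) (h.cross (v j) t) = 0 := by
    have := congrArg (fun x => h.cross x t) (h.rel α)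
    simpa [cross_mul_apply] using this
  have h3 : ∑ i, ∑ j, r α i j • h.cross (v i) ((v j ⊗ₜ 1) * t) =
      -∑ i, ∑ j, r α i j • ((v i ⊗ₜ 1) * h.cross (v j) t) := by
    calc _ = ∑ k, ∑ l, (∑ i, ∑ j, r α i j * R i j k l) • ((v k ⊗ₜ 1) * h.cross (v l) t) := by
          simp only [Finset.sum_smul]
          rw [Fintype.sum_comm_pairs]
          refine Finset.sum_congr rfl fun i _ => Finset.sum_congr rfl fun j _ => ?_
          rw [cross_gen_tmul_one_mul, Finset.sum_comm]
          simp [coeff_gen, TensorProduct.sum_tmul, Finset.sum_mul, ← TensorProduct.smul_tmul',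
            Finset.smul_sum, smul_smul]
      _ = _ := by simp [h.rel_eigen]
  simp only [LinearMap.sum_apply, LinearMap.smul_apply, Module.End.mul_apply,
    LinearMap.add_apply, LinearMap.mulLeft_apply, mul_add, smul_add,
    Finset.sum_add_distrib, h1, h2, h3, LinearMap.zero_apply]
  abel

/-- The action of `A` on `A ⊗ A` by left multiplication with `Δ x` in the braided tensor product
algebra. -/
noncomputable def comulHom : A →ₐ[K] Module.End K (A ⊗[K] A) := h.exists_comulHom.choose

/-- The comultiplication of `A`, for which the generators are primitive. -/
noncomputable def comul : A →ₗ[K] A ⊗[K] A := h.comulHom.toLinearMap.flip (1 ⊗ₜ 1)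

theorem comulHom_gen (i : ι) (t : A ⊗[K] A) :
    h.comulHom (v i) t = (v i ⊗ₜ 1) * t + h.cross (v i) t := by
  rw [comulHom, h.exists_comulHom.choose_spec]
  simp

theorem comul_one : h.comul 1 = 1 ⊗ₜ 1 := by simp [comul]

theorem comul_mul_eq_comulHom (x y : A) : h.comul (x * y) = h.comulHom x (h.comul y) := by
  simp [comul]

theorem comul_gen_mul (i : ι) (x : A) :
    h.comul (v i * x) = (v i ⊗ₜ 1) * h.comul x + h.cross (v i) (h.comul x) := by
  rw [comul_mul_eq_comulHom, comulHom_gen]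

theorem comul_gen (i : ι) : h.comul (v i) = v i ⊗ₜ 1 + 1 ⊗ₜ v i := by
  rw [← mul_one (v i), comul_gen_mul, comul_one, cross_tmul_one]
  simp

/-- Left multiplication in the braided tensor product algebra `A ⊗ A`:
`(x ⊗ y) (u ⊗ w) = x ψ (y ⊗ u) w`. -/
noncomputable def braidedMul : A ⊗[K] A →ₗ[K] Module.End K (A ⊗[K] A) :=
  TensorProduct.lift ((LinearMap.mul K (Module.End K (A ⊗[K] A))).compl₁₂
    (LinearMap.mul K (A ⊗[K] A) ∘ₗ (TensorProduct.mk K A A).flip 1) h.cross.toLinearMap)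

theorem braidedMul_tmul (x y : A) (t : A ⊗[K] A) :
    h.braidedMul (x ⊗ₜ y) t = (x ⊗ₜ 1) * h.cross y t := by
  simp [braidedMul]

theorem braidedMul_eq_map (s t : A ⊗[K] A) : h.braidedMul s t =
    TensorProduct.map (LinearMap.mul' K A) (LinearMap.mul' K A)
      (onMiddleTwo K A h.braiding (s ⊗ₜ t)) := by
  induction s using TensorProduct.induction_on with
  | zero => simp
  | add s s' hs ht => simp only [TensorProduct.add_tmul, map_add, LinearMap.add_apply, hs, ht]
  | tmul x y =>
    induction t using TensorProduct.induction_on with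
    | zero => simp
    | add s t hs ht => simp only [TensorProduct.tmul_add, map_add, hs, ht]
    | tmul u w =>
      rw [onMiddleTwo_tmul, braidedMul_tmul, cross_tmul]
      generalize h.braiding (y ⊗ₜ u) = t
      induction t using TensorProduct.induction_on with
      | zero => simp
      | add s t hs ht =>
        simp only [TensorProduct.tmul_add, TensorProduct.add_tmul, map_add, mul_add, add_mul,
          hs, ht]
      | tmul p q => simp

theorem braidedMul_gen (i : ι) (s t : A ⊗[K] A) :
    h.cross (v i) (h.braidedMul s t) = h.braidedMul (h.cross (v i) s) t := by
  induction s using TensorProduct.induction_on with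
  | zero => simp
  | add s s' hs ht => simp only [map_add, LinearMap.add_apply, hs, ht]
  | tmul x y =>
    rw [braidedMul_tmul, cross_gen_tmul_one_mul, cross_gen_tmul]
    simp [braidedMul_tmul]

theorem mul_braidedMul (x : A) (s t : A ⊗[K] A) :
    (x ⊗ₜ 1) * h.braidedMul s t = h.braidedMul ((x ⊗ₜ 1) * s) t := by
  induction s using TensorProduct.induction_on with
  | zero => simp
  | add s s' hs ht => simp only [map_add, LinearMap.add_apply, mul_add, hs, ht]
  | tmul x y => simp [braidedMul_tmul, ← mul_assoc]

theorem comulHom_eq_braidedMul (x : A) (t : A ⊗[K] A) :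
    h.comulHom x t = h.braidedMul (h.comul x) t := by
  induction x using h.induction_left with
  | one =>
    rw [comul_one, braidedMul_tmul, map_one, map_one, ← Algebra.TensorProduct.one_def, one_mul]
  | gen_mul i x ih =>
    rw [map_mul, Module.End.mul_apply, comulHom_gen, comul_gen_mul, ih, braidedMul_gen,
      mul_braidedMul, map_add, LinearMap.add_apply]
  | add x y hx hy => simp only [map_add, LinearMap.add_apply, hx, hy]
  | smul c x hx => simp only [map_smul, LinearMap.smul_apply, hx]

theorem comul_mul (x y : A) : h.comul (x * y) = h.braidedMul (h.comul x) (h.comul y) := by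
  rw [comul_mul_eq_comulHom, comulHom_eq_braidedMul]

/-! ### Compatibility of the comultiplication with the braiding -/

theorem lTensor_comul_cross (x : A) (t : A ⊗[K] A) :
    h.crossOn h.comulHom x (h.comul.lTensor A t) = h.comul.lTensor A (h.cross x t) :=
  h.crossOn_lTensor (φ := Algebra.lmul K A) h.comul
    (fun i m => by simp [comul_mul_eq_comulHom]) x t

/-- Crossing the first tensor factor and then acting by `Δ (v i)` on the other two is the sum of
the two ways in which a primitive element can stop in the second or in the third factor. -/
theorem crossOn_comulHom_gen (i : ι) (t : A ⊗[K] (A ⊗[K] A)) :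
    h.crossOn h.comulHom (v i) t = TensorProduct.assoc K A A A ((h.cross (v i)).rTensor A
      ((TensorProduct.assoc K A A A).symm t)) + h.crossTwo (v i) t := by
  induction t using TensorProduct.induction_on with
  | zero => simp
  | add s t hs ht => simp only [map_add, hs, ht]; abel
  | tmul x t =>
    rw [crossOn_gen_tmul, crossTwo_gen_tmul]
    simp only [comulHom_gen, TensorProduct.tmul_add, Finset.sum_add_distrib]
    congr 1
    induction t using TensorProduct.induction_on with
    | zero => simp
    | add s t hs ht => simp only [map_add, mul_add, TensorProduct.tmul_add,
        Finset.sum_add_distrib, hs, ht]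
    | tmul u w => simp [cross_gen_tmul, TensorProduct.sum_tmul]

/-- The braiding of a generator with an element is compatible with the comultiplication. -/
theorem coeff_comul (i k : ι) (x : A) :
    h.comul (h.coeff i k x) = h.coeffTensor i k (h.comul x) := by
  induction x using h.induction_left generalizing i k with
  | one =>
    rw [comul_one, coeffTensor_tmul, coeff_one,
      Finset.sum_eq_single i (fun j _ hj => by simp [coeff_one, hj.symm]) (by simp)]
    by_cases hik : i = k <;> simp [coeff_one, comul_one, hik]
  | gen_mul m x ih =>
    have key (t : A ⊗[K] A) : h.coeffTensor i k ((v m ⊗ₜ 1) * t) =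
        ∑ j, (h.coeff i j (v m) ⊗ₜ 1) * h.coeffTensor j k t := by
      induction t using TensorProduct.induction_on with
      | zero => simp
      | add s t hs ht => simp only [map_add, mul_add, Finset.sum_add_distrib, hs, ht]
      | tmul u w =>
        simp only [coeffTensor_tmul, Algebra.TensorProduct.tmul_mul_tmul, coeff_mul, one_mul,
          TensorProduct.sum_tmul, Finset.mul_sum]
        rw [Finset.sum_comm]
    rw [comul_gen_mul, map_add, key, ← cross_coeff_coeffTensor, ← Finset.sum_add_distrib,
      coeff_mul, map_sum]
    refine Finset.sum_congr rfl fun j _ => ?_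
    simp [coeff_gen, Finset.sum_mul, comul_gen_mul, ih, TensorProduct.sum_tmul,
      ← TensorProduct.smul_tmul', Finset.sum_add_distrib]
  | add x y hx hy => simp only [map_add, hx, hy]
  | smul c x hx => simp only [map_smul, hx]

theorem rTensor_comul_cross (x : A) (t : A ⊗[K] A) :
    h.crossTwo x (TensorProduct.assoc K A A A (h.comul.rTensor A t)) =
      TensorProduct.assoc K A A A (h.comul.rTensor A (h.cross x t)) := by
  refine h.crossOn_comm_of_gen (φ := Algebra.lmul K A)
    ((TensorProduct.assoc K A A A).toLinearMap ∘ₗ h.comul.rTensor A) (fun i y z => ?_) x t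
  change h.crossTwo (v i) (TensorProduct.assoc K A A A (h.comul.rTensor A (y ⊗ₜ z))) =
    TensorProduct.assoc K A A A (h.comul.rTensor A (h.cross (v i) (y ⊗ₜ z)))
  simp only [LinearMap.rTensor_tmul, crossTwo_gen_assoc, cross_gen_tmul, map_sum, coeff_comul]

theorem coassoc_apply (x : A) : h.comul.lTensor A (h.comul x) =
    TensorProduct.assoc K A A A (h.comul.rTensor A (h.comul x)) := by
  have key (i : ι) (t : A ⊗[K] A) : h.comul.lTensor A ((v i ⊗ₜ 1) * t) =
      (v i ⊗ₜ (1 ⊗ₜ 1)) * h.comul.lTensor A t := by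
    induction t using TensorProduct.induction_on with
    | zero => simp
    | add s t hs ht => simp only [map_add, mul_add, hs, ht]
    | tmul u w => simp [← Algebra.TensorProduct.one_def]
  have key' (i : ι) (t : A ⊗[K] A) :
      TensorProduct.assoc K A A A (h.comul.rTensor A ((v i ⊗ₜ 1) * t)) =
      (v i ⊗ₜ (1 ⊗ₜ 1)) * TensorProduct.assoc K A A A (h.comul.rTensor A t) +
      TensorProduct.assoc K A A A ((h.cross (v i)).rTensor A (h.comul.rTensor A t)) := by
    induction t using TensorProduct.induction_on with
    | zero => simp
    | add s t hs ht => simp only [map_add, mul_add, hs, ht]; abel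
    | tmul u w =>
      simp only [Algebra.TensorProduct.tmul_mul_tmul, one_mul, LinearMap.rTensor_tmul,
        comul_gen_mul, TensorProduct.add_tmul, map_add]
      congr 1
      generalize h.comul u = s
      induction s using TensorProduct.induction_on with
      | zero => simp
      | add s t hs ht => simp only [map_add, mul_add, TensorProduct.add_tmul, hs, ht]
      | tmul p q => simp
  induction x using h.induction_left with
  | one => simp [comul_one]
  | gen_mul i x ih =>
    rw [comul_gen_mul, map_add, map_add, map_add, key, key', ← lTensor_comul_cross,
      crossOn_comulHom_gen, ← rTensor_comul_cross, ih, LinearEquiv.symm_apply_apply]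
    abel
  | add x y hx hy => simp only [map_add, hx, hy]
  | smul c x hx => simp only [map_smul, hx]

end IsBraidedQuadratic

namespace IsBraidedQuadratic

variable {K A : Type u} {ι κ : Type} [CommRing K] [Ring A] [Algebra K A] [Fintype ι] [Fintype κ]
  [DecidableEq ι] {v : ι → A} {r : κ → ι → ι → K} {R : ι → ι → ι → ι → K}
  (h : IsBraidedQuadratic v r R)

theorem comul_left_braiding_tmul (x y : A) :
    TensorProduct.assoc K A A A (h.comul.rTensor A (h.braiding (x ⊗ₜ y))) =
      onLastTwo K A h.braiding (onFirstTwo K A h.braiding (x ⊗ₜ h.comul y)) := by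
  rw [onLastTwo_onFirstTwo_tmul, braiding_tmul, ← rTensor_comul_cross, LinearMap.rTensor_tmul]

theorem comul_right_braiding_tmul (x y : A) :
    h.comul.lTensor A (h.braiding (x ⊗ₜ y)) = onFirstTwo K A h.braiding
      (onLastTwo K A h.braiding (TensorProduct.assoc K A A A (h.comul x ⊗ₜ y))) := by
  have left (i : ι) (t : A ⊗[K] A) :
      onFirstTwo K A h.braiding (onLastTwo K A h.braiding
        (TensorProduct.assoc K A A A (((v i ⊗ₜ 1) * t) ⊗ₜ y))) =
      TensorProduct.assoc K A A A ((h.cross (v i)).rTensor A ((TensorProduct.assoc K A A A).symm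
        (onFirstTwo K A h.braiding (onLastTwo K A h.braiding
          (TensorProduct.assoc K A A A (t ⊗ₜ y)))))) := by
    induction t using TensorProduct.induction_on with
    | zero => simp
    | add s t hs ht => simp only [mul_add, TensorProduct.add_tmul, map_add, hs, ht]
    | tmul u w =>
      simp only [Algebra.TensorProduct.tmul_mul_tmul, one_mul, TensorProduct.assoc_tmul,
        onLastTwo_tmul]
      generalize h.braiding (w ⊗ₜ y) = s
      induction s using TensorProduct.induction_on with
      | zero => simp
      | add s t hs ht => simp only [TensorProduct.tmul_add, map_add, hs, ht]
      | tmul p q => simp [onFirstTwo_tmul, braiding_mul_tmul]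
  have right (i : ι) (t : A ⊗[K] A) :
      onLastTwo K A h.braiding (TensorProduct.assoc K A A A (h.cross (v i) t ⊗ₜ y)) =
      h.crossTwo (v i) (onLastTwo K A h.braiding (TensorProduct.assoc K A A A (t ⊗ₜ y))) := by
    induction t using TensorProduct.induction_on with
    | zero => simp
    | add s t hs ht => simp only [TensorProduct.add_tmul, map_add, hs, ht]
    | tmul u w =>
      simp [cross_gen_tmul, TensorProduct.sum_tmul, onLastTwo_tmul, crossTwo_gen_tmul,
        braiding_mul_tmul]
  rw [braiding_tmul, ← lTensor_comul_cross, LinearMap.lTensor_tmul, comul_one]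
  induction x using h.induction_left with
  | one => simp [comul_one, onLastTwo_tmul, onFirstTwo_tmul, braiding_one_tmul]
  | gen_mul i x ih =>
    rw [crossOn_mul_apply, ih, comul_gen_mul, crossOn_comulHom_gen, TensorProduct.add_tmul,
      map_add, map_add, map_add, left, right, crossTwo_onFirstTwo]
  | add x y hx hy => simp only [TensorProduct.add_tmul, map_add, LinearMap.add_apply, hx, hy]
  | smul c x hx =>
    simp only [← TensorProduct.smul_tmul', map_smul, LinearMap.smul_apply, hx]

/-! ### The counit -/

omit [DecidableEq ι] in
include h in
theorem exists_counit : ∃ φ : A →ₐ[K] K, ∀ i, φ (v i) = 0 :=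
  h.exists_lift K 0 (by simp)

/-- The counit of `A`, which vanishes on the generators. -/
noncomputable def counit : A →ₐ[K] K := h.exists_counit.choose

omit [DecidableEq ι] in
theorem counit_gen (i : ι) : h.counit (v i) = 0 := h.exists_counit.choose_spec i

theorem counit_coeff (i j : ι) (x : A) :
    h.counit (h.coeff i j x) = if i = j then h.counit x else 0 := by
  induction x using h.induction_left generalizing i j with
  | one => rw [coeff_one, apply_ite h.counit]; simp
  | gen_mul m x ih => simp [coeff_mul, coeff_gen, counit_gen]
  | add x y hx hy => simp only [map_add, hx, hy]; split_ifs <;> simp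
  | smul c x hx => simp only [map_smul, hx]; split_ifs <;> simp

theorem counit_comul_apply (x : A) :
    TensorProduct.lid K A (h.counit.toLinearMap.rTensor A (h.comul x)) = x := by
  have left (i : ι) (t : A ⊗[K] A) :
      h.counit.toLinearMap.rTensor A ((v i ⊗ₜ 1) * t) = 0 := by
    induction t using TensorProduct.induction_on with
    | zero => simp
    | add s t hs ht => simp only [mul_add, map_add, hs, ht, add_zero]
    | tmul u w => simp [counit_gen]
  have right (i : ι) (t : A ⊗[K] A) :
      TensorProduct.lid K A (h.counit.toLinearMap.rTensor A (h.cross (v i) t)) =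
        v i * TensorProduct.lid K A (h.counit.toLinearMap.rTensor A t) := by
    induction t using TensorProduct.induction_on with
    | zero => simp
    | add s t hs ht => simp only [mul_add, map_add, hs, ht]
    | tmul u w => simp [cross_gen_tmul, counit_coeff]
  induction x using h.induction_left with
  | one => simp [comul_one]
  | gen_mul i x ih => rw [comul_gen_mul, map_add, map_add, left, right, ih]; simp
  | add x y hx hy => simp only [map_add, hx, hy]
  | smul c x hx => simp only [map_smul, hx]

theorem comul_counit_apply (x : A) :
    TensorProduct.rid K A (h.counit.toLinearMap.lTensor A (h.comul x)) = x := by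
  have left (i : ι) (t : A ⊗[K] A) :
      TensorProduct.rid K A (h.counit.toLinearMap.lTensor A ((v i ⊗ₜ 1) * t)) =
        v i * TensorProduct.rid K A (h.counit.toLinearMap.lTensor A t) := by
    induction t using TensorProduct.induction_on with
    | zero => simp
    | add s t hs ht => simp only [mul_add, map_add, hs, ht]
    | tmul u w => simp
  have right (i : ι) (t : A ⊗[K] A) :
      h.counit.toLinearMap.lTensor A (h.cross (v i) t) = 0 := by
    induction t using TensorProduct.induction_on with
    | zero => simp
    | add s t hs ht => simp only [map_add, hs, ht, add_zero]
    | tmul u w => simp [cross_gen_tmul, counit_gen]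
  induction x using h.induction_left with
  | one => simp [comul_one]
  | gen_mul i x ih => rw [comul_gen_mul, map_add, map_add, left, right, ih]; simp
  | add x y hx hy => simp only [map_add, hx, hy]
  | smul c x hx => simp only [map_smul, hx]

/-! ### The antipode -/

/-- The endomorphism `u ↦ m (ψ (-v i ⊗ u))` of `A`. -/
noncomputable def genAntipode (i : ι) : Module.End K A :=
  -∑ j, LinearMap.mulRight K (v j) ∘ₗ h.coeff i j

theorem genAntipode_apply (i : ι) (x : A) :
    h.genAntipode i x = -∑ j, h.coeff i j x * v j := by
  simp [genAntipode]

/-- The operators `genAntipode` satisfy the relations: the composition of two of them involves the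
products `m (R (v i ⊗ v j))`, and `R` is `-1` on the relations. -/
theorem exists_antipodeHom : ∃ φ : A →ₐ[K] Module.End K A, ∀ i, φ (v i) = h.genAntipode i := by
  refine h.exists_lift (Module.End K A) h.genAntipode fun α => LinearMap.ext fun x => ?_
  have := h.sum_rel_coeff_coeff
    (fun k l => LinearMap.mulRight K (∑ p, ∑ n, R k l p n • (v p * v n))) (fun β y => by
      have hβ : ∑ k, ∑ l, r β k l • ∑ p, ∑ n, R k l p n • (v p * v n) = 0 := by
        calc _ = ∑ p, ∑ n, (∑ k, ∑ l, r β k l * R k l p n) • (v p * v n) := by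
              simp only [Finset.sum_smul, Finset.smul_sum, smul_smul]
              rw [Fintype.sum_comm_pairs]
          _ = 0 := by simp [h.rel_eigen, h.rel]
      have := congrArg (y * ·) hβ
      simpa only [Finset.mul_sum, mul_smul_comm, mul_zero, LinearMap.mulRight_apply] using this)
    α x
  simp only [LinearMap.sum_apply, LinearMap.smul_apply, Module.End.mul_apply, genAntipode_apply,
    LinearMap.zero_apply]
  rw [← this]
  refine Finset.sum_congr rfl fun i _ => Finset.sum_congr rfl fun j _ => congrArg _ ?_
  simp only [map_neg, map_sum, coeff_mul, coeff_gen, LinearMap.mulRight_apply, Finset.mul_sum,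
    Finset.sum_mul, neg_mul, Finset.sum_neg_distrib, neg_neg, mul_smul_comm, smul_mul_assoc,
    mul_assoc]
  exact Finset.sum_comm_cycle.trans (Finset.sum_congr rfl fun k _ => Finset.sum_comm.trans
    (Finset.sum_congr rfl fun l _ => Finset.sum_comm))

/-- The left action of `A` on itself by `x ↦ (u ↦ m (ψ (S x ⊗ u)))`. -/
noncomputable def antipodeHom : A →ₐ[K] Module.End K A := h.exists_antipodeHom.choose

/-- The antipode of `A`, which is `-1` on generators. -/
noncomputable def antipode : A →ₗ[K] A := h.antipodeHom.toLinearMap.flip 1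

theorem antipode_gen_mul (i : ι) (x : A) :
    h.antipode (v i * x) = h.genAntipode i (h.antipode x) := by
  simp [antipode, antipodeHom, h.exists_antipodeHom.choose_spec i]

theorem antipode_mul_eq_antipodeHom (x y : A) :
    h.antipode (x * y) = h.antipodeHom x (h.antipode y) := by
  simp [antipode]

theorem antipode_one : h.antipode 1 = 1 := by simp [antipode]

theorem antipode_gen (i : ι) : h.antipode (v i) = -v i := by
  rw [← mul_one (v i), antipode_gen_mul, antipode_one, genAntipode_apply]
  simp [coeff_one]

/-- The antipode commutes with the braiding of a generator. -/
theorem coeff_antipode (i j : ι) (x : A) :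
    h.coeff i j (h.antipode x) = h.antipode (h.coeff i j x) := by
  induction x using h.induction_left generalizing i j with
  | one => rw [antipode_one, coeff_one]; split_ifs <;> simp [antipode_one]
  | gen_mul m x ih =>
    calc _ = -∑ l, (∑ k, ∑ n, R k n l j • h.coeff i k (h.coeff m n (h.antipode x))) * v l := by
          simp only [antipode_gen_mul, genAntipode_apply, map_neg, map_sum, coeff_mul, coeff_gen]
          simp only [Finset.mul_sum, Finset.sum_mul, mul_smul_comm, smul_mul_assoc]
          exact congrArg Neg.neg (Finset.sum_comm.trans Finset.sum_comm_cycle)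
      _ = -∑ l, (∑ p, ∑ n, R i m p n • h.coeff p l (h.coeff n j (h.antipode x))) * v l := by
          simp only [sum_smul_coeff_coeff]
      _ = _ := by
          simp only [coeff_mul, coeff_gen, map_sum, Finset.sum_mul, smul_mul_assoc, map_smul,
            antipode_gen_mul, genAntipode_apply, ← ih]
          simp only [smul_neg, Finset.sum_neg_distrib, Finset.smul_sum]
          exact congrArg Neg.neg
            (Finset.sum_comm_cycle.trans (Finset.sum_congr rfl fun _ _ => Finset.sum_comm))
  | add x y hx hy => simp only [map_add, hx, hy]
  | smul c x hx => simp only [map_smul, hx]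

/-- The endomorphism `(id ⊗ m) (ψ ⊗ id) (id ⊗ ψ) (-v i ⊗ ·)` of `A ⊗ A`. -/
noncomputable def genAntipodeTensor (i : ι) : Module.End K (A ⊗[K] A) :=
  -∑ k, LinearMap.mulRight K (1 ⊗ₜ v k) ∘ₗ h.coeffTensor i k

theorem genAntipodeTensor_apply (i : ι) (t : A ⊗[K] A) :
    h.genAntipodeTensor i t = -∑ k, h.coeffTensor i k t * (1 ⊗ₜ v k) := by
  simp [genAntipodeTensor]

theorem genAntipodeTensor_tmul (i : ι) (x y : A) :
    h.genAntipodeTensor i (x ⊗ₜ y) = ∑ j, h.coeff i j x ⊗ₜ h.genAntipode j y := by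
  simp only [genAntipodeTensor_apply, coeffTensor_tmul, genAntipode_apply, Finset.sum_mul,
    Algebra.TensorProduct.tmul_mul_tmul, mul_one, TensorProduct.tmul_neg, TensorProduct.tmul_sum,
    Finset.sum_neg_distrib]
  rw [Finset.sum_comm]

theorem braiding_genAntipode_tmul (i : ι) (t : A ⊗[K] A) :
    h.braiding ((h.genAntipode i).rTensor A t) = h.genAntipodeTensor i (h.braiding t) := by
  induction t using TensorProduct.induction_on with
  | zero => simp
  | add s t hs ht => simp only [map_add, hs, ht]
  | tmul y u =>
    rw [genAntipodeTensor_apply]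
    simp only [← braiding_coeffTensor, coeffTensor_tmul, LinearMap.rTensor_tmul,
      genAntipode_apply, TensorProduct.neg_tmul, TensorProduct.sum_tmul, map_neg, map_sum,
      braiding_mul_tmul, braiding_gen_tmul, cross_tmul, Finset.sum_mul]
    rw [Finset.sum_comm]

theorem lTensor_antipode_cross (i : ι) (t : A ⊗[K] A) :
    h.antipode.lTensor A (h.cross (v i) t) = h.genAntipodeTensor i (h.antipode.lTensor A t) := by
  induction t using TensorProduct.induction_on with
  | zero => simp
  | add s t hs ht => simp only [map_add, hs, ht]
  | tmul y u => simp [cross_gen_tmul, genAntipodeTensor_tmul, antipode_gen_mul]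

theorem mul'_genAntipodeTensor (i : ι) (t : A ⊗[K] A) :
    LinearMap.mul' K A (h.genAntipodeTensor i t) = h.genAntipode i (LinearMap.mul' K A t) := by
  induction t using TensorProduct.induction_on with
  | zero => simp
  | add s t hs ht => simp only [map_add, hs, ht]
  | tmul y u =>
    simp only [genAntipodeTensor_tmul, map_sum, LinearMap.mul'_apply, genAntipode_apply,
      coeff_mul, Finset.sum_mul, Finset.mul_sum, mul_neg, Finset.sum_neg_distrib, mul_assoc]
    rw [Finset.sum_comm]

theorem braiding_antipode_tmul (x y : A) :
    h.braiding (h.antipode x ⊗ₜ y) = h.antipode.lTensor A (h.braiding (x ⊗ₜ y)) := by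
  induction x using h.induction_left with
  | one => simp [antipode_one, braiding_one_tmul]
  | gen_mul i x ih =>
    rw [braiding_mul_tmul, lTensor_antipode_cross, ← ih, ← braiding_genAntipode_tmul,
      LinearMap.rTensor_tmul, antipode_gen_mul]
  | add x y hx hy => simp only [map_add, TensorProduct.add_tmul, hx, hy]
  | smul c x hx => simp only [map_smul, ← TensorProduct.smul_tmul', hx]

theorem braiding_tmul_antipode (x y : A) :
    h.braiding (x ⊗ₜ h.antipode y) = h.antipode.rTensor A (h.braiding (x ⊗ₜ y)) := by
  have := h.cross_comm_of_gen (h.antipode.rTensor A)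
    (fun i a b => by simp [cross_gen_tmul, coeff_antipode]) x (y ⊗ₜ 1)
  simpa only [braiding_tmul, LinearMap.rTensor_tmul] using this

theorem braiding_map_antipode (t : A ⊗[K] A) :
    h.braiding (TensorProduct.map h.antipode h.antipode t) =
      TensorProduct.map h.antipode h.antipode (h.braiding t) := by
  induction t using TensorProduct.induction_on with
  | zero => simp
  | add s t hs ht => simp only [map_add, hs, ht]
  | tmul x y =>
    rw [TensorProduct.map_tmul, braiding_antipode_tmul, braiding_tmul_antipode,
      ← LinearMap.comp_apply, LinearMap.lTensor_comp_rTensor]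

theorem antipode_mul (x y : A) : h.antipode (x * y) =
    LinearMap.mul' K A (h.braiding (h.antipode x ⊗ₜ h.antipode y)) := by
  rw [antipode_mul_eq_antipodeHom]
  generalize h.antipode y = u
  induction x using h.induction_left with
  | one => simp [antipode_one, braiding_one_tmul]
  | gen_mul i x ih =>
    rw [map_mul, Module.End.mul_apply, ih, antipodeHom, h.exists_antipodeHom.choose_spec,
      ← mul'_genAntipodeTensor, ← braiding_genAntipode_tmul, LinearMap.rTensor_tmul,
      antipode_gen_mul]
  | add x y hx hy => simp only [map_add, TensorProduct.add_tmul, LinearMap.add_apply, hx, hy]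
  | smul c x hx =>
    simp only [map_smul, ← TensorProduct.smul_tmul', LinearMap.smul_apply, hx]

theorem mul_antipode_right_apply (x : A) :
    LinearMap.mul' K A (h.antipode.lTensor A (h.comul x)) = algebraMap K A (h.counit x) := by
  have left (i : ι) (t : A ⊗[K] A) :
      LinearMap.mul' K A (h.antipode.lTensor A ((v i ⊗ₜ 1) * t)) =
        v i * LinearMap.mul' K A (h.antipode.lTensor A t) := by
    induction t using TensorProduct.induction_on with
    | zero => simp
    | add s t hs ht => simp only [mul_add, map_add, hs, ht]
    | tmul u w => simp [mul_assoc]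
  induction x using h.induction_left with
  | one => simp [comul_one, antipode_one]
  | gen_mul i x ih =>
    have hi : h.genAntipode i 1 = -v i := by
      simpa [antipode_one, antipode_gen] using (h.antipode_gen_mul i 1).symm
    rw [comul_gen_mul, map_add, map_add, left, lTensor_antipode_cross, mul'_genAntipodeTensor, ih,
      Algebra.algebraMap_eq_smul_one, map_smul, hi]
    simp [counit_gen]
  | add x y hx hy => simp only [map_add, hx, hy]
  | smul c x hx => simp only [map_smul, hx, Algebra.algebraMap_eq_smul_one, smul_assoc]

theorem mul_antipode_left_apply (x : A) :
    LinearMap.mul' K A (h.antipode.rTensor A (h.comul x)) = algebraMap K A (h.counit x) := by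
  have key (i : ι) (t : A ⊗[K] A) :
      LinearMap.mul' K A (h.antipode.rTensor A ((v i ⊗ₜ 1) * t)) +
        LinearMap.mul' K A (h.antipode.rTensor A (h.cross (v i) t)) = 0 := by
    induction t using TensorProduct.induction_on with
    | zero => simp
    | add s t hs ht =>
      simp only [mul_add, map_add]
      rw [add_add_add_comm, hs, ht, add_zero]
    | tmul u w =>
      simp [cross_gen_tmul, antipode_gen_mul, genAntipode_apply, coeff_antipode, Finset.sum_mul,
        mul_assoc]
  induction x using h.induction_left with
  | one => simp [comul_one, antipode_one]
  | gen_mul i x ih => rw [comul_gen_mul, map_add, map_add, key]; simp [counit_gen]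
  | add x y hx hy => simp only [map_add, hx, hy]
  | smul c x hx => simp only [map_smul, hx, Algebra.algebraMap_eq_smul_one, smul_assoc]

theorem braidedMul_one_tmul (t : A ⊗[K] A) (x : A) :
    h.braidedMul t (1 ⊗ₜ x) = t * (1 ⊗ₜ x) := by
  induction t using TensorProduct.induction_on with
  | zero => simp
  | add s t hs ht => simp only [add_mul, map_add, LinearMap.add_apply, hs, ht]
  | tmul u w => simp [braidedMul_tmul, cross_tmul_one]

theorem braidedMul_tmul_one (t : A ⊗[K] A) (x : A) :
    h.braidedMul t (x ⊗ₜ 1) = h.crossBack x t := by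
  induction t using TensorProduct.induction_on with
  | zero => simp
  | add s t hs ht => simp only [map_add, LinearMap.add_apply, hs, ht]
  | tmul u w => simp [braidedMul_tmul, crossBack_tmul, braiding_tmul]

theorem braiding_mul_one_tmul (t : A ⊗[K] A) (x : A) :
    h.braiding (t * (1 ⊗ₜ x)) = h.crossBack x (h.braiding t) := by
  induction t using TensorProduct.induction_on with
  | zero => simp
  | add s t hs ht => simp only [add_mul, map_add, hs, ht]
  | tmul u w => simp [braiding_tmul_mul]

theorem comul_antipode_apply (x : A) : h.comul (h.antipode x) =
    TensorProduct.map h.antipode h.antipode (h.braiding (h.comul x)) := by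
  have left (i : ι) (t : A ⊗[K] A) :
      TensorProduct.map h.antipode h.antipode ((v i ⊗ₜ 1) * t) =
        (h.genAntipode i).rTensor A (TensorProduct.map h.antipode h.antipode t) := by
    induction t using TensorProduct.induction_on with
    | zero => simp
    | add s t hs ht => simp only [mul_add, map_add, hs, ht]
    | tmul u w => simp [antipode_gen_mul]
  have right (i : ι) (t : A ⊗[K] A) :
      TensorProduct.map h.antipode h.antipode (h.cross (v i) t) =
        h.genAntipodeTensor i (TensorProduct.map h.antipode h.antipode t) := by
    induction t using TensorProduct.induction_on with
    | zero => simp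
    | add s t hs ht => simp only [map_add, hs, ht]
    | tmul u w =>
      simp [cross_gen_tmul, genAntipodeTensor_tmul, antipode_gen_mul, coeff_antipode]
  rw [← braiding_map_antipode]
  induction x using h.induction_left with
  | one => simp [comul_one, antipode_one, braiding_one_tmul]
  | gen_mul i x ih =>
    rw [comul_gen_mul, map_add, map_add, left, right, braiding_genAntipode_tmul, antipode_gen_mul,
      genAntipode_apply, map_neg, map_sum]
    simp only [comul_mul, coeff_comul, comul_gen, map_add, braidedMul_one_tmul,
      braidedMul_tmul_one, ih, genAntipodeTensor_apply, map_neg, map_sum, braiding_mul_one_tmul,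
      braiding_coeffTensor, Finset.sum_add_distrib, neg_add]
    rw [add_comm]
  | add x y hx hy => simp only [map_add, hx, hy]
  | smul c x hx => simp only [map_smul, hx]

theorem cross_eq_lTensor_mul' (x : A) (t : A ⊗[K] A) : h.cross x t =
    (LinearMap.mul' K A).lTensor A (onFirstTwo K A h.braiding (x ⊗ₜ t)) := by
  induction t using TensorProduct.induction_on with
  | zero => simp
  | add s t hs ht => simp only [TensorProduct.tmul_add, map_add, hs, ht]
  | tmul u w =>
    rw [cross_tmul, onFirstTwo_tmul]
    generalize h.braiding (x ⊗ₜ u) = s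
    induction s using TensorProduct.induction_on with
    | zero => simp
    | add s t hs ht => simp only [TensorProduct.add_tmul, add_mul, map_add, hs, ht]
    | tmul p q => simp

theorem crossBack_eq_rTensor_mul' (y : A) (t : A ⊗[K] A) : h.crossBack y t =
    (LinearMap.mul' K A).rTensor A ((TensorProduct.assoc K A A A).symm
      (onLastTwo K A h.braiding (TensorProduct.assoc K A A A (t ⊗ₜ y)))) := by
  induction t using TensorProduct.induction_on with
  | zero => simp
  | add s t hs ht => simp only [TensorProduct.add_tmul, map_add, hs, ht]
  | tmul u w =>
    rw [crossBack_tmul, TensorProduct.assoc_tmul, onLastTwo_tmul]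
    generalize h.braiding (w ⊗ₜ y) = s
    induction s using TensorProduct.induction_on with
    | zero => simp
    | add s t hs ht => simp only [TensorProduct.tmul_add, mul_add, map_add, hs, ht]
    | tmul p q => simp

/-- The braided Hopf algebra structure of a quadratic algebra with a compatible braiding. -/
noncomputable def braidedHopf : BraidedHopfStructure K A where
  comul := h.comul
  counit := h.counit.toLinearMap
  antipode := h.antipode
  braiding := h.braiding
  coassoc := LinearMap.ext h.coassoc_apply
  counit_comul := LinearMap.ext h.counit_comul_apply
  comul_counit := LinearMap.ext h.comul_counit_apply
  mul_antipode_right := LinearMap.ext h.mul_antipode_right_apply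
  mul_antipode_left := LinearMap.ext h.mul_antipode_left_apply
  braiding_mul_left := TensorProduct.ext' fun x t => by
    induction t using TensorProduct.induction_on with
    | zero => simp
    | add s t hs ht => simp only [TensorProduct.tmul_add, map_add, hs, ht]
    | tmul y z => simp [onLastTwo_tmul, ← cross_eq_lTensor_mul', braiding_mul_tmul]
  braiding_mul_right := TensorProduct.ext' fun x t => by
    induction t using TensorProduct.induction_on with
    | zero => simp
    | add s t hs ht => simp only [TensorProduct.tmul_add, map_add, hs, ht]
    | tmul y z => simp [onFirstTwo_tmul, ← crossBack_eq_rTensor_mul', braiding_tmul_mul]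
  comul_right_braiding := TensorProduct.ext' h.comul_right_braiding_tmul
  comul_left_braiding := TensorProduct.ext' h.comul_left_braiding_tmul
  comul_mul := TensorProduct.ext' fun x y => by
    simp [comul_mul, braidedMul_eq_map]
  antipode_mul := TensorProduct.ext' fun x y => by simp [antipode_mul]
  comul_antipode := LinearMap.ext h.comul_antipode_apply
  counit_mul := TensorProduct.ext' fun x y => by simp
  yang_baxter := TensorProduct.ext' h.yang_baxter_tmul
  comul_one := h.comul_one
  braiding_one_left := h.braiding_one_tmul
  braiding_one_right := h.braiding_tmul_one

end IsBraidedQuadratic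

namespace IsBraidedQuadratic

variable {K A : Type u} {ι κ : Type} [CommRing K] [Ring A] [Algebra K A] [Fintype ι] [Fintype κ]
  [DecidableEq ι] {v : ι → A} {r : κ → ι → ι → K} {R : ι → ι → ι → ι → K}
  (h : IsBraidedQuadratic v r R)

/-! ### Uniqueness -/

theorem _root_.BraidedHopfStructure.braiding_mul_tmul {K A : Type*} [CommRing K] [Ring A]
    [Algebra K A] (H : BraidedHopfStructure K A) (x y z : A) : H.braiding ((x * y) ⊗ₜ z) =
      (LinearMap.mul' K A).lTensor A
        (onFirstTwo K A H.braiding (x ⊗ₜ H.braiding (y ⊗ₜ z))) := by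
  simpa [onLastTwo_tmul] using LinearMap.congr_fun H.braiding_mul_left (x ⊗ₜ (y ⊗ₜ z))

theorem _root_.BraidedHopfStructure.braiding_tmul_mul {K A : Type*} [CommRing K] [Ring A]
    [Algebra K A] (H : BraidedHopfStructure K A) (x y z : A) : H.braiding (x ⊗ₜ (y * z)) =
      (LinearMap.mul' K A).rTensor A ((TensorProduct.assoc K A A A).symm
        (onLastTwo K A H.braiding
          (TensorProduct.assoc K A A A (H.braiding (x ⊗ₜ y) ⊗ₜ z)))) := by
  simpa [onFirstTwo_tmul] using LinearMap.congr_fun H.braiding_mul_right (x ⊗ₜ (y ⊗ₜ z))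

theorem _root_.BraidedHopfStructure.comul_mul_apply {K A : Type*} [CommRing K] [Ring A]
    [Algebra K A] (H : BraidedHopfStructure K A) (x y : A) : H.comul (x * y) =
      TensorProduct.map (LinearMap.mul' K A) (LinearMap.mul' K A)
        (onMiddleTwo K A H.braiding (H.comul x ⊗ₜ H.comul y)) := by
  simpa using LinearMap.congr_fun H.comul_mul (x ⊗ₜ y)

theorem _root_.BraidedHopfStructure.antipode_mul_apply {K A : Type*} [CommRing K] [Ring A]
    [Algebra K A] (H : BraidedHopfStructure K A) (x y : A) : H.antipode (x * y) =
      LinearMap.mul' K A (H.braiding (H.antipode x ⊗ₜ H.antipode y)) := by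
  simpa using LinearMap.congr_fun H.antipode_mul (x ⊗ₜ y)

theorem _root_.BraidedHopfStructure.counit_mul_apply {K A : Type*} [CommRing K] [Ring A]
    [Algebra K A] (H : BraidedHopfStructure K A) (x y : A) :
    H.counit (x * y) = H.counit x * H.counit y := by
  simpa using LinearMap.congr_fun H.counit_mul (x ⊗ₜ y)

theorem braiding_unique (H : BraidedHopfStructure K A)
    (hψ : ∀ i j, H.braiding (v i ⊗ₜ v j) = ∑ k, ∑ l, R i j k l • (v k ⊗ₜ v l)) :
    H.braiding = h.braiding := by
  have gen (i : ι) (y : A) : H.braiding (v i ⊗ₜ y) = h.braiding (v i ⊗ₜ y) := by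
    rw [braiding_gen_tmul]
    induction y using h.induction_left generalizing i with
    | one => simp [H.braiding_one_right, coeff_one, TensorProduct.ite_tmul]
    | gen_mul m y ih =>
      rw [H.braiding_tmul_mul, hψ]
      simp only [TensorProduct.sum_tmul, map_sum, ← TensorProduct.smul_tmul', map_smul,
        TensorProduct.assoc_tmul, onLastTwo_tmul, ih, TensorProduct.tmul_sum,
        TensorProduct.assoc_symm_tmul, LinearMap.rTensor_tmul, LinearMap.mul'_apply, coeff_mul,
        coeff_gen, Finset.sum_mul, smul_mul_assoc, Finset.smul_sum]
      rw [Finset.sum_comm_cycle]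
      exact Finset.sum_congr rfl fun _ _ => Finset.sum_comm
    | add x y hx hy =>
      simp only [TensorProduct.tmul_add, map_add, hx, hy, TensorProduct.add_tmul,
        Finset.sum_add_distrib]
    | smul c x hx =>
      simp only [TensorProduct.tmul_smul, map_smul, hx, ← TensorProduct.smul_tmul',
        Finset.smul_sum]
  have first (i : ι) (t : A ⊗[K] A) : onFirstTwo K A H.braiding (v i ⊗ₜ t) =
      onFirstTwo K A h.braiding (v i ⊗ₜ t) := by
    induction t using TensorProduct.induction_on with
    | zero => simp
    | add s t hs ht => simp only [TensorProduct.tmul_add, map_add, hs, ht]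
    | tmul u w => rw [onFirstTwo_tmul, onFirstTwo_tmul, gen]
  refine TensorProduct.ext' fun x y => ?_
  induction x using h.induction_left with
  | one => rw [H.braiding_one_left, braiding_one_tmul]
  | gen_mul i x ih =>
    rw [H.braiding_mul_tmul, braiding_mul_tmul, cross_eq_lTensor_mul', ih, first]
  | add x y hx hy => simp only [TensorProduct.add_tmul, map_add, hx, hy]
  | smul c x hx => simp only [← TensorProduct.smul_tmul', map_smul, hx]

omit [DecidableEq ι] in
include h in
theorem counit_one_of_braidedHopf (H : BraidedHopfStructure K A) : H.counit 1 = 1 := by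
  have := congrArg h.counit (LinearMap.congr_fun H.counit_comul 1)
  simpa [H.comul_one] using this

/-- A braided Hopf algebra structure with primitive generators is determined by the braiding of
the generators. -/
theorem eq_braidedHopf (H : BraidedHopfStructure K A)
    (hψ : ∀ i j, H.braiding (v i ⊗ₜ v j) = ∑ k, ∑ l, R i j k l • (v k ⊗ₜ v l))
    (hΔ : ∀ i, H.comul (v i) = v i ⊗ₜ 1 + 1 ⊗ₜ v i) (hε : ∀ i, H.counit (v i) = 0)
    (hS : ∀ i, H.antipode (v i) = -v i) : H = h.braidedHopf := by
  have hψ' := h.braiding_unique H hψ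
  have hε1 := h.counit_one_of_braidedHopf H
  have hS1 : H.antipode 1 = 1 := by
    simpa [H.comul_one, hε1] using LinearMap.congr_fun H.mul_antipode_right 1
  refine BraidedHopfStructure.ext (LinearMap.ext fun x => ?_) (LinearMap.ext fun x => ?_)
    (LinearMap.ext fun x => ?_) hψ'
  · refine h.linearMap_ext_left (by rw [H.comul_one]; exact h.comul_one.symm)
      (fun i x hx => ?_) x
    change H.comul x = h.comul x at hx
    change H.comul (v i * x) = h.comul (v i * x)
    rw [H.comul_mul_apply, h.comul_mul, braidedMul_eq_map, hx, hψ', hΔ, comul_gen]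
  · refine h.linearMap_ext_left (by rw [hε1]; exact (map_one h.counit).symm)
      (fun i x _ => ?_) x
    change H.counit (v i * x) = h.counit (v i * x)
    rw [H.counit_mul_apply, hε, map_mul, counit_gen, zero_mul, zero_mul]
  · refine h.linearMap_ext_left (by rw [hS1]; exact h.antipode_one.symm)
      (fun i x hx => ?_) x
    change H.antipode x = h.antipode x at hx
    change H.antipode (v i * x) = h.antipode (v i * x)
    rw [H.antipode_mul_apply, h.antipode_mul, hx, hψ', hS, antipode_gen]

/-! ### Compatibility with an anti-multiplicative involution -/

section star

variable {σ : K →+* K} (st : A →ₛₗ[σ] A) (τ : ι → ι)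

/-- If a semilinear anti-multiplicative map permutes the generators compatibly with the braiding
matrix, then it is compatible with the braiding of a generator and an arbitrary element. -/
theorem braiding_star_tmul_gen (st_one : st 1 = 1) (st_mul : ∀ x y, st (x * y) = st y * st x)
    (st_gen : ∀ i, st (v i) = v (τ i))
    (hR : ∀ i j, h.braiding (v (τ j) ⊗ₜ v (τ i)) =
      ∑ k, ∑ l, σ (R i j k l) • (v (τ l) ⊗ₜ v (τ k))) (i : ι) (x : A) :
    h.braiding (st x ⊗ₜ v (τ i)) = ∑ j, v (τ j) ⊗ₜ st (h.coeff i j x) := by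
  induction x using h.induction_left generalizing i with
  | one =>
    rw [st_one, braiding_one_tmul,
      Finset.sum_eq_single i (fun j _ hj => by simp [coeff_one, hj.symm]) (by simp)]
    simp [coeff_one, st_one]
  | gen_mul m x ih =>
    rw [st_mul, braiding_mul_tmul, st_gen, hR]
    simp only [map_sum, map_smul, cross_tmul, ih, coeff_mul, coeff_gen, Finset.sum_mul,
      smul_mul_assoc, map_smulₛₗ, st_mul, st_gen, TensorProduct.tmul_sum,
      Algebra.TensorProduct.tmul_mul_tmul, mul_one, TensorProduct.tmul_smul, Finset.smul_sum]
    rw [Finset.sum_comm_cycle]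
    exact Finset.sum_congr rfl fun _ _ => Finset.sum_comm
  | add x y hx hy =>
    simp only [map_add, TensorProduct.add_tmul, TensorProduct.tmul_add, hx, hy,
      Finset.sum_add_distrib]
  | smul c x hx =>
    simp only [map_smulₛₗ, ← TensorProduct.smul_tmul', TensorProduct.tmul_smul, hx,
      Finset.smul_sum, RingHom.id_apply]

theorem comul_star (st_one : st 1 = 1) (st_mul : ∀ x y, st (x * y) = st y * st x)
    (st_gen : ∀ i, st (v i) = v (τ i))
    (hR : ∀ i j, h.braiding (v (τ j) ⊗ₜ v (τ i)) =
      ∑ k, ∑ l, σ (R i j k l) • (v (τ l) ⊗ₜ v (τ k))) (x : A) :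
    h.comul (st x) = TensorProduct.comm K A A (TensorProduct.map st st (h.comul x)) := by
  have left (i : ι) (t : A ⊗[K] A) :
      TensorProduct.comm K A A (TensorProduct.map st st ((v i ⊗ₜ 1) * t)) =
        TensorProduct.comm K A A (TensorProduct.map st st t) * (1 ⊗ₜ v (τ i)) := by
    induction t using TensorProduct.induction_on with
    | zero => simp
    | add s t hs ht => simp only [mul_add, add_mul, map_add, hs, ht]
    | tmul u w => simp [st_mul, st_gen]
  have right (i : ι) (t : A ⊗[K] A) :
      TensorProduct.comm K A A (TensorProduct.map st st (h.cross (v i) t)) =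
        h.crossBack (v (τ i)) (TensorProduct.comm K A A (TensorProduct.map st st t)) := by
    induction t using TensorProduct.induction_on with
    | zero => simp
    | add s t hs ht => simp only [map_add, hs, ht]
    | tmul u w =>
      simp [cross_gen_tmul, crossBack_tmul, st_mul, st_gen,
        h.braiding_star_tmul_gen st τ st_one st_mul st_gen hR, Finset.mul_sum]
  induction x using h.induction_left with
  | one => simp [st_one, comul_one]
  | gen_mul i x ih =>
    rw [st_mul, comul_mul, ih, st_gen, comul_gen, map_add, braidedMul_one_tmul,
      braidedMul_tmul_one, comul_gen_mul, map_add, map_add, left, right, add_comm]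
  | add x y hx hy => simp only [map_add, hx, hy]
  | smul c x hx => simp only [map_smulₛₗ, RingHom.id_apply, hx]

theorem antipode_star (st_one : st 1 = 1) (st_mul : ∀ x y, st (x * y) = st y * st x)
    (st_gen : ∀ i, st (v i) = v (τ i))
    (hR : ∀ i j, h.braiding (v (τ j) ⊗ₜ v (τ i)) =
      ∑ k, ∑ l, σ (R i j k l) • (v (τ l) ⊗ₜ v (τ k))) (x : A) :
    h.antipode (st x) = st (h.antipode x) := by
  induction x using h.induction_left with
  | one => simp [st_one, antipode_one]
  | gen_mul i x ih =>
    rw [st_mul, antipode_mul, ih, st_gen, antipode_gen, TensorProduct.tmul_neg, map_neg, map_neg,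
      h.braiding_star_tmul_gen st τ st_one st_mul st_gen hR, antipode_gen_mul, genAntipode_apply]
    simp [st_mul, st_gen]
  | add x y hx hy => simp only [map_add, hx, hy]
  | smul c x hx => simp only [map_smulₛₗ, RingHom.id_apply, hx]

end star

end IsBraidedQuadratic

/-! ### The oscillator algebra as a quadratic algebra -/

/-- If the relations are exactly the `-1`-eigenvectors of a solution `R` of the Yang–Baxter equation,
then `R` moves them through the generators. By the Yang–Baxter equation, what results from moving a
relation through a generator is again an eigenvector for `-1`. -/
theorem IsCompatibleBraiding.of_exact {K : Type u} {ι κ : Type} [CommRing K] [Fintype ι]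
    [Fintype κ] {r : κ → ι → ι → K} {R : ι → ι → ι → ι → K}
    (yang_baxter : ∀ i j k l m n, ∑ a, ∑ b, ∑ c, R i j a b * R b k c n * R a c l m =
      ∑ a, ∑ b, ∑ c, R j k a b * R i a l c * R c b m n)
    (rel_eigen : ∀ α k l, ∑ i, ∑ j, r α i j * R i j k l = -r α k l)
    (exact : ∀ w : ι → ι → K, (∀ k l, ∑ i, ∑ j, w i j * R i j k l = -w k l) →
      ∃ n : κ → K, ∀ k l, w k l = ∑ β, n β * r β k l) :
    IsCompatibleBraiding r R where
  yang_baxter := yang_baxter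
  rel_eigen := rel_eigen
  rel_left := by
    have (α : κ) (i l : ι) := exact
      (fun k k' => ∑ j, ∑ j', ∑ m, r α j j' * R i j k m * R m j' k' l) fun p p' => by
        calc _ = ∑ j, ∑ j', r α j j' *
                ∑ k, ∑ m, ∑ k', R i j k m * R m j' k' l * R k k' p p' := by
              simp only [Finset.mul_sum, Finset.sum_mul]
              rw [Fintype.sum_comm_pairs]
              refine Finset.sum_congr rfl fun j _ => Finset.sum_congr rfl fun j' _ =>
                Finset.sum_congr rfl fun k _ => Finset.sum_comm.trans ?_
              simp only [mul_assoc]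
          _ = ∑ a, ∑ b, ∑ c, (∑ j, ∑ j', r α j j' * R j j' a b) * R i a p c * R c b p' l := by
              simp only [yang_baxter, Finset.mul_sum, Finset.sum_mul]
              rw [Fintype.sum_comm_pairs]
              refine Finset.sum_congr rfl fun a _ => Finset.sum_congr rfl fun b _ =>
                Finset.sum_comm_cycle.trans ?_
              simp only [mul_assoc]
          _ = _ := by simp [rel_eigen]
    choose N hN using this
    exact ⟨N, fun α i l k k' => hN α i l k k'⟩
  rel_right := by
    have (α : κ) (d p : ι) := exact
      (fun k l => ∑ i, ∑ j, ∑ m, r α i j * R j d m l * R i m p k) fun x y => by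
        calc _ = ∑ i, ∑ j, r α i j *
                ∑ m, ∑ l, ∑ k, R j d m l * R i m p k * R k l x y := by
              simp only [Finset.mul_sum, Finset.sum_mul]
              rw [Fintype.sum_comm_pairs]
              refine Finset.sum_congr rfl fun i _ => Finset.sum_congr rfl fun j _ =>
                (Finset.sum_comm.trans Finset.sum_comm_cycle).trans ?_
              simp only [mul_assoc]
          _ = ∑ a, ∑ b, ∑ c, (∑ i, ∑ j, r α i j * R i j a b) * R b d c y * R a c p x := by
              simp only [← yang_baxter, Finset.mul_sum, Finset.sum_mul]
              rw [Fintype.sum_comm_pairs]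
              refine Finset.sum_congr rfl fun a _ => Finset.sum_congr rfl fun b _ =>
                Finset.sum_comm_cycle.trans ?_
              simp only [mul_assoc]
          _ = _ := by simp [rel_eigen]
    choose N hN using this
    exact ⟨N, fun α d p k l => hN α d p k l⟩

instance : Fintype OscGen where
  elems := ⟨↑[OscGen.a, OscGen.aStar, OscGen.qN], by simp⟩
  complete x := by cases x <;> simp

instance : DecidableEq OscGen := fun x y => by
  cases x <;> cases y <;> first | exact isTrue rfl | exact isFalse (by simp)

theorem OscGen.sum_eq {M : Type*} [AddCommMonoid M] (f : OscGen → M) :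
    ∑ x, f x = f .a + f .aStar + f .qN := by
  simp [Finset.sum, Finset.univ, Fintype.elems, add_assoc]

/-- The coefficients of the three defining relations of the oscillator algebra. -/
def fibRelCoeff {K : Type u} [CommRing K] (q Q₁ : K) : Fin 3 → OscGen → OscGen → K
  | 0, .a, .qN => 1
  | 0, .qN, .a => -q
  | 1, .qN, .aStar => 1
  | 1, .aStar, .qN => -q
  | 2, .a, .aStar => 1
  | 2, .aStar, .a => -Q₁
  | 2, .qN, .qN => -1
  | _, _, _ => 0

namespace FibOsc

variable {K : Type u} [CommRing K] (q Q₁ : K)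

/-- `neg_smul` for the oscillator algebra, with the scalar action of the ring quotient, which
`neg_smul` does not unify with. -/
theorem neg_smul' (c : K) (x : FibOsc q Q₁) : (-c) • x = -(c • x) := neg_smul c x

theorem a_mul_qN : a q Q₁ * qN q Q₁ = q • (qN q Q₁ * a q Q₁) := by
  have := RingQuot.mkAlgHom_rel K (FibRel.a_qN (q := q) (Q₁ := Q₁))
  rw [map_smul, map_mul, map_mul] at this
  exact this

theorem qN_mul_aStar : qN q Q₁ * aStar q Q₁ = q • (aStar q Q₁ * qN q Q₁) := by
  have := RingQuot.mkAlgHom_rel K (FibRel.qN_aStar (q := q) (Q₁ := Q₁))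
  rw [map_smul, map_mul, map_mul] at this
  exact this

theorem a_mul_aStar :
    a q Q₁ * aStar q Q₁ = Q₁ • (aStar q Q₁ * a q Q₁) + qN q Q₁ * qN q Q₁ := by
  have := RingQuot.mkAlgHom_rel K (FibRel.a_aStar (q := q) (Q₁ := Q₁))
  rw [map_sub, map_smul, map_mul, map_mul, map_pow, sub_eq_iff_eq_add', pow_two] at this
  exact this

theorem exists_lift {B : Type*} [Ring B] [Algebra K B] (f : OscGen → B)
    (h₁ : f .a * f .qN = q • (f .qN * f .a)) (h₂ : f .qN * f .aStar = q • (f .aStar * f .qN))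
    (h₃ : f .a * f .aStar = Q₁ • (f .aStar * f .a) + f .qN * f .qN) :
    ∃ φ : FibOsc q Q₁ →ₐ[K] B, ∀ x, φ (gen q Q₁ x) = f x := by
  refine ⟨RingQuot.liftAlgHom K ⟨FreeAlgebra.lift K f, fun x y hxy => ?_⟩, fun x => ?_⟩
  · cases hxy with
    | a_qN => simpa using h₁
    | qN_aStar => simpa using h₂
    | a_aStar => simpa [sub_eq_iff_eq_add', pow_two] using h₃
  · simp [gen]

theorem isQuadraticPresentation :
    IsQuadraticPresentation (gen q Q₁) (fibRelCoeff q Q₁) where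
  adjoin_eq_top := by
    have : Set.range (gen q Q₁) =
        RingQuot.mkAlgHom K (FibRel q Q₁) '' Set.range (FreeAlgebra.ι K) := by
      rw [← Set.range_comp]; rfl
    rw [this, ← AlgHom.map_adjoin, FreeAlgebra.adjoin_range_ι, Algebra.map_top,
      AlgHom.range_eq_top]
    exact RingQuot.mkAlgHom_surjective K _
  rel α := by
    have h₁ := a_mul_qN q Q₁
    have h₂ := qN_mul_aStar q Q₁
    have h₃ := a_mul_aStar q Q₁
    simp only [a, aStar, qN] at h₁ h₂ h₃
    fin_cases α
    · simp [OscGen.sum_eq, fibRelCoeff, h₁, neg_smul']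
    · simp [OscGen.sum_eq, fibRelCoeff, h₂, neg_smul']
    · simp [OscGen.sum_eq, fibRelCoeff, h₃, neg_smul']
  exists_lift B _ _ f hf := by
    refine exists_lift q Q₁ f ?_ ?_ ?_
    · simpa [OscGen.sum_eq, fibRelCoeff, add_neg_eq_zero] using hf 0
    · simpa [OscGen.sum_eq, fibRelCoeff, neg_add_eq_zero, eq_comm] using hf 1
    · rw [← sub_eq_zero, ← hf 2]
      simp [OscGen.sum_eq, fibRelCoeff]
      abel

end FibOsc

namespace AnsatzConstants

/-- The matrix of the quadratic part of the braiding of the ansatz. -/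
def braidMatrix {K : Type u} [Zero K] (C : AnsatzConstants K) :
    OscGen → OscGen → OscGen → OscGen → K
  | .qN, .qN, .qN, .qN => C.g₁
  | .qN, .qN, .a, .aStar => C.g₂
  | .qN, .qN, .aStar, .a => C.g₃
  | .qN, .a, .a, .qN => C.d₁
  | .qN, .a, .qN, .a => C.d₂
  | .aStar, .qN, .qN, .aStar => C.d₁
  | .aStar, .qN, .aStar, .qN => C.d₂
  | .qN, .aStar, .aStar, .qN => C.f₁
  | .qN, .aStar, .qN, .aStar => C.f₂
  | .a, .qN, .qN, .a => C.f₁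
  | .a, .qN, .a, .qN => C.f₂
  | .a, .a, .a, .a => C.z
  | .aStar, .aStar, .aStar, .aStar => C.z
  | .a, .aStar, .qN, .qN => C.b₁
  | .a, .aStar, .a, .aStar => C.b₂
  | .a, .aStar, .aStar, .a => C.b₃
  | .aStar, .a, .qN, .qN => C.c₁
  | .aStar, .a, .a, .aStar => C.c₂
  | .aStar, .a, .aStar, .a => C.c₃
  | _, _, _, _ => 0

/-- The constants for which the generators are primitive, the antipode is `-1` on generators and
the braiding is homogeneous. -/
structure IsPrimitive {K : Type u} [Ring K] (C : AnsatzConstants K) : Prop where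
  A : C.A₁ = 0 ∧ C.A₂ = 0 ∧ C.A₃ = 0 ∧ C.A₄ = 1 ∧ C.A₅ = 1 ∧ C.A₆ = 0
  B : C.B₁ = 0 ∧ C.B₂ = 0 ∧ C.B₃ = 1 ∧ C.B₄ = 1
  e : C.e₁ = 0 ∧ C.e₂ = 0
  k : C.k₁ = -1 ∧ C.k₂ = 0 ∧ C.k₃ = 0 ∧ C.k₄ = 0
  m : C.m₁ = 0 ∧ C.m₂ = -1 ∧ C.m₃ = 0 ∧ C.m₄ = 0
  g : C.g₄ = 0 ∧ C.g₅ = 0 ∧ C.g₆ = 0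
  d : C.d₃ = 0 ∧ C.d₄ = 0
  f : C.f₃ = 0 ∧ C.f₄ = 0
  b : C.b₄ = 0 ∧ C.b₅ = 0 ∧ C.b₆ = 0
  c : C.c₄ = 0 ∧ C.c₅ = 0 ∧ C.c₆ = 0

/-- The constants for which the braiding is `-1` on the relations of the oscillator algebra. -/
structure IsEigen {K : Type u} [CommRing K] (q Q₁ : K) (C : AnsatzConstants K) : Prop where
  f₁ : C.f₁ = q * (1 + C.d₂)
  f₂ : C.f₂ = q * C.d₁ - 1
  g₁ : C.g₁ = C.b₁ - Q₁ * C.c₁ - 1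
  g₂ : C.g₂ = 1 + C.b₂ - Q₁ * C.c₂
  g₃ : C.g₃ = C.b₃ - Q₁ - Q₁ * C.c₃

section braidMatrix

variable {K : Type u} [CommRing K] (C : AnsatzConstants K) (φ : OscGen → OscGen → K)

theorem sum_braidMatrix (i j : OscGen) : ∑ k, ∑ l, C.braidMatrix i j k l * φ k l =
    match i, j with
    | .qN, .qN => C.g₁ * φ .qN .qN + C.g₂ * φ .a .aStar + C.g₃ * φ .aStar .a
    | .qN, .a => C.d₁ * φ .a .qN + C.d₂ * φ .qN .a
    | .aStar, .qN => C.d₁ * φ .qN .aStar + C.d₂ * φ .aStar .qN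
    | .qN, .aStar => C.f₁ * φ .aStar .qN + C.f₂ * φ .qN .aStar
    | .a, .qN => C.f₁ * φ .qN .a + C.f₂ * φ .a .qN
    | .a, .a => C.z * φ .a .a
    | .aStar, .aStar => C.z * φ .aStar .aStar
    | .a, .aStar => C.b₁ * φ .qN .qN + C.b₂ * φ .a .aStar + C.b₃ * φ .aStar .a
    | .aStar, .a => C.c₁ * φ .qN .qN + C.c₂ * φ .a .aStar + C.c₃ * φ .aStar .a := by
  cases i <;> cases j <;> simp [OscGen.sum_eq, braidMatrix] <;> ring

theorem sum_mul_braidMatrix (k l : OscGen) : ∑ i, ∑ j, φ i j * C.braidMatrix i j k l =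
    match k, l with
    | .qN, .qN => φ .qN .qN * C.g₁ + φ .a .aStar * C.b₁ + φ .aStar .a * C.c₁
    | .a, .aStar => φ .qN .qN * C.g₂ + φ .a .aStar * C.b₂ + φ .aStar .a * C.c₂
    | .aStar, .a => φ .qN .qN * C.g₃ + φ .a .aStar * C.b₃ + φ .aStar .a * C.c₃
    | .qN, .a => φ .qN .a * C.d₂ + φ .a .qN * C.f₁
    | .a, .qN => φ .qN .a * C.d₁ + φ .a .qN * C.f₂
    | .qN, .aStar => φ .qN .aStar * C.f₂ + φ .aStar .qN * C.d₁
    | .aStar, .qN => φ .qN .aStar * C.f₁ + φ .aStar .qN * C.d₂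
    | .a, .a => φ .a .a * C.z
    | .aStar, .aStar => φ .aStar .aStar * C.z := by
  cases k <;> cases l <;> simp [OscGen.sum_eq, braidMatrix] <;> ring

end braidMatrix

end AnsatzConstants

/-! ### The Yang–Baxter equation for the six solutions -/

/-- The Yang–Baxter equation, tested on functions of three indices. -/
theorem yang_baxter_of_forall {K : Type u} {ι : Type} [CommRing K] [Fintype ι] [DecidableEq ι]
    {R : ι → ι → ι → ι → K}
    (hR : ∀ (F : ι → ι → ι → K) (i j k : ι),
      ∑ a, ∑ b, R i j a b * ∑ c, ∑ n, R b k c n * ∑ l, ∑ m, R a c l m * F l m n =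
      ∑ a, ∑ b, R j k a b * ∑ l, ∑ c, R i a l c * ∑ m, ∑ n, R c b m n * F l m n)
    (i j k l m n : ι) :
    ∑ a, ∑ b, ∑ c, R i j a b * R b k c n * R a c l m =
      ∑ a, ∑ b, ∑ c, R j k a b * R i a l c * R c b m n := by
  have := hR (fun l' m' n' => if l' = l then if m' = m then if n' = n then 1 else 0 else 0 else 0)
    i j k
  simpa [Finset.mul_sum, mul_assoc] using this

/-- The third solution is the second one for the opposite choice of the square root. -/
theorem fibTable_two {K : Type u} [Field K] (q Q₁ s : K) :
    fibTable q Q₁ s 2 = fibTable q Q₁ (-s) 1 := by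
  ext
  all_goals first | rfl | skip
  all_goals simp only [fibTable, Matrix.cons_val]
  all_goals ring

/-- The sixth solution is the fifth one for the opposite choice of the square root. -/
theorem fibTable_five {K : Type u} [Field K] (q Q₁ s : K) :
    fibTable q Q₁ s 5 = fibTable q Q₁ (-s) 4 := by
  ext
  all_goals first | rfl | skip
  all_goals simp only [fibTable, Matrix.cons_val]
  case g₃ => rw [show q * s - Q₁ = -(Q₁ + q * -s) by ring, mul_neg, div_neg]
  all_goals ring

section Table

variable {K : Type u} [Field K] {q Q₁ s : K}

theorem yang_baxter_fibTable_zero (hq : q ≠ 0) (hQ : Q₁ ≠ 0) (i j k l m n : OscGen) :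
    let R := (fibTable q Q₁ s 0).braidMatrix
    ∑ x, ∑ y, ∑ w, R i j x y * R y k w n * R x w l m =
      ∑ x, ∑ y, ∑ w, R j k x y * R i x l w * R w y m n := by
  refine yang_baxter_of_forall (fun F i j k => ?_) i j k l m n
  simp only [AnsatzConstants.sum_braidMatrix]
  cases i <;> cases j <;> cases k
  all_goals simp only [fibTable, Matrix.cons_val]
  all_goals field_simp
  all_goals ring

theorem yang_baxter_fibTable_one (hq : q ≠ 0) (hs : s ≠ 0) (i j k l m n : OscGen) :
    let R := (fibTable q (s ^ 2) s 1).braidMatrix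
    ∑ x, ∑ y, ∑ w, R i j x y * R y k w n * R x w l m =
      ∑ x, ∑ y, ∑ w, R j k x y * R i x l w * R w y m n := by
  refine yang_baxter_of_forall (fun F i j k => ?_) i j k l m n
  simp only [AnsatzConstants.sum_braidMatrix]
  cases i <;> cases j <;> cases k
  all_goals simp only [fibTable, Matrix.cons_val]
  all_goals field_simp
  all_goals ring

theorem yang_baxter_fibTable_three (hq : q ≠ 0) (hQ : Q₁ ≠ 0) (i j k l m n : OscGen) :
    let R := (fibTable q Q₁ s 3).braidMatrix
    ∑ x, ∑ y, ∑ w, R i j x y * R y k w n * R x w l m =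
      ∑ x, ∑ y, ∑ w, R j k x y * R i x l w * R w y m n := by
  refine yang_baxter_of_forall (fun F i j k => ?_) i j k l m n
  simp only [AnsatzConstants.sum_braidMatrix]
  cases i <;> cases j <;> cases k
  all_goals simp only [fibTable, Matrix.cons_val]
  all_goals field_simp
  all_goals ring

/-- The entry `g₃` of the fifth solution without the factor of its denominator that cancels. -/
theorem fibTable_four_g₃ (hs : s ≠ 0) (hqs : s + q ≠ 0) :
    (fibTable q (s ^ 2) s 4).g₃ = -(s * (s - q) ^ 2 * (s + q) / q ^ 2) := by
  simp only [fibTable, Matrix.cons_val]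
  rw [show s ^ 2 + q * s = s * (s + q) by ring]
  field_simp
  ring

theorem yang_baxter_fibTable_four (hq : q ≠ 0) (hs : s ≠ 0) (hqs : s + q ≠ 0)
    (i j k l m n : OscGen) :
    let R := (fibTable q (s ^ 2) s 4).braidMatrix
    ∑ x, ∑ y, ∑ w, R i j x y * R y k w n * R x w l m =
      ∑ x, ∑ y, ∑ w, R j k x y * R i x l w * R w y m n := by
  refine yang_baxter_of_forall (fun F i j k => ?_) i j k l m n
  simp only [AnsatzConstants.sum_braidMatrix]
  cases i <;> cases j <;> cases k
  all_goals try simp only [fibTable_four_g₃ hs hqs]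
  all_goals simp only [fibTable, Matrix.cons_val]
  all_goals field_simp
  all_goals ring

/-- The hypotheses make the `-1`-eigenspace of the braiding matrix three-dimensional, so that it is
spanned by the relations, and the Yang–Baxter equation suffices. -/
theorem AnsatzConstants.IsEigen.isCompatibleBraiding {C : AnsatzConstants K} (hC : C.IsEigen q Q₁)
    (hz : C.z + 1 ≠ 0) (hd : C.d₁ ≠ 0) (hdet : (C.g₁ + 1) * C.c₂ - C.c₁ * C.g₂ ≠ 0)
    (hYB : ∀ i j k l m n, ∑ x, ∑ y, ∑ w, C.braidMatrix i j x y * C.braidMatrix y k w n *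
        C.braidMatrix x w l m =
      ∑ x, ∑ y, ∑ w, C.braidMatrix j k x y * C.braidMatrix i x l w * C.braidMatrix w y m n) :
    IsCompatibleBraiding (fibRelCoeff q Q₁) C.braidMatrix := by
  obtain ⟨f₁, f₂, g₁, g₂, g₃⟩ := hC
  refine IsCompatibleBraiding.of_exact hYB (fun α k l => ?_) fun w hw => ?_
  · rw [sum_mul_braidMatrix]
    fin_cases α <;> cases k <;> cases l <;> simp [fibRelCoeff, *] <;> ring
  · simp only [sum_mul_braidMatrix] at hw
    -- The kernel of `R + 1` is computed weight by weight.
    refine ⟨![w .a .qN, w .qN .aStar, w .a .aStar], fun k l => ?_⟩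
    have haa : w .a .a = 0 := by
      have := hw .a .a
      refine (mul_eq_zero.1 (?_ : w .a .a * (C.z + 1) = 0)).resolve_right hz
      linear_combination this
    have hss : w .aStar .aStar = 0 := by
      have := hw .aStar .aStar
      refine (mul_eq_zero.1 (?_ : w .aStar .aStar * (C.z + 1) = 0)).resolve_right hz
      linear_combination this
    have hna : w .qN .a = -q * w .a .qN := by
      have := hw .a .qN
      refine mul_left_cancel₀ hd ?_
      simp only [f₂] at this
      linear_combination this
    have hsn : w .aStar .qN = -q * w .qN .aStar := by
      have := hw .qN .aStar
      refine mul_left_cancel₀ hd ?_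
      simp only [f₂] at this
      linear_combination this
    have e₁ : (w .qN .qN + w .a .aStar) * (C.g₁ + 1) +
        (w .aStar .a + Q₁ * w .a .aStar) * C.c₁ = 0 := by
      have := hw .qN .qN
      simp only [g₁] at this ⊢
      linear_combination this
    have e₂ : (w .qN .qN + w .a .aStar) * C.g₂ +
        (w .aStar .a + Q₁ * w .a .aStar) * C.c₂ = 0 := by
      have := hw .a .aStar
      simp only [g₂] at this ⊢
      linear_combination this
    have hnn : w .qN .qN = -w .a .aStar := by
      refine eq_neg_of_add_eq_zero_left ((mul_eq_zero.1 ?_).resolve_right hdet)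
      linear_combination C.c₂ * e₁ - C.c₁ * e₂
    have hsa : w .aStar .a = -Q₁ * w .a .aStar := by
      rw [neg_mul]
      refine eq_neg_of_add_eq_zero_left ((mul_eq_zero.1 ?_).resolve_right hdet)
      linear_combination (C.g₁ + 1) * e₂ - C.g₂ * e₁
    rw [Fin.sum_univ_three]
    cases k <;> cases l <;> simp [fibRelCoeff, *] <;> ring

theorem fibTable_isPrimitive (i : Fin 6) : (fibTable q Q₁ s i).IsPrimitive := by
  fin_cases i <;> exact ⟨⟨rfl, rfl, rfl, rfl, rfl, rfl⟩, ⟨rfl, rfl, rfl, rfl⟩, ⟨rfl, rfl⟩,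
    ⟨rfl, rfl, rfl, rfl⟩, ⟨rfl, rfl, rfl, rfl⟩, ⟨rfl, rfl, rfl⟩, ⟨rfl, rfl⟩, ⟨rfl, rfl⟩,
    ⟨rfl, rfl, rfl⟩, ⟨rfl, rfl, rfl⟩⟩

theorem fibTable_isEigen_zero (hq : q ≠ 0) (hQ : Q₁ ≠ 0) :
    (fibTable q Q₁ s 0).IsEigen q Q₁ := by
  constructor <;> simp only [fibTable, Matrix.cons_val] <;> field_simp <;> ring

theorem fibTable_isEigen_one (hq : q ≠ 0) (hs : s ≠ 0) :
    (fibTable q (s ^ 2) s 1).IsEigen q (s ^ 2) := by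
  constructor <;> simp only [fibTable, Matrix.cons_val] <;> field_simp <;> ring

theorem fibTable_isEigen_three (hq : q ≠ 0) (hQ : Q₁ ≠ 0) :
    (fibTable q Q₁ s 3).IsEigen q Q₁ := by
  constructor <;> simp only [fibTable, Matrix.cons_val] <;> field_simp <;> ring

theorem fibTable_isEigen_four (hq : q ≠ 0) (hs : s ≠ 0) (hsq : s + q ≠ 0) :
    (fibTable q (s ^ 2) s 4).IsEigen q (s ^ 2) := by
  constructor
  case g₃ =>
    rw [fibTable_four_g₃ hs hsq]; simp only [fibTable, Matrix.cons_val]; field_simp; ring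
  all_goals simp only [fibTable, Matrix.cons_val]
  all_goals field_simp
  all_goals ring

theorem fibTable_isEigen (hq : q ≠ 0) (hQ0 : Q₁ ≠ 0) (hQ : Q₁ ≠ q ^ 2) (hs : s ^ 2 = Q₁)
    (i : Fin 6) : (fibTable q Q₁ s i).IsEigen q Q₁ := by
  subst hs
  have hs0 : s ≠ 0 := by rintro rfl; simp at hQ0
  have h₁ : s + q ≠ 0 := fun h => hQ (by linear_combination (s - q) * h)
  have h₂ : -s + q ≠ 0 := fun h => hQ (by linear_combination -(s + q) * h)
  fin_cases i
  · exact fibTable_isEigen_zero hq hQ0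
  · exact fibTable_isEigen_one hq hs0
  · have := fibTable_isEigen_one hq (neg_ne_zero.2 hs0)
    rwa [neg_sq, ← fibTable_two] at this
  · exact fibTable_isEigen_three hq hQ0
  · exact fibTable_isEigen_four hq hs0 h₁
  · have := fibTable_isEigen_four hq (neg_ne_zero.2 hs0) h₂
    rwa [neg_sq, ← fibTable_five] at this

theorem isCompatibleBraiding_fibTable_zero (hq : q ≠ 0) (hs : s ≠ 0) (hQ : s ^ 2 + q ^ 2 ≠ 0) :
    IsCompatibleBraiding (fibRelCoeff q (s ^ 2)) (fibTable q (s ^ 2) s 0).braidMatrix := by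
  refine (fibTable_isEigen_zero hq (pow_ne_zero 2 hs)).isCompatibleBraiding ?_ ?_ ?_
    (yang_baxter_fibTable_zero hq (pow_ne_zero 2 hs))
  all_goals simp only [fibTable, Matrix.cons_val]
  · rw [show q ^ 2 / s ^ 2 + 1 = (s ^ 2 + q ^ 2) / s ^ 2 by field_simp; ring]
    exact div_ne_zero hQ (pow_ne_zero 2 hs)
  · exact div_ne_zero hq (pow_ne_zero 2 hs)
  · rw [show (q ^ 2 / s ^ 2 + 1) * (q ^ 2 / (s ^ 2) ^ 2) - -(q ^ 2 / (s ^ 2) ^ 2) * 0 =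
        (s ^ 2 + q ^ 2) * q ^ 2 / s ^ 6 by field_simp; try ring]
    exact div_ne_zero (mul_ne_zero hQ (pow_ne_zero 2 hq)) (pow_ne_zero 6 hs)

theorem isCompatibleBraiding_fibTable_one (hq : q ≠ 0) (hs : s ≠ 0) (hsq : s - q ≠ 0)
    (hQ : s ^ 2 + q ^ 2 ≠ 0) :
    IsCompatibleBraiding (fibRelCoeff q (s ^ 2)) (fibTable q (s ^ 2) s 1).braidMatrix := by
  refine (fibTable_isEigen_one hq hs).isCompatibleBraiding ?_ ?_ ?_
    (yang_baxter_fibTable_one hq hs)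
  all_goals simp only [fibTable, Matrix.cons_val]
  · rw [show q ^ 2 / s ^ 2 + 1 = (s ^ 2 + q ^ 2) / s ^ 2 by field_simp; ring]
    exact div_ne_zero hQ (pow_ne_zero 2 hs)
  · exact div_ne_zero hq (pow_ne_zero 2 hs)
  · rw [show (-(q / s) + 1) * (1 / s ^ 2) - 0 * ((q ^ 2 - s ^ 2) * (s + q) / (q * s ^ 2)) =
        (s - q) / s ^ 3 by field_simp; try ring]
    exact div_ne_zero hsq (pow_ne_zero 3 hs)

theorem isCompatibleBraiding_fibTable_three (hq : q ≠ 0) (hs : s ≠ 0) (hQ : s ^ 2 + q ^ 2 ≠ 0) :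
    IsCompatibleBraiding (fibRelCoeff q (s ^ 2)) (fibTable q (s ^ 2) s 3).braidMatrix := by
  refine (fibTable_isEigen_three hq (pow_ne_zero 2 hs)).isCompatibleBraiding ?_ ?_ ?_
    (yang_baxter_fibTable_three hq (pow_ne_zero 2 hs))
  all_goals simp only [fibTable, Matrix.cons_val]
  · rw [show s ^ 2 / q ^ 2 + 1 = (s ^ 2 + q ^ 2) / q ^ 2 by field_simp]
    exact div_ne_zero hQ (pow_ne_zero 2 hq)
  · exact inv_ne_zero hq
  · rw [show (s ^ 2 / q ^ 2 + 1) * (1 / s ^ 2) - -1 / s ^ 2 * 0 =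
        (s ^ 2 + q ^ 2) / (q ^ 2 * s ^ 2) by field_simp; try ring]
    exact div_ne_zero hQ (mul_ne_zero (pow_ne_zero 2 hq) (pow_ne_zero 2 hs))

theorem isCompatibleBraiding_fibTable_four (hq : q ≠ 0) (hs : s ≠ 0) (hsq : s + q ≠ 0)
    (hQ : s ^ 2 + q ^ 2 ≠ 0) :
    IsCompatibleBraiding (fibRelCoeff q (s ^ 2)) (fibTable q (s ^ 2) s 4).braidMatrix := by
  refine (fibTable_isEigen_four hq hs hsq).isCompatibleBraiding ?_ ?_ ?_
    (yang_baxter_fibTable_four hq hs hsq)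
  all_goals simp only [fibTable, Matrix.cons_val]
  · rw [show s ^ 2 / q ^ 2 + 1 = (s ^ 2 + q ^ 2) / q ^ 2 by field_simp]
    exact div_ne_zero hQ (pow_ne_zero 2 hq)
  · exact inv_ne_zero hq
  · rw [show (s / q + 1) * (1 / s ^ 2) - -((q + s) / (q * s ^ 2)) * 0 =
        (s + q) / (q * s ^ 2) by field_simp; try ring]
    exact div_ne_zero hsq (mul_ne_zero hq (pow_ne_zero 2 hs))

theorem isCompatibleBraiding_fibTable (hq : q ≠ 0) (hQ0 : Q₁ ≠ 0) (hQ : Q₁ ≠ q ^ 2)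
    (hQ' : Q₁ ≠ -q ^ 2) (hs : s ^ 2 = Q₁) (i : Fin 6) :
    IsCompatibleBraiding (fibRelCoeff q Q₁) (fibTable q Q₁ s i).braidMatrix := by
  subst hs
  have hs0 : s ≠ 0 := by rintro rfl; simp at hQ0
  have h₁ : s + q ≠ 0 := fun h => hQ (by linear_combination (s - q) * h)
  have h₂ : s - q ≠ 0 := fun h => hQ (by linear_combination (s + q) * h)
  have h₃ : s ^ 2 + q ^ 2 ≠ 0 := fun h => hQ' (by linear_combination h)
  have h₄ : (-s) ^ 2 = s ^ 2 := by ring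
  fin_cases i
  · exact isCompatibleBraiding_fibTable_zero hq hs0 h₃
  · exact isCompatibleBraiding_fibTable_one hq hs0 h₂ h₃
  · have := isCompatibleBraiding_fibTable_one (s := -s) hq (neg_ne_zero.2 hs0)
      (fun h => h₁ (by linear_combination -h)) (by rwa [h₄])
    rwa [h₄, ← fibTable_two] at this
  · exact isCompatibleBraiding_fibTable_three hq hs0 h₃
  · exact isCompatibleBraiding_fibTable_four hq hs0 h₁ h₃
  · have := isCompatibleBraiding_fibTable_four (s := -s) hq (neg_ne_zero.2 hs0)
      (fun h => h₂ (by linear_combination -h)) (by rwa [h₄])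
    rwa [h₄, ← fibTable_five] at this

end Table

/-! ### Structures of the ansatz form with primitive generators -/

namespace HasAnsatzForm

variable {K : Type u} [CommRing K] {q Q₁ : K} {C : AnsatzConstants K}

theorem braiding_gen_gen {H : BraidedHopfStructure K (FibOsc q Q₁)} (hH : HasAnsatzForm H C)
    (hC : C.IsPrimitive) (i j : OscGen) :
    H.braiding (FibOsc.gen q Q₁ i ⊗ₜ FibOsc.gen q Q₁ j) =
      ∑ k, ∑ l, C.braidMatrix i j k l • (FibOsc.gen q Q₁ k ⊗ₜ FibOsc.gen q Q₁ l) := by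
  obtain ⟨-, -, -, -, -, ⟨g₄, g₅, g₆⟩, ⟨d₃, d₄⟩, ⟨f₃, f₄⟩, ⟨b₄, b₅, b₆⟩, c₄, c₅, c₆⟩ := hC
  obtain ⟨-, -, -, -, -, -, -, -, -, h₁, h₂, h₃, h₄, h₅, h₆, h₇, h₈, h₉⟩ := hH
  simp only [FibOsc.a, FibOsc.aStar, FibOsc.qN, g₄, g₅, g₆, d₃, d₄, f₃, f₄, b₄, b₅, b₆, c₄, c₅,
    c₆] at h₁ h₂ h₃ h₄ h₅ h₆ h₇ h₈ h₉
  cases i <;> cases j <;>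
    simp only [h₁, h₂, h₃, h₄, h₅, h₆, h₇, h₈, h₉, OscGen.sum_eq, AnsatzConstants.braidMatrix] <;>
    module

theorem comul_gen {H : BraidedHopfStructure K (FibOsc q Q₁)} (hH : HasAnsatzForm H C)
    (hC : C.IsPrimitive) (i : OscGen) :
    H.comul (FibOsc.gen q Q₁ i) = FibOsc.gen q Q₁ i ⊗ₜ 1 + 1 ⊗ₜ FibOsc.gen q Q₁ i := by
  obtain ⟨⟨A₁, A₂, A₃, A₄, A₅, A₆⟩, ⟨B₁, B₂, B₃, B₄⟩, -⟩ := hC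
  obtain ⟨h₁, h₂, h₃, -⟩ := hH
  simp only [FibOsc.a, FibOsc.aStar, FibOsc.qN, A₁, A₂, A₃, A₄, A₅, A₆, B₁, B₂, B₃, B₄]
    at h₁ h₂ h₃
  cases i <;> simp only [h₁, h₂, h₃] <;> module

theorem antipode_gen {H : BraidedHopfStructure K (FibOsc q Q₁)} (hH : HasAnsatzForm H C)
    (hC : C.IsPrimitive) (i : OscGen) :
    H.antipode (FibOsc.gen q Q₁ i) = -FibOsc.gen q Q₁ i := by
  obtain ⟨-, -, -, ⟨k₁, k₂, k₃, k₄⟩, ⟨m₁, m₂, m₃, m₄⟩, -⟩ := hC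
  obtain ⟨-, -, -, -, -, -, h₁, h₂, h₃, -⟩ := hH
  simp only [FibOsc.a, FibOsc.aStar, FibOsc.qN, k₁, k₂, k₃, k₄, m₁, m₂, m₃, m₄] at h₁ h₂ h₃
  cases i <;> simp only [h₁, h₂, h₃] <;> module

theorem counit_gen {H : BraidedHopfStructure K (FibOsc q Q₁)} (hH : HasAnsatzForm H C)
    (hC : C.e₁ = 0 ∧ C.e₂ = 0) (i : OscGen) : H.counit (FibOsc.gen q Q₁ i) = 0 := by
  cases i
  · exact hH.counit_a.trans hC.2
  · exact hH.counit_aStar.trans hC.2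
  · exact hH.counit_qN.trans hC.1

end HasAnsatzForm

/-- The structure constructed from the braiding matrix of primitive constants is of the ansatz form
with these constants. -/
theorem IsBraidedQuadratic.hasAnsatzForm_braidedHopf {K : Type u} [CommRing K] {q Q₁ : K}
    {C : AnsatzConstants K} (hC : C.IsPrimitive)
    (h : IsBraidedQuadratic (FibOsc.gen q Q₁) (fibRelCoeff q Q₁) C.braidMatrix) :
    HasAnsatzForm h.braidedHopf C := by
  obtain ⟨⟨A₁, A₂, A₃, A₄, A₅, A₆⟩, ⟨B₁, B₂, B₃, B₄⟩, ⟨e₁, e₂⟩, ⟨k₁, k₂, k₃, k₄⟩,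
    ⟨m₁, m₂, m₃, m₄⟩, ⟨g₄, g₅, g₆⟩, ⟨d₃, d₄⟩, ⟨f₃, f₄⟩, ⟨b₄, b₅, b₆⟩, c₄, c₅, c₆⟩ := hC
  constructor
  · rw [A₁, A₂, A₃, A₄, A₅, A₆]; refine (h.comul_gen _).trans ?_; simp only [FibOsc.qN]; module
  · rw [B₁, B₂, B₃, B₄]; refine (h.comul_gen _).trans ?_; simp only [FibOsc.a]; module
  · rw [B₁, B₂, B₃, B₄]; refine (h.comul_gen _).trans ?_; simp only [FibOsc.aStar]; module
  · exact (h.counit_gen _).trans e₁.symm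
  · exact (h.counit_gen _).trans e₂.symm
  · exact (h.counit_gen _).trans e₂.symm
  · rw [k₁, k₂, k₃, k₄]; refine (h.antipode_gen _).trans ?_; simp only [FibOsc.qN]; module
  · rw [m₁, m₂, m₃, m₄]; refine (h.antipode_gen _).trans ?_; simp only [FibOsc.a]; module
  · rw [m₁, m₂, m₃, m₄]; refine (h.antipode_gen _).trans ?_; simp only [FibOsc.aStar]; module
  all_goals
    refine (h.braiding_gen_gen _ _).trans ?_
    simp only [g₄, g₅, g₆, d₃, d₄, f₃, f₄, b₄, b₅, b₆, c₄, c₅, c₆, FibOsc.a, FibOsc.aStar,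
      FibOsc.qN, OscGen.sum_eq, AnsatzConstants.braidMatrix]
    module

theorem HasAnsatzForm.eq_braidedHopf {K : Type u} [CommRing K] {q Q₁ : K}
    {C : AnsatzConstants K} {H : BraidedHopfStructure K (FibOsc q Q₁)} (hH : HasAnsatzForm H C)
    (hC : C.IsPrimitive)
    (h : IsBraidedQuadratic (FibOsc.gen q Q₁) (fibRelCoeff q Q₁) C.braidMatrix) :
    H = h.braidedHopf :=
  h.eq_braidedHopf H (hH.braiding_gen_gen hC) (hH.comul_gen hC) (hH.counit_gen hC.e)
    (hH.antipode_gen hC)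

theorem AnsatzConstants.IsPrimitive.existsUnique_hasAnsatzForm {K : Type u} [CommRing K] {q Q₁ : K}
    {C : AnsatzConstants K} (hC : C.IsPrimitive)
    (hR : IsCompatibleBraiding (fibRelCoeff q Q₁) C.braidMatrix) :
    ∃! H : BraidedHopfStructure K (FibOsc q Q₁), HasAnsatzForm H C :=
  have h : IsBraidedQuadratic (FibOsc.gen q Q₁) (fibRelCoeff q Q₁) C.braidMatrix :=
    { FibOsc.isQuadraticPresentation q Q₁, hR with }
  ⟨h.braidedHopf, h.hasAnsatzForm_braidedHopf hC, fun _ hH => hH.eq_braidedHopf hC h⟩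

/-! ### Linear functionals on the oscillator algebra -/

namespace FibOsc

variable {K : Type u} [CommRing K] (q Q₁ : K)

/-- A bilinear form on the span of the generators that vanishes on the defining relations. -/
structure IsRelForm (φ : OscGen → OscGen → K) : Prop where
  a_qN : φ .a .qN = q * φ .qN .a
  qN_aStar : φ .qN .aStar = q * φ .aStar .qN
  a_aStar : φ .a .aStar = Q₁ * φ .aStar .a + φ .qN .qN

/-- There are linear functionals with prescribed values in degrees `0`, `1` and `2`: they are matrix
coefficients of the action of the algebra on its quotient by the degrees above `2`. -/
theorem exists_functional (c : K) (μ : OscGen → K) {φ : OscGen → OscGen → K}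
    (hφ : IsRelForm q Q₁ φ) : ∃ ℓ : FibOsc q Q₁ →ₗ[K] K, ℓ 1 = c ∧ (∀ x, ℓ (gen q Q₁ x) = μ x) ∧
      ∀ x y, ℓ (gen q Q₁ x * gen q Q₁ y) = φ x y := by
  -- The row vectors are spanned by the classes of `1`, of the generators and of one vector of
  -- degree `2`, on which the coefficient is `φ`.
  let f : OscGen → Matrix (Option (Option OscGen)) (Option (Option OscGen)) K := fun x =>
    Matrix.of fun i j => match i, j with
      | none, some (some y) => if x = y then 1 else 0
      | some (some y), some none => φ y x
      | _, _ => 0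
  have hf (x y : OscGen) : f x * f y = φ x y • Matrix.single none (some none) 1 := by
    ext i j
    rcases i with _ | _ | i <;> rcases j with _ | _ | j <;>
      simp [Matrix.mul_apply, Fintype.sum_option, f]
  obtain ⟨ρ, hρ⟩ := exists_lift q Q₁ f (by rw [hf, hf, hφ.a_qN, smul_smul])
    (by rw [hf, hf, hφ.qN_aStar, smul_smul])
    (by rw [hf, hf, hf, hφ.a_aStar, smul_smul, add_smul])
  refine ⟨(c • Matrix.entryLinearMap K K none none + (∑ y, μ y • Matrix.entryLinearMap K K
    none (some (some y))) + Matrix.entryLinearMap K K none (some none)) ∘ₗ ρ.toLinearMap,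
    ?_, fun x => ?_, fun x y => ?_⟩
  · simp
  · simp [hρ, f]
  · simp [hρ, hf]

/-- The form with prescribed values on the ordered pairs of generators `q^N q^N`, `q^N a`,
`a^* q^N`, `a^* a` and `a a`. -/
def relForm (nn na sn sa aa : K) : OscGen → OscGen → K
  | .qN, .qN => nn
  | .qN, .a => na
  | .a, .qN => q * na
  | .aStar, .qN => sn
  | .qN, .aStar => q * sn
  | .aStar, .a => sa
  | .a, .aStar => Q₁ * sa + nn
  | .a, .a => aa
  | .aStar, .aStar => 0

theorem isRelForm_relForm (nn na sn sa aa : K) :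
    IsRelForm q Q₁ (relForm q Q₁ nn na sn sa aa) := ⟨rfl, rfl, rfl⟩

theorem isRelForm_zero : IsRelForm q Q₁ 0 := by constructor <;> simp

/-- The coefficient of a generator. -/
noncomputable def coord (i : OscGen) : FibOsc q Q₁ →ₗ[K] K :=
  (exists_functional q Q₁ 0 (Pi.single i 1) (isRelForm_zero q Q₁)).choose

theorem coord_one (i : OscGen) : coord q Q₁ i 1 = 0 :=
  (exists_functional q Q₁ 0 (Pi.single i 1) (isRelForm_zero q Q₁)).choose_spec.1

theorem coord_gen (i j : OscGen) : coord q Q₁ i (gen q Q₁ j) = if i = j then 1 else 0 := by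
  refine ((exists_functional q Q₁ 0 (Pi.single i 1) (isRelForm_zero q Q₁)).choose_spec.2.1
    j).trans ?_
  simp [Pi.single_apply, eq_comm]

theorem coord_gen_mul_gen (i j k : OscGen) : coord q Q₁ i (gen q Q₁ j * gen q Q₁ k) = 0 :=
  (exists_functional q Q₁ 0 (Pi.single i 1) (isRelForm_zero q Q₁)).choose_spec.2.2 j k

end FibOsc

/-! ### Necessary conditions on a homogeneous braiding -/

namespace BraidedHopfStructure

variable {K A : Type*} {ι : Type} [CommRing K] [Ring A] [Algebra K A] [Fintype ι] [DecidableEq ι]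
  {v : ι → A} {r : ι → ι → K} {R : ι → ι → ι → ι → K} (H : BraidedHopfStructure K A)
  {c : ι → A →ₗ[K] K}

theorem comul_mul_of_primitive {x y : A} (hx : H.comul x = x ⊗ₜ 1 + 1 ⊗ₜ x)
    (hy : H.comul y = y ⊗ₜ 1 + 1 ⊗ₜ y) : H.comul (x * y) =
      (x * y) ⊗ₜ 1 + x ⊗ₜ y + H.braiding (x ⊗ₜ y) + 1 ⊗ₜ (x * y) := by
  have key (t : A ⊗[K] A) : TensorProduct.map (LinearMap.mul' K A) (LinearMap.mul' K A)
      ((TensorProduct.assoc K A A (A ⊗[K] A)).symm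
        (1 ⊗ₜ TensorProduct.assoc K A A A (t ⊗ₜ 1))) = t := by
    induction t using TensorProduct.induction_on with
    | zero => simp
    | add s t hs ht => simp only [TensorProduct.tmul_add, TensorProduct.add_tmul, map_add, hs, ht]
    | tmul p q => simp
  rw [H.comul_mul_apply, hx, hy]
  simp only [TensorProduct.tmul_add, TensorProduct.add_tmul, map_add, onMiddleTwo_tmul, key,
    H.braiding_one_left, H.braiding_one_right]
  simp
  abel

/-- Quadratic relations between primitive generators have eigenvalue `-1` under the braiding. -/
theorem rel_eigen_of_primitive
    (hψ : ∀ i j, H.braiding (v i ⊗ₜ v j) = ∑ k, ∑ l, R i j k l • (v k ⊗ₜ v l))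
    (hΔ : ∀ i, H.comul (v i) = v i ⊗ₜ 1 + 1 ⊗ₜ v i)
    (hr : ∑ i, ∑ j, r i j • (v i * v j) = 0) (hc₁ : ∀ i, c i 1 = 0)
    (hc : ∀ i j, c i (v j) = if i = j then 1 else 0)
    (k l : ι) : ∑ i, ∑ j, r i j * R i j k l = -r k l := by
  have key (i j : ι) : LinearMap.mul' K K (TensorProduct.map (c k) (c l)
      (H.comul (v i * v j))) = (if l = j then if k = i then 1 else 0 else 0) + R i j k l := by
    rw [H.comul_mul_of_primitive (hΔ i) (hΔ j), hψ]
    simp [hc, hc₁]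
  have := congrArg (fun x => LinearMap.mul' K K (TensorProduct.map (c k) (c l) (H.comul x))) hr
  simp [key, mul_add, Finset.sum_add_distrib] at this
  exact (neg_eq_of_add_eq_zero_right this).symm

/-- The braiding of a generator with a quadratic relation vanishes. -/
theorem sum_rel_right {φ : ι → ι → K} {ℓ : A →ₗ[K] K}
    (hψ : ∀ i j, H.braiding (v i ⊗ₜ v j) = ∑ k, ∑ l, R i j k l • (v k ⊗ₜ v l))
    (hr : ∑ i, ∑ j, r i j • (v i * v j) = 0) (hℓ : ∀ i j, ℓ (v i * v j) = φ i j)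
    (hc : ∀ i j, c i (v j) = if i = j then 1 else 0) (i p : ι) :
    ∑ j, ∑ k, r j k * ∑ l, ∑ n, R i j l n * ∑ m, R n k m p * φ l m = 0 := by
  have key (j k : ι) : LinearMap.mul' K K (TensorProduct.map ℓ (c p)
      (H.braiding (v i ⊗ₜ (v j * v k)))) =
      ∑ l, ∑ n, R i j l n * ∑ m, R n k m p * φ l m := by
    rw [H.braiding_tmul_mul, hψ]
    simp only [TensorProduct.sum_tmul, map_sum, ← TensorProduct.smul_tmul', map_smul,
      TensorProduct.assoc_tmul, onLastTwo_tmul, hψ, TensorProduct.tmul_sum,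
      TensorProduct.tmul_smul, TensorProduct.assoc_symm_tmul, LinearMap.rTensor_tmul,
      LinearMap.mul'_apply, TensorProduct.map_tmul, hℓ, hc]
    simp
  have := congrArg (fun x => LinearMap.mul' K K (TensorProduct.map ℓ (c p)
    (H.braiding (v i ⊗ₜ x)))) hr
  simpa [TensorProduct.tmul_sum, key] using this

/-- The braiding of a quadratic relation with a generator vanishes. -/
theorem sum_rel_left {φ : ι → ι → K} {ℓ : A →ₗ[K] K}
    (hψ : ∀ i j, H.braiding (v i ⊗ₜ v j) = ∑ k, ∑ l, R i j k l • (v k ⊗ₜ v l))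
    (hr : ∑ i, ∑ j, r i j • (v i * v j) = 0) (hℓ : ∀ i j, ℓ (v i * v j) = φ i j)
    (hc : ∀ i j, c i (v j) = if i = j then 1 else 0) (k p : ι) :
    ∑ i, ∑ j, r i j * ∑ m, ∑ n, R j k m n * ∑ l, R i m p l * φ l n = 0 := by
  have key (i j : ι) : LinearMap.mul' K K (TensorProduct.map (c p) ℓ
      (H.braiding ((v i * v j) ⊗ₜ v k))) =
      ∑ m, ∑ n, R j k m n * ∑ l, R i m p l * φ l n := by
    rw [H.braiding_mul_tmul, hψ]
    simp only [TensorProduct.sum_tmul, map_sum, ← TensorProduct.smul_tmul', map_smul,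
      TensorProduct.assoc_tmul, onFirstTwo_tmul, hψ, TensorProduct.tmul_sum,
      TensorProduct.tmul_smul, LinearMap.lTensor_tmul,
      LinearMap.mul'_apply, TensorProduct.map_tmul, hℓ, hc]
    simp
  have := congrArg (fun x => LinearMap.mul' K K (TensorProduct.map (c p) ℓ
    (H.braiding (x ⊗ₜ v k)))) hr
  simpa [TensorProduct.sum_tmul, ← TensorProduct.smul_tmul', key] using this

/-- `(ε ⊗ ε) ∘ Δ = ε`. -/
theorem counit_mul'_comul (z : A) :
    LinearMap.mul' K K (TensorProduct.map H.counit H.counit (H.comul z)) = H.counit z := by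
  have key (t : A ⊗[K] A) : LinearMap.mul' K K (TensorProduct.map H.counit H.counit t) =
      H.counit (TensorProduct.lid K A (H.counit.rTensor A t)) := by
    induction t using TensorProduct.induction_on with
    | zero => simp
    | add s t hs ht => simp only [map_add, hs, ht]
    | tmul p q => simp
  rw [key]
  exact congrArg H.counit (LinearMap.congr_fun H.counit_comul z)

/-- The braiding maps a primitive element tensored with anything into the kernel of `id ⊗ ε`. -/
theorem lTensor_counit_braiding (hε : H.counit 1 = 1) {x : A} (hx : H.comul x = x ⊗ₜ 1 + 1 ⊗ₜ x)
    (y : A) : TensorProduct.rid K A (H.counit.lTensor A (H.braiding (x ⊗ₜ y))) = 0 := by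
  -- `(id ⊗ ε ⊗ ε) ∘ (id ⊗ Δ) ∘ ψ` is `(id ⊗ ε) ∘ ψ`, but its value at `x ⊗ y` is twice as large.
  let E : A ⊗[K] (A ⊗[K] A) →ₗ[K] A := (TensorProduct.rid K A).toLinearMap ∘ₗ
    (LinearMap.mul' K K ∘ₗ TensorProduct.map H.counit H.counit).lTensor A
  have h₁ (t : A ⊗[K] A) : E (H.comul.lTensor A t) =
      TensorProduct.rid K A (H.counit.lTensor A t) := by
    induction t using TensorProduct.induction_on with
    | zero => simp
    | add s t hs ht => simp only [map_add, hs, ht]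
    | tmul p q => simp [E, counit_mul'_comul]
  have h₂ (t : A ⊗[K] A) : E (TensorProduct.assoc K A A A (t ⊗ₜ 1)) =
      TensorProduct.rid K A (H.counit.lTensor A t) := by
    induction t using TensorProduct.induction_on with
    | zero => simp
    | add s t hs ht => simp only [TensorProduct.add_tmul, map_add, hs, ht]
    | tmul p q => simp [E, hε]
  have h₃ (t : A ⊗[K] A) : E (onFirstTwo K A H.braiding (1 ⊗ₜ t)) =
      TensorProduct.rid K A (H.counit.lTensor A t) := by
    induction t using TensorProduct.induction_on with
    | zero => simp
    | add s t hs ht => simp only [TensorProduct.tmul_add, map_add, hs, ht]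
    | tmul p q => simp [E, hε, onFirstTwo_tmul, H.braiding_one_left]
  have := congrArg E (LinearMap.congr_fun H.comul_right_braiding (x ⊗ₜ y))
  simp only [LinearMap.comp_apply, h₁, LinearMap.rTensor_tmul, hx, TensorProduct.add_tmul, map_add,
    LinearEquiv.coe_coe, TensorProduct.assoc_tmul, onLastTwo_tmul, H.braiding_one_left,
    onFirstTwo_tmul, h₂, h₃] at this
  exact left_eq_add.1 this

/-- The braiding maps anything tensored with a primitive element into the kernel of `ε ⊗ id`. -/
theorem rTensor_counit_braiding (hε : H.counit 1 = 1) (x : A) {y : A}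
    (hy : H.comul y = y ⊗ₜ 1 + 1 ⊗ₜ y) :
    TensorProduct.lid K A (H.counit.rTensor A (H.braiding (x ⊗ₜ y))) = 0 := by
  let E : A ⊗[K] (A ⊗[K] A) →ₗ[K] A := (TensorProduct.lid K A).toLinearMap ∘ₗ
    (LinearMap.mul' K K ∘ₗ TensorProduct.map H.counit H.counit).rTensor A ∘ₗ
      (TensorProduct.assoc K A A A).symm.toLinearMap
  have h₁ (t : A ⊗[K] A) : E (TensorProduct.assoc K A A A (H.comul.rTensor A t)) =
      TensorProduct.lid K A (H.counit.rTensor A t) := by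
    induction t using TensorProduct.induction_on with
    | zero => simp
    | add s t hs ht => simp only [map_add, hs, ht]
    | tmul p q => simp [E, counit_mul'_comul]
  have h₂ (t : A ⊗[K] A) : E (1 ⊗ₜ t) = TensorProduct.lid K A (H.counit.rTensor A t) := by
    induction t using TensorProduct.induction_on with
    | zero => simp
    | add s t hs ht => simp only [TensorProduct.tmul_add, map_add, hs, ht]
    | tmul p q => simp [E, hε]
  have h₃ (t : A ⊗[K] A) :
      E (onLastTwo K A H.braiding (TensorProduct.assoc K A A A (t ⊗ₜ 1))) =
        TensorProduct.lid K A (H.counit.rTensor A t) := by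
    induction t using TensorProduct.induction_on with
    | zero => simp
    | add s t hs ht => simp only [TensorProduct.add_tmul, map_add, hs, ht]
    | tmul p q => simp [E, hε, onLastTwo_tmul, H.braiding_one_right]
  have := congrArg E (LinearMap.congr_fun H.comul_left_braiding (x ⊗ₜ y))
  simp only [LinearMap.comp_apply, LinearEquiv.coe_coe, h₁, LinearMap.lTensor_tmul, hy,
    TensorProduct.tmul_add, map_add, onFirstTwo_tmul, h₃, H.braiding_one_right,
    TensorProduct.assoc_tmul, onLastTwo_tmul, h₂] at this
  exact left_eq_add.1 this

end BraidedHopfStructure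

/-! ### The linear constants of the ansatz -/

namespace HasAnsatzForm

open FibOsc

variable {K : Type u} [Field K] {q Q₁ : K} {C : AnsatzConstants K}
  {H : BraidedHopfStructure K (FibOsc q Q₁)}

theorem counit_one (H : BraidedHopfStructure K (FibOsc q Q₁)) : H.counit 1 = 1 := by
  obtain ⟨ℓ, h, -⟩ := exists_functional q Q₁ 1 0 (isRelForm_zero q Q₁)
  simpa [H.comul_one, h] using congrArg ℓ (LinearMap.congr_fun H.counit_comul 1)

theorem antipode_one (H : BraidedHopfStructure K (FibOsc q Q₁)) : H.antipode 1 = 1 := by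
  simpa [H.comul_one, counit_one] using LinearMap.congr_fun H.mul_antipode_right 1

/-- The constants `e₁`, `e₂` vanish by the counit axioms for `a` and by the relation
`a a* = Q₁ a* a + (q^N)²`. -/
theorem e_eq_zero (hH : HasAnsatzForm H C) : C.e₁ = 0 ∧ C.e₂ = 0 := by
  obtain ⟨ℓ, hℓ, hℓ', -⟩ := exists_functional q Q₁ 1 0 (isRelForm_zero q Q₁)
  have h₁ := congrArg (coord q Q₁ .a) (LinearMap.congr_fun H.comul_counit (a q Q₁))
  have h₂ := LinearMap.congr_fun H.counit_comul (a q Q₁)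
  have h₃ := congrArg (coord q Q₁ .qN) h₂
  have h₄ := congrArg ℓ h₂
  have h₅ := congrArg H.counit (a_mul_aStar q Q₁)
  simp only [LinearMap.comp_apply, LinearEquiv.coe_coe, hH.comul_a, map_add, map_smul,
    LinearMap.lTensor_tmul, LinearMap.rTensor_tmul, TensorProduct.rid_tmul,
    TensorProduct.lid_tmul, hH.counit_a, hH.counit_qN, counit_one, LinearMap.id_apply] at h₁ h₃ h₄
  simp only [map_add, map_smul, H.counit_mul_apply, hH.counit_a, hH.counit_aStar, hH.counit_qN,
    smul_eq_mul] at h₅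
  simp only [a, qN, coord_gen, coord_one, hℓ, hℓ'] at h₁ h₃ h₄
  simp only [smul_eq_mul, Pi.zero_apply, reduceCtorEq, if_true, if_false, mul_one, mul_zero, add_zero,
    zero_add] at h₁ h₃ h₄
  have he₂ : C.e₂ = 0 := by linear_combination -C.e₂ * h₁ + C.e₁ * h₃ + h₄
  refine ⟨?_, he₂⟩
  rw [he₂] at h₅
  simpa using h₅

/-- The linear terms of the comultiplication, from the counit axioms. -/
theorem linear_comul (hH : HasAnsatzForm H C) :
    C.A₄ = 1 ∧ C.A₅ = 1 ∧ C.A₆ = 0 ∧ C.B₃ = 1 ∧ C.B₄ = 1 := by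
  obtain ⟨he₁, he₂⟩ := hH.e_eq_zero
  obtain ⟨ℓ, hℓ, hℓ', -⟩ := exists_functional q Q₁ 1 0 (isRelForm_zero q Q₁)
  have h₁ := LinearMap.congr_fun H.comul_counit (a q Q₁)
  have h₂ := LinearMap.congr_fun H.counit_comul (a q Q₁)
  have h₃ := LinearMap.congr_fun H.comul_counit (qN q Q₁)
  have h₄ := LinearMap.congr_fun H.counit_comul (qN q Q₁)
  simp only [LinearMap.comp_apply, LinearEquiv.coe_coe, hH.comul_a, hH.comul_qN, map_add, map_smul,
    LinearMap.lTensor_tmul, LinearMap.rTensor_tmul, TensorProduct.rid_tmul, TensorProduct.lid_tmul,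
    hH.counit_a, hH.counit_aStar, hH.counit_qN, counit_one, he₁, he₂, LinearMap.id_apply]
    at h₁ h₂ h₃ h₄
  replace h₁ := congrArg (coord q Q₁ .a) h₁
  replace h₂ := congrArg (coord q Q₁ .a) h₂
  have h₅ := congrArg ℓ h₄
  replace h₃ := congrArg (coord q Q₁ .qN) h₃
  replace h₄ := congrArg (coord q Q₁ .qN) h₄
  simp only [map_add, map_smul, a, qN, aStar, coord_gen, coord_one, hℓ, hℓ'] at h₁ h₂ h₃ h₄ h₅
  simp at h₁ h₂ h₃ h₄ h₅
  exact ⟨h₄, h₃, h₅, h₂, h₁⟩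

/-- The antipode is `-1` on generators, from the terms of degree at most one of the antipode axioms
for `a` and `q^N`. -/
theorem linear_antipode (hH : HasAnsatzForm H C) :
    (C.k₁ = -1 ∧ C.k₂ = 0 ∧ C.k₃ = 0 ∧ C.k₄ = 0) ∧
      (C.m₁ = 0 ∧ C.m₂ = -1 ∧ C.m₃ = 0 ∧ C.m₄ = 0) := by
  obtain ⟨he₁, he₂⟩ := hH.e_eq_zero
  obtain ⟨hA₄, hA₅, hA₆, hB₃, hB₄⟩ := hH.linear_comul
  have h1 := antipode_one H
  obtain ⟨ℓ, hℓ, hℓ', hℓ''⟩ := exists_functional q Q₁ 1 0 (isRelForm_zero q Q₁)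
  have h₁ := LinearMap.congr_fun H.mul_antipode_left (a q Q₁)
  have h₂ := LinearMap.congr_fun H.mul_antipode_left (qN q Q₁)
  simp only [LinearMap.comp_apply, hH.comul_a, hH.comul_qN, map_add, map_smul,
    LinearMap.rTensor_tmul, LinearMap.mul'_apply, hH.antipode_a, hH.antipode_aStar,
    hH.antipode_qN, hH.counit_a, hH.counit_qN, h1, he₁, he₂, hA₄, hA₅, hA₆, hB₃, hB₄, map_zero,
    add_mul, smul_mul_assoc, mul_one, one_mul] at h₁ h₂
  have e (ℓ : FibOsc q Q₁ →ₗ[K] K) := And.intro (congrArg ℓ h₁) (congrArg ℓ h₂)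
  have e₁ := e (coord q Q₁ .a)
  have e₂ := e (coord q Q₁ .aStar)
  have e₃ := e (coord q Q₁ .qN)
  have e₀ := e ℓ
  simp only [map_add, map_smul, a, qN, aStar, coord_gen, coord_one, hℓ, hℓ', hℓ'',
    coord_gen_mul_gen, map_zero] at e₀ e₁ e₂ e₃
  simp at e₀ e₁ e₂ e₃
  obtain ⟨m₄, k₄⟩ := e₀
  simp only [m₄, k₄, mul_zero, zero_add] at e₁ e₂ e₃
  exact ⟨⟨eq_neg_of_add_eq_zero_right e₃.2, e₁.2, e₂.2, k₄⟩,
    e₃.1, eq_neg_of_add_eq_zero_right e₁.1, e₂.1, m₄⟩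

/-- The terms of degree two of the antipode axioms for `a` and `q^N`. -/
theorem quadratic_comul (hH : HasAnsatzForm H C) :
    C.A₁ = -C.A₂ ∧ C.A₃ = -(Q₁ * C.A₂) ∧ C.B₁ = -(q * C.B₂) := by
  obtain ⟨he₁, he₂⟩ := hH.e_eq_zero
  obtain ⟨hA₄, hA₅, hA₆, hB₃, hB₄⟩ := hH.linear_comul
  obtain ⟨⟨k₁, k₂, k₃, k₄⟩, m₁, m₂, m₃, m₄⟩ := hH.linear_antipode
  have h1 := antipode_one H
  have h₁ := LinearMap.congr_fun H.mul_antipode_left (a q Q₁)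
  have h₂ := LinearMap.congr_fun H.mul_antipode_left (qN q Q₁)
  simp only [LinearMap.comp_apply, hH.comul_a, hH.comul_qN, map_add, map_smul,
    LinearMap.rTensor_tmul, LinearMap.mul'_apply, hH.antipode_a, hH.antipode_aStar,
    hH.antipode_qN, hH.counit_a, hH.counit_qN, h1, he₁, he₂, hA₄, hA₅, hA₆, hB₃, hB₄, map_zero,
    add_mul, smul_mul_assoc, mul_one, one_mul, k₁, k₂, k₃, k₄, m₁, m₂, m₃, m₄] at h₁ h₂
  obtain ⟨ℓ₁, -, hℓ₁, hℓ₁'⟩ := exists_functional q Q₁ 0 0 (isRelForm_relForm q Q₁ 0 1 0 0 0)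
  obtain ⟨ℓ₂, hℓ₂₀, hℓ₂, hℓ₂'⟩ := exists_functional q Q₁ 0 0 (isRelForm_relForm q Q₁ 1 0 0 0 0)
  obtain ⟨ℓ₃, hℓ₃₀, hℓ₃, hℓ₃'⟩ := exists_functional q Q₁ 0 0 (isRelForm_relForm q Q₁ 0 0 0 1 0)
  have e₁ := congrArg ℓ₁ h₁
  have e₂ := congrArg ℓ₂ h₂
  have e₃ := congrArg ℓ₃ h₂
  simp only [map_add, map_smul, a, qN, aStar, hℓ₁, hℓ₁', hℓ₂, hℓ₂', hℓ₃, hℓ₃', hℓ₂₀, hℓ₃₀,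
    map_zero, relForm] at e₁ e₂ e₃
  simp at e₁ e₂ e₃
  exact ⟨by linear_combination -e₂, by linear_combination -e₃, by linear_combination -e₁⟩

/-- Coassociativity forces the quadratic terms of the comultiplication of the generators to vanish. -/
theorem quadratic_comul_eq_zero (hH : HasAnsatzForm H C) (hq : q ≠ 0) :
    C.A₁ = 0 ∧ C.A₂ = 0 ∧ C.A₃ = 0 ∧ C.B₁ = 0 ∧ C.B₂ = 0 := by
  obtain ⟨hA₄, hA₅, hA₆, hB₃, hB₄⟩ := hH.linear_comul
  obtain ⟨hA₁, hA₃, hB₁⟩ := hH.quadratic_comul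
  have h₁ := LinearMap.congr_fun H.coassoc (a q Q₁)
  have h₂ := LinearMap.congr_fun H.coassoc (qN q Q₁)
  simp only [LinearMap.comp_apply, hH.comul_a, hH.comul_qN, hH.comul_aStar, map_add, map_smul,
    LinearMap.rTensor_tmul, LinearMap.lTensor_tmul, H.comul_one, TensorProduct.tmul_add,
    TensorProduct.add_tmul, TensorProduct.tmul_smul, TensorProduct.smul_tmul, hA₄, hA₅, hA₆, hB₃,
    hB₄, LinearEquiv.coe_coe, TensorProduct.assoc_tmul] at h₁ h₂
  let c (i j k : OscGen) : FibOsc q Q₁ ⊗[K] (FibOsc q Q₁ ⊗[K] FibOsc q Q₁) →ₗ[K] K :=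
    LinearMap.mul' K K ∘ₗ TensorProduct.map (coord q Q₁ i)
      (LinearMap.mul' K K ∘ₗ TensorProduct.map (coord q Q₁ j) (coord q Q₁ k))
  -- The coefficients of `a ⊗ a ⊗ a*` and `q^N ⊗ q^N ⊗ a` in the axiom for `a`, and that of
  -- `q^N ⊗ a ⊗ a*` in the axiom for `q^N`.
  have e₁ := congrArg (c .a .a .aStar) h₁
  have e₂ := congrArg (c .qN .qN .a) h₁
  have e₃ := congrArg (c .qN .a .aStar) h₂
  simp only [map_add, map_smul, c, LinearMap.comp_apply, TensorProduct.map_tmul, a, aStar, qN,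
    LinearMap.mul'_apply, coord_gen, coord_one] at e₁ e₂ e₃
  simp at e₁ e₂ e₃
  have hA₂ : C.A₂ = 0 := by
    rcases e₁ with h | h
    · simpa [hB₁, hA₁, h] using e₃
    · exact h
  have hB₁' : C.B₁ = 0 := by rcases e₂ with h | h <;> simp [h, hA₁, hA₂]
  exact ⟨by simp [hA₁, hA₂], hA₂, by simp [hA₃, hA₂], hB₁', by simpa [hB₁, hq] using hB₁'⟩

/-! ### The braiding is homogeneous -/

/-- The generators are primitive and the braiding is homogeneous: the terms with a tensor factor
`1` in the braiding of generators are excluded by `lTensor_counit_braiding` and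
`rTensor_counit_braiding`. -/
theorem isPrimitive (hH : HasAnsatzForm H C) (hq : q ≠ 0) : C.IsPrimitive := by
  obtain ⟨A₁, A₂, A₃, B₁, B₂⟩ := hH.quadratic_comul_eq_zero hq
  obtain ⟨A₄, A₅, A₆, B₃, B₄⟩ := hH.linear_comul
  have e := hH.e_eq_zero
  have hn : H.comul (qN q Q₁) = qN q Q₁ ⊗ₜ 1 + 1 ⊗ₜ qN q Q₁ := by
    rw [hH.comul_qN, A₁, A₂, A₃, A₄, A₅, A₆]; module
  have ha : H.comul (a q Q₁) = a q Q₁ ⊗ₜ 1 + 1 ⊗ₜ a q Q₁ := by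
    rw [hH.comul_a, B₁, B₂, B₃, B₄]; module
  have hs : H.comul (aStar q Q₁) = aStar q Q₁ ⊗ₜ 1 + 1 ⊗ₜ aStar q Q₁ := by
    rw [hH.comul_aStar, B₁, B₂, B₃, B₄]; module
  obtain ⟨ℓ, hℓ, hℓ', -⟩ := exists_functional q Q₁ 1 1 (isRelForm_zero q Q₁)
  have hc := counit_one H
  have l₁ := H.lTensor_counit_braiding hc hn (qN q Q₁)
  have l₂ := H.lTensor_counit_braiding hc hn (a q Q₁)
  have l₃ := H.lTensor_counit_braiding hc hn (aStar q Q₁)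
  have l₄ := H.lTensor_counit_braiding hc ha (aStar q Q₁)
  have l₅ := H.lTensor_counit_braiding hc hs (a q Q₁)
  have r₁ := H.rTensor_counit_braiding hc (qN q Q₁) hn
  have r₂ := H.rTensor_counit_braiding hc (qN q Q₁) ha
  have r₃ := H.rTensor_counit_braiding hc (qN q Q₁) hs
  have r₄ := H.rTensor_counit_braiding hc (a q Q₁) hs
  have r₅ := H.rTensor_counit_braiding hc (aStar q Q₁) ha
  simp only [hH.braiding_qN_qN, hH.braiding_qN_a, hH.braiding_qN_aStar, hH.braiding_a_aStar,
    hH.braiding_aStar_a, map_add, map_smul, LinearMap.lTensor_tmul, LinearMap.rTensor_tmul,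
    TensorProduct.rid_tmul, TensorProduct.lid_tmul, hH.counit_a, hH.counit_aStar, hH.counit_qN,
    hc, e.1, e.2] at l₁ l₂ l₃ l₄ l₅ r₁ r₂ r₃ r₄ r₅
  have f₁ := And.intro (congrArg (coord q Q₁ .qN) l₁) (congrArg ℓ l₁)
  have f₂ := congrArg ℓ l₂
  have f₃ := congrArg ℓ l₃
  have f₄ := And.intro (congrArg (coord q Q₁ .qN) l₄) (congrArg ℓ l₄)
  have f₅ := And.intro (congrArg (coord q Q₁ .qN) l₅) (congrArg ℓ l₅)
  have g₁ := congrArg (coord q Q₁ .qN) r₁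
  have g₂ := congrArg ℓ r₂
  have g₃ := congrArg ℓ r₃
  have g₄ := congrArg (coord q Q₁ .qN) r₄
  have g₅ := congrArg (coord q Q₁ .qN) r₅
  simp only [map_add, map_smul, a, qN, aStar, coord_gen, coord_one, hℓ, hℓ', map_zero]
    at f₁ f₂ f₃ f₄ f₅ g₁ g₂ g₃ g₄ g₅
  simp at f₁ f₂ f₃ f₄ f₅ g₁ g₂ g₃ g₄ g₅
  replace f₁ := And.intro f₁.1 (by simpa [f₁.1] using f₁.2)
  replace f₄ := And.intro f₄.1 (by simpa [f₄.1] using f₄.2)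
  replace f₅ := And.intro f₅.1 (by simpa [f₅.1] using f₅.2)
  exact ⟨⟨A₁, A₂, A₃, A₄, A₅, A₆⟩, ⟨B₁, B₂, B₃, B₄⟩, e, hH.linear_antipode.1,
    hH.linear_antipode.2, ⟨g₁, f₁⟩, ⟨g₂, f₂⟩, ⟨g₃, f₃⟩, ⟨g₄, f₄⟩, ⟨g₅, f₅⟩⟩

theorem isEigen (hH : HasAnsatzForm H C) (hC : C.IsPrimitive) : C.IsEigen q Q₁ := by
  have h (α : Fin 3) := H.rel_eigen_of_primitive (hH.braiding_gen_gen hC) (hH.comul_gen hC)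
    ((isQuadraticPresentation q Q₁).rel α) (coord_one q Q₁) (coord_gen q Q₁)
  simp only [AnsatzConstants.sum_mul_braidMatrix] at h
  have h₁ := h 0 .qN .a
  have h₂ := h 0 .a .qN
  have h₃ := h 2 .qN .qN
  have h₄ := h 2 .a .aStar
  have h₅ := h 2 .aStar .a
  simp only [fibRelCoeff] at h₁ h₂ h₃ h₄ h₅
  exact ⟨by linear_combination h₁, by linear_combination h₂, by linear_combination -h₃,
    by linear_combination -h₄, by linear_combination -h₅⟩

end HasAnsatzForm

/-! ### The equations for the constants of the braiding -/

/-- Equations for the constants expressing that the braiding is well defined on the oscillator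
algebra. In the names of the fields, `n`, `a`, `s` stand for `q^N`, `a`, `a*` and `an`, `as` for the
relations that begin with these monomials; `left` and `right` is the side of the tensor product on
which the relation is, then come the two factors and, where needed, the ordered monomial whose
coefficient is taken on the side of the relation. -/
structure AnsatzConstants.IsBraidSolution {K : Type u} [CommRing K] (q Q₁ : K)
    (C : AnsatzConstants K) : Prop extends C.IsEigen q Q₁ where
  left_an_a_na : C.d₁ * C.z * q + C.d₂ * C.f₂ = q * C.z * C.d₁
  left_an_a_aa : C.d₂ * C.f₁ = q * C.z * C.d₂
  left_an_n : C.g₁ * C.f₂ + C.g₂ * C.z = q * C.f₂ * C.d₁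
  left_an_s : C.f₂ * C.f₁ * Q₁ = q * (C.b₂ * C.d₂ * Q₁ + C.b₃ * C.f₂)
  left_as_a_nn : C.c₁ * C.f₂ + C.c₂ * C.z = C.d₁ ^ 2
  left_as_a_sa : C.c₂ * C.z * Q₁ + C.c₃ * C.b₂ = Q₁ * C.z * C.c₂ + C.d₂ * C.g₂
  left_as_a_aa : C.c₃ * C.b₃ = Q₁ * C.z * C.c₃ + C.d₂ * C.g₃
  right_a_an : C.z * C.f₂ = q * C.f₂ * C.d₁
  right_n_an_na : C.d₁ * C.g₁ * q + C.d₂ * C.f₂ = q * (C.g₁ * C.d₁ + C.g₂ * C.c₁ * q)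
  right_n_an_nn : C.d₁ * C.g₃ + C.d₂ * C.f₁ = q * (C.g₁ * C.d₂ + C.g₂ * C.c₃)
  right_s_an_nn : C.c₁ * C.g₁ + C.c₂ * C.d₂ = q * C.d₁ * C.c₁
  right_s_an_sa : C.c₂ * C.d₂ * Q₁ + C.c₃ * C.f₂ = q * C.d₂ * C.d₁
  right_s_an_sn : C.c₁ * C.g₃ * q + C.c₃ * C.f₁ = q * (C.d₁ * C.c₃ * q + C.d₂ ^ 2)
  right_n_as : C.d₁ * C.f₁ + C.d₂ * C.b₁ = Q₁ * C.f₂ * C.c₁ + C.g₂ * C.d₂ + C.g₁ ^ 2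
  right_a_as_aa : C.z * C.b₂ = Q₁ * C.b₂ * C.c₂ + C.f₂ * C.g₂
  right_a_as_nn : C.z * C.b₃ = Q₁ * (C.b₁ * C.d₂ + C.b₂ * C.c₃) + C.f₂ * C.g₃ + C.f₁ ^ 2

/-- Sums against the coefficients of the relations. -/
theorem sum_fibRelCoeff {K : Type u} [CommRing K] (q Q₁ : K) (F : OscGen → OscGen → K)
    (α : Fin 3) : ∑ i, ∑ j, fibRelCoeff q Q₁ α i j * F i j = match α with
      | 0 => F .a .qN - q * F .qN .a
      | 1 => F .qN .aStar - q * F .aStar .qN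
      | 2 => F .a .aStar - Q₁ * F .aStar .a - F .qN .qN := by
  fin_cases α <;> simp [OscGen.sum_eq, fibRelCoeff] <;> ring

namespace HasAnsatzForm

open FibOsc

variable {K : Type u} [Field K] {q Q₁ : K} {C : AnsatzConstants K}
  {H : BraidedHopfStructure K (FibOsc q Q₁)}

theorem isBraidSolution (hH : HasAnsatzForm H C) (hC : C.IsPrimitive) :
    C.IsBraidSolution q Q₁ := by
  have hψ := hH.braiding_gen_gen hC
  have r (α i p) (nn na sn sa aa : K) :=
    H.sum_rel_right hψ ((isQuadraticPresentation q Q₁).rel α) (exists_functional q Q₁ 0 0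
      (isRelForm_relForm q Q₁ nn na sn sa aa)).choose_spec.2.2 (coord_gen q Q₁) i p
  have l (α k p) (nn na sn sa aa : K) :=
    H.sum_rel_left hψ ((isQuadraticPresentation q Q₁).rel α) (exists_functional q Q₁ 0 0
      (isRelForm_relForm q Q₁ nn na sn sa aa)).choose_spec.2.2 (coord_gen q Q₁) k p
  simp only [sum_fibRelCoeff, AnsatzConstants.sum_braidMatrix] at r l
  refine { hH.isEigen hC with
    left_an_a_na := ?_, left_an_a_aa := ?_, left_an_n := ?_, left_an_s := ?_, left_as_a_nn := ?_,
    left_as_a_sa := ?_, left_as_a_aa := ?_, right_a_an := ?_, right_n_an_na := ?_,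
    right_n_an_nn := ?_, right_s_an_nn := ?_, right_s_an_sa := ?_, right_s_an_sn := ?_,
    right_n_as := ?_, right_a_as_aa := ?_, right_a_as_nn := ?_ }
  · have := l 0 .a .a 0 1 0 0 0
    simp [OscGen.sum_eq, AnsatzConstants.braidMatrix, relForm] at this
    linear_combination this
  · have := l 0 .a .qN 0 0 0 0 1
    simp [OscGen.sum_eq, AnsatzConstants.braidMatrix, relForm] at this
    linear_combination this
  · have := l 0 .qN .a 1 0 0 0 0
    simp [OscGen.sum_eq, AnsatzConstants.braidMatrix, relForm] at this
    linear_combination this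
  · have := l 0 .aStar .qN 0 0 0 1 0
    simp [OscGen.sum_eq, AnsatzConstants.braidMatrix, relForm] at this
    linear_combination this
  · have := l 2 .a .a 1 0 0 0 0
    simp [OscGen.sum_eq, AnsatzConstants.braidMatrix, relForm] at this
    linear_combination this
  · have := l 2 .a .a 0 0 0 1 0
    simp [OscGen.sum_eq, AnsatzConstants.braidMatrix, relForm] at this
    linear_combination this
  · have := l 2 .a .aStar 0 0 0 0 1
    simp [OscGen.sum_eq, AnsatzConstants.braidMatrix, relForm] at this
    linear_combination this
  · have := r 0 .a .qN 0 0 0 0 1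
    simp [OscGen.sum_eq, AnsatzConstants.braidMatrix, relForm] at this
    linear_combination this
  · have := r 0 .qN .qN 0 1 0 0 0
    simp [OscGen.sum_eq, AnsatzConstants.braidMatrix, relForm] at this
    linear_combination this
  · have := r 0 .qN .a 1 0 0 0 0
    simp [OscGen.sum_eq, AnsatzConstants.braidMatrix, relForm] at this
    linear_combination this
  · have := r 0 .aStar .qN 1 0 0 0 0
    simp [OscGen.sum_eq, AnsatzConstants.braidMatrix, relForm] at this
    linear_combination this
  · have := r 0 .aStar .qN 0 0 0 1 0
    simp [OscGen.sum_eq, AnsatzConstants.braidMatrix, relForm] at this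
    linear_combination this
  · have := r 0 .aStar .a 0 0 1 0 0
    simp [OscGen.sum_eq, AnsatzConstants.braidMatrix, relForm] at this
    linear_combination this
  · have := r 2 .qN .qN 1 0 0 0 0
    simp [OscGen.sum_eq, AnsatzConstants.braidMatrix, relForm] at this
    linear_combination this
  · have := r 2 .a .aStar 0 0 0 0 1
    simp [OscGen.sum_eq, AnsatzConstants.braidMatrix, relForm] at this
    linear_combination this
  · have := r 2 .a .a 1 0 0 0 0
    simp [OscGen.sum_eq, AnsatzConstants.braidMatrix, relForm] at this
    linear_combination this

end HasAnsatzForm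

/-! ### Solving the equations -/

namespace AnsatzConstants

/-- The constants are determined by nine of them. -/
theorem IsPrimitive.eq_of_isEigen {K : Type u} [CommRing K] {q Q₁ : K} {C C' : AnsatzConstants K}
    (hC : C.IsPrimitive) (hC' : C'.IsPrimitive) (hE : C.IsEigen q Q₁) (hE' : C'.IsEigen q Q₁)
    (z : C.z = C'.z) (d₁ : C.d₁ = C'.d₁) (d₂ : C.d₂ = C'.d₂) (g₁ : C.g₁ = C'.g₁)
    (g₂ : C.g₂ = C'.g₂) (g₃ : C.g₃ = C'.g₃) (c₁ : C.c₁ = C'.c₁) (c₂ : C.c₂ = C'.c₂)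
    (c₃ : C.c₃ = C'.c₃) : C = C' := by
  have f₁ : C.f₁ = C'.f₁ := by rw [hE.f₁, hE'.f₁, d₂]
  have f₂ : C.f₂ = C'.f₂ := by rw [hE.f₂, hE'.f₂, d₁]
  have b₁ : C.b₁ = C'.b₁ := by linear_combination hE'.g₁ - hE.g₁ + g₁ + Q₁ * c₁
  have b₂ : C.b₂ = C'.b₂ := by linear_combination hE'.g₂ - hE.g₂ + g₂ + Q₁ * c₂
  have b₃ : C.b₃ = C'.b₃ := by linear_combination hE'.g₃ - hE.g₃ + g₃ + Q₁ * c₃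
  obtain ⟨⟨_, _, _, _, _, _⟩, ⟨_, _, _, _⟩, ⟨_, _⟩, ⟨_, _, _, _⟩, ⟨_, _, _, _⟩, ⟨_, _, _⟩, ⟨_, _⟩,
    ⟨_, _⟩, ⟨_, _, _⟩, _, _, _⟩ := hC
  obtain ⟨⟨_, _, _, _, _, _⟩, ⟨_, _, _, _⟩, ⟨_, _⟩, ⟨_, _, _, _⟩, ⟨_, _, _, _⟩, ⟨_, _, _⟩, ⟨_, _⟩,
    ⟨_, _⟩, ⟨_, _, _⟩, _, _, _⟩ := hC'
  ext <;> simp only [*]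

variable {K : Type u} [Field K] {q Q₁ s : K} {C : AnsatzConstants K}

namespace IsBraidSolution

/-- The case `q d₁ = 1`, `d₂ = 0` does not occur. -/
theorem d₂_ne_zero_of_mul_d₁_eq_one (h : C.IsBraidSolution q Q₁) (hQ : Q₁ ≠ q ^ 2)
    (hQ' : Q₁ ≠ -q ^ 2) (hQ'' : Q₁ ^ 2 + Q₁ * q ^ 2 + q ^ 4 ≠ 0) (hd₁ : q * C.d₁ = 1) :
    C.d₂ ≠ 0 := by
  intro hd₂
  have hd₁0 : C.d₁ ≠ 0 := by rintro h0; simp [h0] at hd₁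
  have hf₂ : C.f₂ = 0 := by rw [h.f₂, hd₁, sub_self]
  have hf₁ : C.f₁ = q := by rw [h.f₁, hd₂]; ring
  have hcz : q ^ 2 * C.c₂ * C.z = 1 := by
    have := h.left_as_a_nn
    rw [hf₂] at this
    linear_combination q ^ 2 * this + (q * C.d₁ + 1) * hd₁
  have hz : C.z ≠ 0 := by rintro h0; simp [h0] at hcz
  have hg₂ : C.g₂ = 0 := by
    have := h.left_an_n
    rw [hf₂] at this
    simpa [hz] using this
  have hg₃ : C.g₃ = 0 := by
    have := h.right_n_an_nn
    rw [hd₂, hg₂] at this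
    simpa [hd₁0] using this
  have hb₂ : C.b₂ = Q₁ * C.c₂ - 1 := by linear_combination hg₂ - h.g₂
  have hb₃ : C.b₃ = Q₁ + Q₁ * C.c₃ := by linear_combination hg₃ - h.g₃
  have h₁ := h.left_as_a_aa
  have h₂ := h.left_as_a_sa
  have h₃ := h.right_a_as_aa
  have h₄ := h.right_a_as_nn
  rw [hb₃, hd₂] at h₁
  rw [hb₂, hd₂] at h₂
  rw [hb₂, hf₂] at h₃
  rw [hb₂, hb₃, hd₂, hf₂, hf₁] at h₄
  -- In every case the equations give `Q₁ ^ 2 = q ^ 4` or `Q₁ ^ 3 = q ^ 6`.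
  have hsq : Q₁ ^ 2 ≠ q ^ 4 := fun h' => by
    have : (Q₁ - q ^ 2) * (Q₁ + q ^ 2) = 0 := by linear_combination h'
    rcases mul_eq_zero.1 this with h' | h'
    · exact hQ (by linear_combination h')
    · exact hQ' (by linear_combination h')
  have hcube : Q₁ ^ 3 ≠ q ^ 6 := fun h' => by
    have : (Q₁ - q ^ 2) * (Q₁ ^ 2 + Q₁ * q ^ 2 + q ^ 4) = 0 := by linear_combination h'
    rcases mul_eq_zero.1 this with h' | h'
    · exact hQ (by linear_combination h')
    · exact hQ'' h'
  have h₂' : C.c₃ * (Q₁ * C.c₂ - 1) = 0 := by linear_combination h₂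
  have h₄' : C.z * Q₁ * (1 + C.c₃) = q ^ 2 := by linear_combination h₄ + Q₁ * h₂'
  by_cases hc₃ : C.c₃ = 0
  · rw [hc₃] at h₄'
    have h₃' : (Q₁ * C.c₂ - 1) * (C.z - Q₁ * C.c₂) = 0 := by linear_combination h₃
    rcases mul_eq_zero.1 h₃' with hu | hu
    · exact hsq (by linear_combination Q₁ * q ^ 2 * C.z * hu - Q₁ ^ 2 * hcz + q ^ 2 * h₄')
    · exact hcube (by linear_combination -Q₁ ^ 3 * hcz - Q₁ ^ 2 * q ^ 2 * C.z * hu +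
        q ^ 2 * (C.z * Q₁ + q ^ 2) * h₄')
  · have hu : Q₁ * C.c₂ - 1 = 0 := by simpa [hc₃] using h₂'
    have hz' : Q₁ * (1 + C.c₃ - C.z) = 0 := mul_left_cancel₀ hc₃ (by linear_combination h₁)
    have hz'' : q ^ 2 * C.z = Q₁ := by linear_combination Q₁ * hcz - q ^ 2 * C.z * hu
    exact hcube (by linear_combination -Q₁ * (q ^ 2 * C.z + Q₁) * hz'' + q ^ 4 * h₄' -
      q ^ 4 * C.z * hz')

/-- The branch `d₂ = 0`, `c₁ = 0`, in which `g₁ ^ 2 = z = (q / s) ^ 2`. -/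
theorem eq_fibTable_one (h : C.IsBraidSolution q Q₁) (hC : C.IsPrimitive) (hq : q ≠ 0)
    (hQ0 : Q₁ ≠ 0) (hQ : Q₁ ≠ q ^ 2) (hs : s ^ 2 = Q₁) (hz : C.z = q ^ 2 / Q₁)
    (hd₁ : C.d₁ = q / Q₁) (hd₂ : C.d₂ = 0) (hc₁ : C.c₁ = 0) (hc₃ : C.c₃ = 0) (hg₃ : C.g₃ = 0)
    (hg₁ : C.g₁ = -(q / s)) : C = fibTable q Q₁ s 1 := by
  have hs0 : s ≠ 0 := by rintro rfl; simp [eq_comm] at hs; exact hQ0 hs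
  subst hs
  have h₁ := h.left_as_a_nn
  have h₂ := h.left_an_n
  rw [hc₁, hd₁, hz] at h₁
  rw [h.f₂, hd₁, hz, hg₁] at h₂
  have hc₂ : C.c₂ = 1 / s ^ 2 := by
    field_simp at h₁ ⊢
    refine mul_left_cancel₀ (pow_ne_zero 2 hq) ?_
    linear_combination h₁
  have hg₂ : C.g₂ = (q ^ 2 - s ^ 2) * (s + q) / (q * s ^ 2) := by
    field_simp at h₂ ⊢
    linear_combination h₂
  exact hC.eq_of_isEigen (fibTable_isPrimitive 1) h.toIsEigen (fibTable_isEigen hq hQ0 hQ rfl 1)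
    hz hd₁ hd₂ hg₁ hg₂ hg₃ hc₁ hc₂ hc₃

/-- For `d₂ = 0`, either `c₁ = 0` and `g₁` is a square root of `z`, or `c₁ ≠ 0` and `g₁ = z`. -/
theorem eq_fibTable_of_d₂_eq_zero (h : C.IsBraidSolution q Q₁) (hC : C.IsPrimitive) (hq : q ≠ 0)
    (hQ0 : Q₁ ≠ 0) (hQ : Q₁ ≠ q ^ 2) (hs : s ^ 2 = Q₁) (hd₁ : q * C.d₁ ≠ 1) (hd₂ : C.d₂ = 0) :
    ∃ i, C = fibTable q Q₁ s i := by
  have hf₂0 : C.f₂ ≠ 0 := by rw [h.f₂]; exact sub_ne_zero.2 hd₁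
  have hf₁ : C.f₁ = q := by rw [h.f₁, hd₂]; ring
  have hzd : C.z = q * C.d₁ := mul_right_cancel₀ hf₂0 (by linear_combination h.right_a_an)
  have hf₂ : C.f₂ = C.z - 1 := by rw [h.f₂, hzd]
  have hc₃ : C.c₃ = 0 := by simpa [hd₂, hf₂0] using h.right_s_an_sa
  have hb₃ : C.b₃ = Q₁ := by
    refine mul_left_cancel₀ (mul_ne_zero hq hf₂0) ?_
    have := h.left_an_s
    rw [hd₂, hf₁] at this
    linear_combination -this
  have hg₃ : C.g₃ = 0 := by rw [h.g₃, hb₃, hc₃]; ring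
  have hz : C.z = q ^ 2 / Q₁ := by
    have := h.right_a_as_nn
    rw [hb₃, hd₂, hc₃, hg₃, hf₁] at this
    rw [eq_div_iff hQ0]
    linear_combination this
  have hd₁' : C.d₁ = q / Q₁ := by
    refine mul_left_cancel₀ hq ?_
    rw [← hzd, hz]; ring
  have h₁ := h.left_as_a_nn
  have h₂ := h.right_n_an_na
  have h₃ := h.left_an_n
  have h₄ := h.right_n_as
  rw [hf₂] at h₁
  rw [hd₂] at h₂
  rw [hf₂, mul_right_comm, ← hzd] at h₃
  rw [hd₂, hf₁, hf₂] at h₄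
  by_cases hc₁ : C.c₁ = 0
  · have hg₁ : C.g₁ ^ 2 = (q / s) ^ 2 := by
      rw [div_pow, hs, ← hz, hzd]
      rw [hc₁] at h₄
      linear_combination -h₄
    rcases sq_eq_sq_iff_eq_or_eq_neg.1 hg₁ with hg₁ | hg₁
    · refine ⟨2, ?_⟩
      rw [fibTable_two]
      exact h.eq_fibTable_one hC hq hQ0 hQ (by rw [neg_sq, hs]) hz hd₁' hd₂ hc₁ hc₃ hg₃
        (by rw [hg₁, div_neg, neg_neg])
    · exact ⟨1, h.eq_fibTable_one hC hq hQ0 hQ hs hz hd₁' hd₂ hc₁ hc₃ hg₃ hg₁⟩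
  · have hg₂ : C.g₂ = 0 := by
      refine mul_right_cancel₀ (mul_ne_zero (pow_ne_zero 2 hq) hc₁) ?_
      linear_combination -h₂
    have hz1 : C.z - 1 ≠ 0 := hf₂ ▸ hf₂0
    have hg₁ : C.g₁ = C.z := by
      refine mul_right_cancel₀ hz1 ?_
      rw [hg₂] at h₃
      linear_combination h₃
    have hc₁' : C.c₁ = -(q ^ 2 / Q₁ ^ 2) := by
      have : Q₁ * C.c₁ = -C.z := by
        refine mul_left_cancel₀ hz1 ?_
        rw [hg₁, hg₂] at h₄
        linear_combination -hzd - h₄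
      rw [hz] at this
      field_simp at this ⊢
      linear_combination this
    have hc₂ : C.c₂ = q ^ 2 / Q₁ ^ 2 := by
      rw [hc₁', hz, hd₁'] at h₁
      field_simp at h₁ ⊢
      linear_combination h₁
    exact ⟨0, hC.eq_of_isEigen (fibTable_isPrimitive 0) h.toIsEigen
      (fibTable_isEigen hq hQ0 hQ hs 0) hz hd₁' hd₂ (hg₁.trans hz) hg₂ hg₃ hc₁' hc₂ hc₃⟩

/-- The branch `d₂ ≠ 0`, `g₁ ^ 2 = z = (s / q) ^ 2`. -/
theorem eq_fibTable_four (h : C.IsBraidSolution q Q₁) (hC : C.IsPrimitive) (hq : q ≠ 0)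
    (hQ0 : Q₁ ≠ 0) (hQ : Q₁ ≠ q ^ 2) (hs : s ^ 2 = Q₁) (hz : C.z = Q₁ / q ^ 2)
    (hd₁ : C.d₁ = q⁻¹) (hd₂ : C.d₂ = (Q₁ - q ^ 2) / q ^ 2) (hc₂ : C.c₂ = 1 / Q₁) (hg₂ : C.g₂ = 0)
    (hg₁ : C.g₁ = s / q) : C = fibTable q Q₁ s 4 := by
  have hs0 : s ≠ 0 := by rintro rfl; simp [eq_comm] at hs; exact hQ0 hs
  subst hs
  have hp : s + q ≠ 0 := fun h => hQ (by linear_combination (s - q) * h)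
  have hm : s - q ≠ 0 := fun h => hQ (by linear_combination (s + q) * h)
  have h₁ := h.right_s_an_nn
  have h₂ := h.right_n_an_nn
  have h₃ := h.right_s_an_sn
  rw [hg₁, hc₂, hd₂, hd₁] at h₁
  rw [h.f₁, hd₁, hd₂, hg₁, hg₂] at h₂
  have hc₁ : C.c₁ = -((q + s) / (q * s ^ 2)) := by
    field_simp at h₁ ⊢
    refine mul_left_cancel₀ hm ?_
    linear_combination h₁
  have hg₃ : C.g₃ = (fibTable q (s ^ 2) s 4).g₃ := by
    rw [fibTable_four_g₃ hs0 hp]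
    field_simp at h₂ ⊢
    linear_combination h₂
  have hc₃ : C.c₃ = (q ^ 2 - s ^ 2) * (q - s) / (q ^ 2 * s) := by
    rw [fibTable_four_g₃ hs0 hp] at hg₃
    rw [hc₁, hg₃, h.f₁, hd₁, hd₂] at h₃
    field_simp at h₃ ⊢
    refine mul_left_cancel₀ (mul_ne_zero hm hp) ?_
    linear_combination h₃
  exact hC.eq_of_isEigen (fibTable_isPrimitive 4) h.toIsEigen (fibTable_isEigen hq hQ0 hQ rfl 4)
    hz hd₁ hd₂ hg₁ hg₂ hg₃ hc₁ hc₂ hc₃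

/-- For `d₂ ≠ 0`, elimination of `c₁` gives `(g₁ - z) (g₁ ^ 2 - z) = 0`. -/
theorem eq_fibTable_of_d₂_ne_zero (h : C.IsBraidSolution q Q₁) (hC : C.IsPrimitive) (hq : q ≠ 0)
    (hQ0 : Q₁ ≠ 0) (hQ : Q₁ ≠ q ^ 2) (hs : s ^ 2 = Q₁) (hd₂ : C.d₂ ≠ 0) :
    ∃ i, C = fibTable q Q₁ s i := by
  have hqd : q * C.d₁ = 1 := by
    refine mul_left_cancel₀ hd₂ ?_
    have := h.left_an_a_na
    rw [h.f₂] at this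
    linear_combination this
  have hd₁ : C.d₁ = q⁻¹ := eq_inv_of_mul_eq_one_right hqd
  have hf₂ : C.f₂ = 0 := by rw [h.f₂, hqd, sub_self]
  have hz1 : C.z = 1 + C.d₂ := by
    refine mul_left_cancel₀ (mul_ne_zero hq hd₂) ?_
    have := h.left_an_a_aa
    rw [h.f₁] at this
    linear_combination -this
  have hc₂ : C.c₂ = 1 / Q₁ := by
    rw [eq_div_iff hQ0]
    refine mul_left_cancel₀ hd₂ ?_
    have := h.right_s_an_sa
    rw [hf₂] at this
    linear_combination this + C.d₂ * hqd
  have hz : C.z = Q₁ / q ^ 2 := by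
    have := h.left_as_a_nn
    rw [hf₂, hc₂, hd₁] at this
    field_simp at this ⊢
    linear_combination this
  have hd₂' : C.d₂ = (Q₁ - q ^ 2) / q ^ 2 := by
    rw [sub_div, div_self (pow_ne_zero 2 hq), ← hz, hz1]; ring
  have hz0 : C.z ≠ 0 := by rw [hz]; exact div_ne_zero hQ0 (pow_ne_zero 2 hq)
  have hg₂ : C.g₂ = 0 := by simpa [hf₂, hz0] using h.left_an_n
  have h₁ : Q₁ * C.c₁ * (1 - C.g₁) = C.d₂ := by
    have := h.right_s_an_nn
    rw [hc₂] at this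
    field_simp at this
    linear_combination -this - Q₁ * C.c₁ * hqd
  have h₂ := h.right_n_as
  rw [hf₂, h.f₁, hg₂] at h₂
  have key : (C.g₁ - C.z) * (C.g₁ ^ 2 - C.z) = 0 := by
    rw [hz1]
    linear_combination (1 - C.g₁) * (h₂ - (1 + C.d₂) * hqd + C.d₂ * h.g₁) - C.d₂ * h₁
  rcases mul_eq_zero.1 key with hg | hg
  · have hg₁ : C.g₁ = C.z := sub_eq_zero.1 hg
    have hc₁ : C.c₁ = -1 / Q₁ := by
      rw [eq_div_iff hQ0]
      refine mul_left_cancel₀ hd₂ ?_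
      rw [hg₁, hz1] at h₁
      linear_combination -h₁
    have hg₃ : C.g₃ = 0 := by
      have := h.right_n_an_nn
      rw [h.f₁, hg₁, hg₂, hz1] at this
      refine mul_left_cancel₀ (inv_ne_zero hq) ?_
      rw [← hd₁]
      linear_combination this
    have hc₃ : C.c₃ = C.d₂ := by
      have := h.right_s_an_sn
      rw [hg₃, h.f₁] at this
      refine mul_left_cancel₀ (mul_ne_zero hq hd₂) ?_
      linear_combination this + q * C.c₃ * hqd
    exact ⟨3, hC.eq_of_isEigen (fibTable_isPrimitive 3) h.toIsEigen
      (fibTable_isEigen hq hQ0 hQ hs 3) hz hd₁ hd₂' (hg₁.trans hz) hg₂ hg₃ hc₁ hc₂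
      (hc₃.trans hd₂')⟩
  · have hg₁ : C.g₁ ^ 2 = (s / q) ^ 2 := by
      rw [div_pow, hs, ← hz]
      linear_combination hg
    rcases sq_eq_sq_iff_eq_or_eq_neg.1 hg₁ with hg₁ | hg₁
    · exact ⟨4, h.eq_fibTable_four hC hq hQ0 hQ hs hz hd₁ hd₂' hc₂ hg₂ hg₁⟩
    · refine ⟨5, ?_⟩
      rw [fibTable_five]
      exact h.eq_fibTable_four hC hq hQ0 hQ (by rw [neg_sq, hs]) hz hd₁ hd₂' hc₂ hg₂
        (by rw [hg₁, neg_div])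

end IsBraidSolution

end AnsatzConstants

/-! ### The six solutions -/

section Field

variable {K : Type u} [Field K] {q Q₁ s : K}

theorem HasAnsatzForm.exists_eq_fibTable {C : AnsatzConstants K}
    {H : BraidedHopfStructure K (FibOsc q Q₁)} (hH : HasAnsatzForm H C) (hq : q ≠ 0) (hQ0 : Q₁ ≠ 0)
    (hQ : Q₁ ≠ q ^ 2) (hQ' : Q₁ ≠ -q ^ 2) (hQ'' : Q₁ ^ 2 + Q₁ * q ^ 2 + q ^ 4 ≠ 0)
    (hs : s ^ 2 = Q₁) : ∃ i, C = fibTable q Q₁ s i := by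
  have hC := hH.isPrimitive hq
  have h := hH.isBraidSolution hC
  by_cases hd₂ : C.d₂ = 0
  · exact h.eq_fibTable_of_d₂_eq_zero hC hq hQ0 hQ hs
      (fun hd₁ => h.d₂_ne_zero_of_mul_d₁_eq_one hQ hQ' hQ'' hd₁ hd₂) hd₂
  · exact h.eq_fibTable_of_d₂_ne_zero hC hq hQ0 hQ hs hd₂

/-- The constants `z` and `g₁` separate the six solutions. -/
theorem eq_of_fibTable_z_eq (h2 : (2 : K) ≠ 0) (hq : q ≠ 0) (hQ0 : Q₁ ≠ 0)
    (hQ : Q₁ ≠ q ^ 2) (hQ' : Q₁ ≠ -q ^ 2) (hs : s ^ 2 = Q₁) {i j : Fin 6}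
    (hz : (fibTable q Q₁ s i).z = (fibTable q Q₁ s j).z)
    (hg : (fibTable q Q₁ s i).g₁ = (fibTable q Q₁ s j).g₁) : i = j := by
  subst hs
  have hs0 : s ≠ 0 := by rintro rfl; simp at hQ0
  have hp : s + q ≠ 0 := fun h => hQ (by linear_combination (s - q) * h)
  have hm : s - q ≠ 0 := fun h => hQ (by linear_combination (s + q) * h)
  have hpm : s ^ 2 + q ^ 2 ≠ 0 := fun h => hQ' (by linear_combination h)
  have n₁ : q ^ 2 / s ^ 2 ≠ s ^ 2 / q ^ 2 := fun h => by
    field_simp at h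
    exact mul_ne_zero (mul_ne_zero hp hm) hpm (by linear_combination -h)
  have n₂ : q ^ 2 / s ^ 2 ≠ -(q / s) := fun h => by
    field_simp at h
    exact hp (by linear_combination h)
  have n₃ : q ^ 2 / s ^ 2 ≠ q / s := fun h => by
    field_simp at h
    exact hm (by linear_combination -h)
  have n₄ : -(q / s) ≠ q / s := fun h =>
    mul_ne_zero h2 (div_ne_zero hq hs0) (by linear_combination -h)
  have n₅ : s ^ 2 / q ^ 2 ≠ s / q := fun h => by
    field_simp at h
    exact hm (by linear_combination h)
  have n₆ : s ^ 2 / q ^ 2 ≠ -(s / q) := fun h => by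
    field_simp at h
    exact hp (by linear_combination h)
  have n₇ : s / q ≠ -(s / q) := fun h =>
    mul_ne_zero h2 (div_ne_zero hs0 hq) (by linear_combination h)
  fin_cases i <;> fin_cases j
  all_goals first
    | rfl
    | exact (n₁ hz).elim
    | exact (n₁ hz.symm).elim
    | exact (n₂ hg).elim
    | exact (n₂ hg.symm).elim
    | exact (n₃ hg).elim
    | exact (n₃ hg.symm).elim
    | exact (n₄ hg).elim
    | exact (n₄ hg.symm).elim
    | exact (n₅ hg).elim
    | exact (n₅ hg.symm).elim
    | exact (n₆ hg).elim
    | exact (n₆ hg.symm).elim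
    | exact (n₇ hg).elim
    | exact (n₇ hg.symm).elim

theorem HasAnsatzForm.z_eq {C C' : AnsatzConstants K} {H : BraidedHopfStructure K (FibOsc q Q₁)}
    (hH : HasAnsatzForm H C) (hH' : HasAnsatzForm H C') : C.z = C'.z := by
  have := congrArg (LinearMap.mul' K K ∘ₗ TensorProduct.map (FibOsc.coord q Q₁ .a)
    (FibOsc.coord q Q₁ .a)) (hH.braiding_a_a.symm.trans hH'.braiding_a_a)
  simpa [FibOsc.a, FibOsc.coord_gen] using this

theorem HasAnsatzForm.g₁_eq {C C' : AnsatzConstants K} {H : BraidedHopfStructure K (FibOsc q Q₁)}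
    (hH : HasAnsatzForm H C) (hH' : HasAnsatzForm H C') : C.g₁ = C'.g₁ := by
  have := congrArg (LinearMap.mul' K K ∘ₗ TensorProduct.map (FibOsc.coord q Q₁ .qN)
    (FibOsc.coord q Q₁ .qN)) (hH.braiding_qN_qN.symm.trans hH'.braiding_qN_qN)
  simpa [FibOsc.a, FibOsc.qN, FibOsc.aStar, FibOsc.coord_gen, FibOsc.coord_one] using this

theorem exactlySixSolutions (h2 : (2 : K) ≠ 0) (hq : q ≠ 0) (hQ0 : Q₁ ≠ 0)
    (hQ : Q₁ ≠ q ^ 2) (hQ' : Q₁ ≠ -q ^ 2) (hQ'' : Q₁ ^ 2 + Q₁ * q ^ 2 + q ^ 4 ≠ 0)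
    (hs : s ^ 2 = Q₁) : ExactlySixSolutions q Q₁ s := by
  have hex (i : Fin 6) := (fibTable_isPrimitive (q := q) (Q₁ := Q₁) (s := s) i
    ).existsUnique_hasAnsatzForm (isCompatibleBraiding_fibTable hq hQ0 hQ hQ' hs i)
  refine ⟨fun i j hij => eq_of_fibTable_z_eq h2 hq hQ0 hQ hQ' hs (congrArg _ hij) (congrArg _ hij),
    hex, fun H C hH => hH.exists_eq_fibTable hq hQ0 hQ hQ' hQ'' hs, ?_⟩
  choose F hF hF' using hex
  have hset : {H : BraidedHopfStructure K (FibOsc q Q₁) | ∃ C, HasAnsatzForm H C} =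
      F '' Set.univ := by
    ext H
    simp only [Set.mem_ofPred_eq, Set.image_univ, Set.mem_range]
    constructor
    · rintro ⟨C, hC⟩
      obtain ⟨i, rfl⟩ := hC.exists_eq_fibTable hq hQ0 hQ hQ' hQ'' hs
      exact ⟨i, (hF' i H hC).symm⟩
    · rintro ⟨i, rfl⟩
      exact ⟨_, hF i⟩
  have hinj : Function.Injective F := fun i j hij => by
    have hj := hF j
    rw [← hij] at hj
    exact eq_of_fibTable_z_eq h2 hq hQ0 hQ hQ' hs ((hF i).z_eq hj) ((hF i).g₁_eq hj)
  rw [hset, Set.ncard_image_of_injective _ hinj, Set.ncard_univ, Nat.card_eq_fintype_card,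
    Fintype.card_fin]

end Field

/-! ### The `*`-structure -/

namespace FibOsc

/-- The universal property of the oscillator algebra with scalars acting through a central ring
homomorphism. -/
theorem exists_ringHom {K : Type*} [CommRing K] (q Q₁ : K) {B : Type*} [Ring B] (g : K →+* B)
    (hg : ∀ c x, g c * x = x * g c) (f : OscGen → B)
    (h₁ : f .a * f .qN = g q * (f .qN * f .a))
    (h₂ : f .qN * f .aStar = g q * (f .aStar * f .qN))
    (h₃ : f .a * f .aStar = g Q₁ * (f .aStar * f .a) + f .qN * f .qN) :
    ∃ φ : FibOsc q Q₁ →+* B, (∀ x, φ (gen q Q₁ x) = f x) ∧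
      ∀ (c : K) (x : FibOsc q Q₁), φ (c • x) = g c * φ x := by
  let _ : Algebra K B := g.toAlgebra' hg
  obtain ⟨φ, hφ⟩ := exists_lift q Q₁ f h₁ h₂ h₃
  exact ⟨φ.toRingHom, hφ, fun c x => map_smul φ c x⟩

/-- The universal property of the oscillator algebra for semilinear anti-multiplicative maps. -/
theorem exists_antiHom {K A : Type*} [CommRing K] [Ring A] [Algebra K A] {q Q₁ : K} (σ : K →+* K)
    (hq : σ q = q) (hQ : σ Q₁ = Q₁) (f : OscGen → A) (h₁ : f .qN * f .a = q • (f .a * f .qN))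
    (h₂ : f .aStar * f .qN = q • (f .qN * f .aStar))
    (h₃ : f .aStar * f .a = Q₁ • (f .a * f .aStar) + f .qN * f .qN) :
    ∃ st : FibOsc q Q₁ →ₛₗ[σ] A, st 1 = 1 ∧ (∀ x y, st (x * y) = st y * st x) ∧
      ∀ i, st (gen q Q₁ i) = f i := by
  let g : K →+* Aᵐᵒᵖ := (algebraMap K Aᵐᵒᵖ).comp σ
  have hg (c : K) (x : A) : g c * MulOpposite.op x = MulOpposite.op (σ c • x) := by
    rw [RingHom.comp_apply, ← Algebra.smul_def, MulOpposite.op_smul]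
  obtain ⟨φ, hφ, hφ'⟩ := exists_ringHom q Q₁ g (fun c x => Algebra.commutes (σ c) x)
    (fun i => MulOpposite.op (f i))
    (by simp only [← MulOpposite.op_mul, hg, hq, h₁])
    (by simp only [← MulOpposite.op_mul, hg, hq, h₂])
    (by simp only [← MulOpposite.op_mul, hg, hQ, h₃, MulOpposite.op_add])
  refine ⟨{ toFun := fun x => (φ x).unop, map_add' := fun x y => ?_, map_smul' := fun c x => ?_ },
    ?_, fun x y => ?_, fun i => ?_⟩
  · rw [map_add, MulOpposite.unop_add]
  · rw [hφ', ← MulOpposite.op_unop (φ x), hg, MulOpposite.unop_op, MulOpposite.unop_op]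
  · exact congrArg MulOpposite.unop (map_one φ)
  · exact congrArg MulOpposite.unop (map_mul φ x y)
  · exact congrArg MulOpposite.unop (hφ i)

end FibOsc

/-- The exchange of the generators `a` and `a*`. -/
def OscGen.swap : OscGen → OscGen
  | .a => .aStar
  | .aStar => .a
  | .qN => .qN

theorem FibOsc.exists_isOscStar {𝕜 : Type*} [RCLike 𝕜] (q Q₁ : ℝ) :
    ∃ st : FibOsc (q : 𝕜) (Q₁ : 𝕜) →ₛₗ[starRingEnd 𝕜] FibOsc (q : 𝕜) (Q₁ : 𝕜), IsOscStar st := by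
  obtain ⟨st, h₁, hm, hst⟩ := FibOsc.exists_antiHom (starRingEnd 𝕜) (RCLike.conj_ofReal q)
    (RCLike.conj_ofReal Q₁) (fun i => gen (q : 𝕜) (Q₁ : 𝕜) i.swap) (qN_mul_aStar _ _)
    (a_mul_qN _ _) (a_mul_aStar _ _)
  exact ⟨st, h₁, hm, hst .a, hst .aStar, hst .qN⟩

section star

variable {𝕜 : Type u} [RCLike 𝕜]

theorem IsOscStar.map_gen {q Q₁ : 𝕜} {st : FibOsc q Q₁ →ₛₗ[starRingEnd 𝕜] FibOsc q Q₁}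
    (h : IsOscStar st) (i : OscGen) : st (FibOsc.gen q Q₁ i) = FibOsc.gen q Q₁ i.swap := by
  cases i
  · exact h.map_a
  · exact h.map_aStar
  · exact h.map_qN

theorem IsOscStar.eq {q Q₁ : 𝕜} {st st' : FibOsc q Q₁ →ₛₗ[starRingEnd 𝕜] FibOsc q Q₁}
    (h : IsOscStar st) (h' : IsOscStar st') : st = st' := by
  refine LinearMap.ext fun x => ?_
  induction x using (FibOsc.isQuadraticPresentation q Q₁).induction_left with
  | one => rw [h.map_one, h'.map_one]
  | gen_mul i x ih => rw [h.map_mul, h'.map_mul, ih, h.map_gen, h'.map_gen]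
  | add x y hx hy => rw [map_add, map_add, hx, hy]
  | smul c x hx => rw [map_smulₛₗ, map_smulₛₗ, hx]

theorem AnsatzConstants.map_braidMatrix_eq {K : Type u} [CommRing K] (σ : K →+* K)
    (C : AnsatzConstants K) (hz : σ C.z = C.z) (hd₁ : σ C.d₁ = C.d₁) (hd₂ : σ C.d₂ = C.d₂)
    (hf₁ : σ C.f₁ = C.f₁) (hf₂ : σ C.f₂ = C.f₂) (hg₁ : σ C.g₁ = C.g₁) (hg₂ : σ C.g₂ = C.g₂)
    (hg₃ : σ C.g₃ = C.g₃) (hb₁ : σ C.b₁ = C.b₁) (hb₂ : σ C.b₂ = C.b₂) (hb₃ : σ C.b₃ = C.b₃)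
    (hc₁ : σ C.c₁ = C.c₁) (hc₂ : σ C.c₂ = C.c₂) (hc₃ : σ C.c₃ = C.c₃) (i j k l : OscGen) :
    σ (C.braidMatrix i j k l) = C.braidMatrix i j k l := by
  cases i <;> cases j <;> cases k <;> cases l <;> simp only [braidMatrix, map_zero, *]

theorem conj_braidMatrix_fibTable (q Q₁ s : ℝ) (n : Fin 6) (i j k l : OscGen) :
    starRingEnd 𝕜 ((fibTable (q : 𝕜) (Q₁ : 𝕜) (s : 𝕜) n).braidMatrix i j k l) =
      (fibTable (q : 𝕜) (Q₁ : 𝕜) (s : 𝕜) n).braidMatrix i j k l := by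
  refine AnsatzConstants.map_braidMatrix_eq _ _ ?_ ?_ ?_ ?_ ?_ ?_ ?_ ?_ ?_ ?_ ?_ ?_ ?_ ?_ i j k l <;>
    fin_cases n <;>
    simp only [fibTable, commonConstants, Fin.zero_eta, Fin.mk_one, Fin.reduceFinMk,
      Matrix.cons_val, map_div₀, map_mul, map_sub, map_add, map_neg, map_pow, map_inv₀, map_one,
      map_zero, RCLike.conj_ofReal]

/-- The ansatz is symmetric under the exchange of `a` and `a*` together with the flip. -/
theorem AnsatzConstants.braidMatrix_swap {K : Type u} [Zero K] (C : AnsatzConstants K)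
    (i j k l : OscGen) : C.braidMatrix j.swap i.swap l.swap k.swap = C.braidMatrix i j k l := by
  cases i <;> cases j <;> cases k <;> cases l <;> rfl

theorem OscGen.sum_swap {M : Type*} [AddCommMonoid M] (f : OscGen → M) :
    ∑ x : OscGen, f x.swap = ∑ x, f x := by
  simp only [OscGen.sum_eq, OscGen.swap]
  rw [add_comm (f .aStar)]

/-- The structures of the table for a real square root are compatible with the `*`-structure: by
`braidMatrix_swap` and the reality of the constants, this holds for the braiding of generators. -/
theorem IsOscStar.isStarCompatible {q Q₁ s : ℝ}
    {st : FibOsc (q : 𝕜) (Q₁ : 𝕜) →ₛₗ[starRingEnd 𝕜] FibOsc (q : 𝕜) (Q₁ : 𝕜)} (hst : IsOscStar st)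
    {n : Fin 6} {H : BraidedHopfStructure 𝕜 (FibOsc (q : 𝕜) (Q₁ : 𝕜))}
    (hH : HasAnsatzForm H (fibTable (q : 𝕜) (Q₁ : 𝕜) (s : 𝕜) n))
    (hR : IsCompatibleBraiding (fibRelCoeff (q : 𝕜) (Q₁ : 𝕜))
      (fibTable (q : 𝕜) (Q₁ : 𝕜) (s : 𝕜) n).braidMatrix) : IsStarCompatible st H := by
  have h : IsBraidedQuadratic (FibOsc.gen (q : 𝕜) (Q₁ : 𝕜)) (fibRelCoeff (q : 𝕜) (Q₁ : 𝕜))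
      (fibTable (q : 𝕜) (Q₁ : 𝕜) (s : 𝕜) n).braidMatrix :=
    { FibOsc.isQuadraticPresentation (q : 𝕜) (Q₁ : 𝕜), hR with }
  obtain rfl := hH.eq_braidedHopf (fibTable_isPrimitive n) h
  have hR' (i j : OscGen) :
      h.braiding (FibOsc.gen (q : 𝕜) (Q₁ : 𝕜) j.swap ⊗ₜ FibOsc.gen (q : 𝕜) (Q₁ : 𝕜) i.swap) =
        ∑ k, ∑ l, starRingEnd 𝕜 ((fibTable (q : 𝕜) (Q₁ : 𝕜) (s : 𝕜) n).braidMatrix i j k l) •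
          (FibOsc.gen (q : 𝕜) (Q₁ : 𝕜) l.swap ⊗ₜ FibOsc.gen (q : 𝕜) (Q₁ : 𝕜) k.swap) := by
    rw [h.braiding_gen_gen, Finset.sum_comm, ← OscGen.sum_swap]
    refine Finset.sum_congr rfl fun k _ => ?_
    rw [← OscGen.sum_swap]
    refine Finset.sum_congr rfl fun l _ => ?_
    rw [conj_braidMatrix_fibTable, AnsatzConstants.braidMatrix_swap]
  exact ⟨h.comul_star st OscGen.swap hst.map_one hst.map_mul hst.map_gen hR',
    h.antipode_star st OscGen.swap hst.map_one hst.map_mul hst.map_gen hR'⟩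

end star

theorem mainTheorem2 (𝕜 : Type*) [RCLike 𝕜] :
    (∀ (q Q₁ : ℝ) (s : 𝕜), q ≠ 0 → Q₁ ≠ 0 → Q₁ ≠ q ^ 2 → Q₁ ≠ -q ^ 2 → s ^ 2 = (Q₁ : 𝕜) →
      ExactlySixSolutions (q : 𝕜) (Q₁ : 𝕜) s) ∧
    (∀ q : ℝ, q ≠ 0 → q ≠ 1 → q ≠ -1 →
      ExactlySixSolutions (q : 𝕜) (((q : 𝕜) ^ 2)⁻¹) ((q : 𝕜)⁻¹)) ∧
    (∀ q Q₁ : ℝ, q ≠ 0 → 0 < Q₁ → Q₁ ≠ q ^ 2 →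
      ∃! st : FibOsc (q : 𝕜) (Q₁ : 𝕜) →ₛₗ[starRingEnd 𝕜] FibOsc (q : 𝕜) (Q₁ : 𝕜),
        IsOscStar st ∧
        ∀ (H : BraidedHopfStructure 𝕜 (FibOsc (q : 𝕜) (Q₁ : 𝕜))) (C : AnsatzConstants 𝕜),
          HasAnsatzForm H C → IsStarCompatible st H) := by
  -- The factor of `Q₁ ^ 3 - q ^ 6` other than `Q₁ - q ^ 2` has no real zeros.
  have hpos (q Q₁ : ℝ) (hq : q ≠ 0) : Q₁ ^ 2 + Q₁ * q ^ 2 + q ^ 4 ≠ 0 := by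
    have : 0 < q ^ 4 := by positivity
    nlinarith [sq_nonneg (2 * Q₁ + q ^ 2)]
  have six (q Q₁ : ℝ) (s : 𝕜) (hq : q ≠ 0) (hQ0 : Q₁ ≠ 0) (hQ : Q₁ ≠ q ^ 2) (hQ' : Q₁ ≠ -q ^ 2)
      (hs : s ^ 2 = (Q₁ : 𝕜)) : ExactlySixSolutions (q : 𝕜) (Q₁ : 𝕜) s :=
    exactlySixSolutions two_ne_zero (by exact_mod_cast hq) (by exact_mod_cast hQ0)
      (by exact_mod_cast hQ) (by exact_mod_cast hQ') (by exact_mod_cast hpos q Q₁ hq) hs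
  refine ⟨six, fun q hq hq1 hq1' => ?_, fun q Q₁ hq hQ0 hQ => ?_⟩
  · have := six q (q ^ 2)⁻¹ ((q : 𝕜)⁻¹) hq (inv_ne_zero (pow_ne_zero 2 hq)) (fun h => ?_)
      (fun h => ?_) (by push_cast; rw [inv_pow])
    · push_cast at this
      exact this
    · have h4 : (q ^ 2 - 1) * (q ^ 2 + 1) = 0 := by
        field_simp at h
        linear_combination -h
      have h5 : q ^ 2 + 1 ≠ 0 := by positivity
      have h6 : (q - 1) * (q + 1) = 0 := by linear_combination (mul_eq_zero.1 h4).resolve_right h5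
      rcases mul_eq_zero.1 h6 with h | h
      · exact hq1 (by linear_combination h)
      · exact hq1' (by linear_combination h)
    · have h7 : 0 < (q ^ 2)⁻¹ := by positivity
      nlinarith [sq_nonneg q]
  · obtain ⟨st, hst⟩ := FibOsc.exists_isOscStar (𝕜 := 𝕜) q Q₁
    have hq' : (q : 𝕜) ≠ 0 := by exact_mod_cast hq
    have hQ0' : (Q₁ : 𝕜) ≠ 0 := by exact_mod_cast hQ0.ne'
    have h₁ : (Q₁ : 𝕜) ≠ (q : 𝕜) ^ 2 := by exact_mod_cast hQ
    have h₂ : (Q₁ : 𝕜) ≠ -(q : 𝕜) ^ 2 := by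
      have : Q₁ ≠ -q ^ 2 := by nlinarith [sq_nonneg q]
      exact_mod_cast this
    have h₃ : (Q₁ : 𝕜) ^ 2 + (Q₁ : 𝕜) * (q : 𝕜) ^ 2 + (q : 𝕜) ^ 4 ≠ 0 := by
      exact_mod_cast hpos q Q₁ hq
    have hs : ((√Q₁ : ℝ) : 𝕜) ^ 2 = (Q₁ : 𝕜) := by
      rw [← RCLike.ofReal_pow, Real.sq_sqrt hQ0.le]
    refine ⟨st, ⟨hst, fun H C hH => ?_⟩, fun st' h' => h'.1.eq hst⟩
    obtain ⟨i, rfl⟩ := hH.exists_eq_fibTable hq' hQ0' h₁ h₂ h₃ hs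
    exact hst.isStarCompatible hH (isCompatibleBraiding_fibTable hq' hQ0' h₁ h₂ hs i)
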